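/- **Theorem (maximal matching in fully dynamic graphs).** For a finite undirected graph $G$ let $\alpha(G)$ be its arboricity, the least integer $a\ge 1$ such that every nonempty set $U$ of vertices spans at most $a(|U|-1)$ edges. A *fully dynamic graph* on $n$ fixed vertices starts with no edges and changes by arbitrary insertions and deletions of single edges; assume that its arboricity is at all times at most a known integer $\alpha\ge 1$. Write $\Delta_\beta(G)=\beta\,\alpha(G)+\log_\beta n$ and $\Delta(G)=\inf_{\beta>1}\Delta_\beta(G)$. There is one deterministic algorithm on the unit-cost word RAM (word length at least a suitable constant times $\log_2(n+2)$, memory initially zero) which receives $n$ and the integer parameter $\min(\lceil\beta\alpha\rceil,n)$, where $\beta>1$ is real, and which explicitly maintains a maximal matching of the graph after every update, such that the following worst-case time bounds hold, in which $G$ denotes the graph after the update for an insertion and before the update for a deletion, and the constants in (1) and (2) are absolute. 1. For every $n$, every $\alpha\ge1$ and every real $\beta>1$, an insertion takes time $O(\alpha\cdot\beta\cdot\Delta_\beta(G))$ and a deletion takes time $O(\Delta_\beta(G))$. 2. For all $n\ge 2$ and $\alpha\ge 1$ there is a real $\beta>1$ that attains the infimum $\inf_{\beta'>1}(\beta'\alpha+\log_{\beta'}n)$,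 and with this choice of $\beta$ an insertion takes time $O(\alpha\cdot\beta\cdot\Delta(G))$ and a deletion takes time $O(\Delta(G))$. 3. In particular, for each constant $\alpha$ (take $\beta=2$) every update takes time $O(\log n)$, where the constant depends only on $\alpha$. -/

import Mathlib

/-! ## Arboricity -/

/-- The arboricity of a finite graph: the least integer `a ≥ 1` such that every nonempty set `U`
of vertices spans at most `a * (|U| - 1)` edges. -/
noncomputable def arboricity {V : Type*} [Fintype V] (G : SimpleGraph V) : ℕ :=
  sInf {a : ℕ | 1 ≤ a ∧ ∀ U : Finset V, U.Nonempty →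
    (G.induce (U : Set V)).edgeSet.ncard ≤ a * (U.card - 1)}

/-! ## The word RAM

Programs are written in a structured language over a memory of `w`-bit words and a supply of
registers (each program mentions only finitely many).  Every executed elementary instruction and
every evaluated test takes one unit of time. -/

namespace WordRAM

/-- Arithmetic instructions. -/
inductive Op where
  | add
  | sub
  | mul

/-- The result of an arithmetic instruction on `w`-bit words: sums and products are taken modulo
`2 ^ w`, and subtraction stops at `0`. -/
def Op.eval (w : ℕ) : Op → ℕ → ℕ → ℕ
  | .add, x, y => (x + y) % 2 ^ w
  | .sub, x, y => x - y
  | .mul, x, y => (x * y) % 2 ^ w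

/-- Comparisons. -/
inductive Cmp where
  | lt
  | le
  | eq
  | ne

/-- The meaning of a comparison. -/
def Cmp.Holds : Cmp → ℕ → ℕ → Prop
  | .lt, x, y => x < y
  | .le, x, y => x ≤ y
  | .eq, x, y => x = y
  | .ne, x, y => x ≠ y

/-- Programs.  The arguments `r`, `a`, `b` are names of registers, and `c` is a constant. -/
inductive Cmd where
  /-- do nothing -/
  | skip
  /-- `r := c` -/
  | const (r c : ℕ)
  /-- `r := a o b` -/
  | arith (o : Op) (r a b : ℕ)
  /-- `r := mem[a]` -/
  | load (r a : ℕ)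
  /-- `mem[a] := b` -/
  | store (a b : ℕ)
  /-- first `p`, then `q` -/
  | seq (p q : Cmd)
  /-- if `a o b` then `p` else `q` -/
  | cond (o : Cmp) (a b : ℕ) (p q : Cmd)
  /-- while `a o b` do `p` -/
  | loop (o : Cmp) (a b : ℕ) (p : Cmd)

/-- A state of the machine: the contents of the registers and of the memory. -/
structure State where
  reg : ℕ → ℕ
  mem : ℕ → ℕ

/-- `Run w p s t s'`: on words of `w` bits, the program `p` started in the state `s` halts after
exactly `t` time units in the state `s'`. -/
inductive Run (w : ℕ) : Cmd → State → ℕ → State → Prop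
  | skip (s : State) : Run w .skip s 1 s
  | const (r c : ℕ) (s : State) :
      Run w (.const r c) s 1 ⟨Function.update s.reg r (c % 2 ^ w), s.mem⟩
  | arith (o : Op) (r a b : ℕ) (s : State) :
      Run w (.arith o r a b) s 1 ⟨Function.update s.reg r (o.eval w (s.reg a) (s.reg b)), s.mem⟩
  | load (r a : ℕ) (s : State) :
      Run w (.load r a) s 1 ⟨Function.update s.reg r (s.mem (s.reg a)), s.mem⟩
  | store (a b : ℕ) (s : State) :
      Run w (.store a b) s 1 ⟨s.reg, Function.update s.mem (s.reg a) (s.reg b)⟩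
  | seq (p q : Cmd) (s s₁ s₂ : State) (t₁ t₂ : ℕ) :
      Run w p s t₁ s₁ → Run w q s₁ t₂ s₂ → Run w (.seq p q) s (t₁ + t₂) s₂
  | condTrue (o : Cmp) (a b : ℕ) (p q : Cmd) (s s' : State) (t : ℕ) :
      o.Holds (s.reg a) (s.reg b) → Run w p s t s' → Run w (.cond o a b p q) s (t + 1) s'
  | condFalse (o : Cmp) (a b : ℕ) (p q : Cmd) (s s' : State) (t : ℕ) :
      ¬ o.Holds (s.reg a) (s.reg b) → Run w q s t s' → Run w (.cond o a b p q) s (t + 1) s'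
  | loopStep (o : Cmp) (a b : ℕ) (p : Cmd) (s s₁ s₂ : State) (t₁ t₂ : ℕ) :
      o.Holds (s.reg a) (s.reg b) → Run w p s t₁ s₁ → Run w (.loop o a b p) s₁ t₂ s₂ →
      Run w (.loop o a b p) s (t₁ + t₂ + 1) s₂
  | loopEnd (o : Cmp) (a b : ℕ) (p : Cmd) (s : State) :
      ¬ o.Holds (s.reg a) (s.reg b) → Run w (.loop o a b p) s 1 s

/-- The machine is deterministic: the running time and the final state are determined by the
program and the initial state. -/
theorem Run.deterministic {w : ℕ} {p : Cmd} {s s' : State} {t : ℕ} (h : Run w p s t s') :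
    ∀ {t₀ : ℕ} {s₀ : State}, Run w p s t₀ s₀ → t = t₀ ∧ s' = s₀ := by
  induction h with
  | skip | const | arith | load | store => intro t₀ s₀ h'; cases h'; exact ⟨rfl, rfl⟩
  | seq p q s s₁ s₂ t₁ t₂ _ _ ih₁ ih₂ =>
    intro t₀ s₀ h'
    cases h' with
    | seq _ _ _ s₃ _ t₃ t₄ h₁ h₂ =>
      obtain ⟨rfl, rfl⟩ := ih₁ h₁
      obtain ⟨rfl, rfl⟩ := ih₂ h₂
      exact ⟨rfl, rfl⟩
  | condTrue o a b p q s s' t hc _ ih =>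
    intro t₀ s₀ h'
    cases h' with
    | condTrue _ _ _ _ _ _ _ _ _ h => obtain ⟨rfl, rfl⟩ := ih h; exact ⟨rfl, rfl⟩
    | condFalse _ _ _ _ _ _ _ _ hn _ => exact absurd hc hn
  | condFalse o a b p q s s' t hc _ ih =>
    intro t₀ s₀ h'
    cases h' with
    | condTrue _ _ _ _ _ _ _ _ hn _ => exact absurd hn hc
    | condFalse _ _ _ _ _ _ _ _ _ h => obtain ⟨rfl, rfl⟩ := ih h; exact ⟨rfl, rfl⟩
  | loopStep o a b p s s₁ s₂ t₁ t₂ hc _ _ ih₁ ih₂ =>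
    intro t₀ s₀ h'
    cases h' with
    | loopStep _ _ _ _ _ s₃ _ t₃ t₄ _ h₁ h₂ =>
      obtain ⟨rfl, rfl⟩ := ih₁ h₁
      obtain ⟨rfl, rfl⟩ := ih₂ h₂
      exact ⟨rfl, rfl⟩
    | loopEnd _ _ _ _ _ hn => exact absurd hc hn
  | loopEnd o a b p s hn =>
    intro t₀ s₀ h'
    cases h' with
    | loopStep _ _ _ _ _ _ _ _ _ hc _ _ => exact absurd hc hn
    | loopEnd => exact ⟨rfl, rfl⟩

end WordRAM

/-! ## Maintaining a maximal matching of a fully dynamic graph -/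

/-- A dynamic graph algorithm: one program for edge insertions and one for edge deletions. -/
structure DynAlg where
  ins : WordRAM.Cmd
  del : WordRAM.Cmd

namespace DynAlg

/-- `Call w n γ p u v M t M'`: the update program `p`, called on the pair `u`, `v` of vertices when
the memory is `M`, halts after `t` time units and leaves the memory `M'`.  Registers `0, 1, 2, 3`
hold `u`, `v`, the number `n` of vertices and the parameter `γ`, all other registers hold `0`;
only the memory survives from one call to the next. -/
def Call (w n γ : ℕ) (p : WordRAM.Cmd) (u v : Fin n) (M : ℕ → ℕ) (t : ℕ) (M' : ℕ → ℕ) : Prop :=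
  ∃ r' : ℕ → ℕ, WordRAM.Run w p
    ⟨fun i => match i with
      | 0 => (u : ℕ)
      | 1 => (v : ℕ)
      | 2 => n
      | 3 => γ
      | _ => 0, M⟩ t ⟨r', M'⟩

/-- `A.Reaches w n γ α G M`: after some sequence of single-edge insertions and deletions that
starts with the empty graph on `n` vertices, and in which no graph has arboricity greater than `α`,
the current graph is `G`, and the algorithm `A`, started with an all-zero memory, has memory `M`. -/
inductive Reaches (A : DynAlg) (w n γ α : ℕ) : SimpleGraph (Fin n) → (ℕ → ℕ) → Prop
  | start : Reaches A w n γ α ⊥ (fun _ => 0)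
  | insert (G : SimpleGraph (Fin n)) (M M' : ℕ → ℕ) (u v : Fin n) (t : ℕ) :
      Reaches A w n γ α G M → u ≠ v → ¬ G.Adj u v →
      arboricity (G ⊔ SimpleGraph.edge u v) ≤ α → Call w n γ A.ins u v M t M' →
      Reaches A w n γ α (G ⊔ SimpleGraph.edge u v) M'
  | delete (G : SimpleGraph (Fin n)) (M M' : ℕ → ℕ) (u v : Fin n) (t : ℕ) :
      Reaches A w n γ α G M → G.Adj u v → Call w n γ A.del u v M t M' →
      Reaches A w n γ α (G.deleteEdges {s(u, v)}) M'

/-- The memory `M` displays the matching `S` of `G`: the cell `v` holds `0` if the vertex `v` is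
unmatched, and `x + 1` if `v` is matched to `x`. -/
def Displays {n : ℕ} {G : SimpleGraph (Fin n)} (M : ℕ → ℕ) (S : G.Subgraph) : Prop :=
  ∀ v : Fin n, (M v = 0 ↔ v ∉ S.verts) ∧ ∀ x : Fin n, M v = x + 1 ↔ S.Adj v x

/-- On words of `w` bits and with parameter `γ`, the algorithm `A` maintains a maximal matching of
every fully dynamic graph on `n` vertices whose arboricity is at all times at most `α`.  An
insertion takes at most `insTime G` time units, where `G` is the graph after it, and a deletion at
most `delTime G`, where `G` is the graph before it. -/
def MaintainsMaximalMatching (A : DynAlg) (w n γ α : ℕ)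
    (insTime delTime : SimpleGraph (Fin n) → ℝ) : Prop :=
  ∀ (G : SimpleGraph (Fin n)) (M : ℕ → ℕ), A.Reaches w n γ α G M →
    (∃ S : G.Subgraph, Maximal SimpleGraph.Subgraph.IsMatching S ∧ Displays M S) ∧
    (∀ u v : Fin n, u ≠ v → ¬ G.Adj u v → arboricity (G ⊔ SimpleGraph.edge u v) ≤ α →
      ∃ (t : ℕ) (M' : ℕ → ℕ), Call w n γ A.ins u v M t M' ∧
        (t : ℝ) ≤ insTime (G ⊔ SimpleGraph.edge u v)) ∧
    (∀ u v : Fin n, G.Adj u v →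
      ∃ (t : ℕ) (M' : ℕ → ℕ), Call w n γ A.del u v M t M' ∧ (t : ℝ) ≤ delTime G)

end DynAlg

/-- The quantity `β * a + log_β n`. -/
noncomputable def degBound (n a : ℕ) (β : ℝ) : ℝ := β * a + Real.logb β n

/-- The infimum of `β * a + log_β n` over all real `β > 1`. -/
noncomputable def optDegBound (n a : ℕ) : ℝ := ⨅ β : Set.Ioi (1 : ℝ), degBound n a β

/-! # Maximal matching in fully dynamic graphs -/

/-! ## A language of structured programs

Programs with expressions whose memory is addressed by quadruples of digits, a verification
condition calculus for them, and their translation into word RAM programs. -/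

namespace RamLang

open WordRAM

/-! The algorithm keeps an orientation of the graph in which every vertex `x` lists its
out-neighbours by age. The invariant `Valid γ` says that the newest `γ` of them have outdegree at
least `deg x - 1`, the next `γ` at least `deg x - 2`, and so on.

Why outdegrees are small: let the arboricity be at most `a` and `β * a ≤ γ`. Along the newest `γ`
arcs the outdegree falls by at most one per step, so from a vertex whose outdegree exceeds `β * a`
by about `k`, every vertex met in fewer than `k` steps still has at least `β * a` such arcs. A
vertex set `W'` spans at most `a * |W'|` edges, so the set of reached vertices grows by the factor
`β` in each step (`pow_le_card_reach`). As there are only `n` vertices, `k ≤ log_β n`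
(`le_degBound`, `Inv.deg_le_degBound`). The argument concerns the current graph only and works for
every `β` compatible with `γ`.

Why the invariant is cheap to keep: to insert `x → h` with `deg x ≤ deg h`, inspect the `γ` oldest
out-neighbours of `x`. If one of them, `y`, has smaller outdegree, put `h` in its place and continue
with the reversed edge `y → x`. Otherwise declare the inspected ones newest and append `h`.
Outdegrees strictly decrease along this chain. To delete `x → h`, look for an in-neighbour `y` of
`x` with larger outdegree; if there is one, put `y` in the place of `h` and continue by deleting `y
→ x`. Outdegrees strictly increase, and the successive searches over outdegrees telescope. Only the
last vertex of a chain changes its outdegree. The three preservation lemmas are `Valid.redirect`,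
`Valid.add` and `Valid.remove`; the chains are `insArc_vc` and `delArc_vc`.

The matching: in-neighbours are sorted into buckets by a key that encodes outdegree and matched
status. A free neighbour of `z` is then found by trying one bucket per outdegree and reading the
out-list of `z` (`findFree_vc`). A change of outdegree or status of `x` is announced to the
out-neighbours of `x` only (`rekey_vc`).

The machine: programs are written in a small language with time-aware verification conditions, and
`Pr.vc_sound` transfers these to the word RAM. The optimal `β` for `α` serves all smaller
arboricities as well, by `exists_degBound_le_optDegBound`. -/

/-- Memory addressed by quadruples. -/
abbrev Mem := ℕ → ℕ → ℕ → ℕ → ℕ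

/-- Expressions: registers, literals, sums, truncated differences and memory cells. -/
inductive Ex where
  | reg (i : ℕ)
  | lit (c : ℕ)
  | add (a b : Ex)
  | sub (a b : Ex)
  | cell (t k y x : Ex)

/-- The number of digits available for each coordinate of an address. -/
def base (n : ℕ) : ℕ := 2 * n + 8

namespace Ex

def eval (r : ℕ → ℕ) (m : Mem) : Ex → ℕ
  | reg i => r i
  | lit c => c
  | add a b => a.eval r m + b.eval r m
  | sub a b => a.eval r m - b.eval r m
  | cell t k y x => m (t.eval r m) (k.eval r m) (y.eval r m) (x.eval r m)

/-- The evaluation stays within the available registers, words and addresses. -/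
def Ok (n : ℕ) (r : ℕ → ℕ) (m : Mem) : Ex → Prop
  | reg i => i < 99
  | lit c => c ≤ 8
  | add a b => a.Ok n r m ∧ b.Ok n r m ∧ a.eval r m + b.eval r m ≤ 8 * n + 40
  | sub a b => a.Ok n r m ∧ b.Ok n r m
  | cell t k y x => t.Ok n r m ∧ k.Ok n r m ∧ y.Ok n r m ∧ x.Ok n r m ∧
      t.eval r m < base n ∧ k.eval r m < base n ∧ y.eval r m < base n ∧ x.eval r m < base n

def cost : Ex → ℕ
  | reg _ => 2
  | lit _ => 1
  | add a b => a.cost + (b.cost + 1)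
  | sub a b => a.cost + (b.cost + 1)
  | cell t k y x => t.cost + k.cost + y.cost + x.cost + 6 + 1

/-- Code that puts into register `d` the address with the digits left by `ct`, `ck`, `cy`, `cx`. -/
def addrCode (d : ℕ) (ct ck cy cx : Cmd) : Cmd :=
  .seq ct (.seq ck (.seq (.arith .mul d d 99) (.seq (.arith .add d d (d + 1))
    (.seq cy (.seq (.arith .mul d d 99) (.seq (.arith .add d d (d + 1))
      (.seq cx (.seq (.arith .mul d d 99) (.arith .add d d (d + 1))))))))))

/-- Code that puts the value of an expression into register `d`. -/
def comp : Ex → ℕ → Cmd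
  | reg i, d => .seq (.const d 0) (.arith .sub d i d)
  | lit c, d => .const d c
  | add a b, d => .seq (a.comp d) (.seq (b.comp (d + 1)) (.arith .add d d (d + 1)))
  | sub a b, d => .seq (a.comp d) (.seq (b.comp (d + 1)) (.arith .sub d d (d + 1)))
  | cell t k y x, d =>
      .seq (addrCode d (t.comp d) (k.comp (d + 1)) (y.comp (d + 1)) (x.comp (d + 1))) (.load d d)

end Ex

/-- States: registers, memory and elapsed time. -/
structure St where
  r : ℕ → ℕ
  m : Mem
  t : ℕ

/-- The address with digits `t`, `k`, `y`, `x`. -/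
def enc (n t k y x : ℕ) : ℕ := ((t * base n + k) * base n + y) * base n + x

/-- The state `s` of the machine implements the registers `r` and the memory `m`. -/
structure Rel (n : ℕ) (r : ℕ → ℕ) (m : Mem) (s : State) : Prop where
  reg : ∀ i < 99, s.reg i = r i
  base : s.reg 99 = base n
  mem : ∀ t k y x, t < RamLang.base n → k < RamLang.base n → y < RamLang.base n →
    x < RamLang.base n → s.mem (enc n t k y x) = m t k y x

/-- Updating a cell. -/
def upd (m : Mem) (t k y x v : ℕ) : Mem := fun t' k' y' x' =>
  if t' = t ∧ k' = k ∧ y' = y ∧ x' = x then v else m t' k' y' x'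

/-! ### Addresses and the compilation of expressions -/

theorem enc_inj {n t k y x t' k' y' x' : ℕ} (hk : k < base n) (hy : y < base n) (hx : x < base n)
    (hk' : k' < base n) (hy' : y' < base n) (hx' : x' < base n)
    (h : enc n t k y x = enc n t' k' y' x') : t = t' ∧ k = k' ∧ y = y' ∧ x = x' := by
  have key : ∀ {a b c d : ℕ}, b < base n → d < base n → a * base n + b = c * base n + d →
      a = c ∧ b = d := by
    intro a b c d hb hd h
    have h1 : (a * base n + b) / base n = (c * base n + d) / base n := by rw [h]
    have h2 : (a * base n + b) % base n = (c * base n + d) % base n := by rw [h]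
    have h0 : 0 < base n := by omega
    rw [mul_comm, Nat.mul_add_div h0, mul_comm, Nat.mul_add_div h0, Nat.div_eq_of_lt hb,
      Nat.div_eq_of_lt hd] at h1
    rw [mul_comm, Nat.mul_add_mod, mul_comm, Nat.mul_add_mod, Nat.mod_eq_of_lt hb,
      Nat.mod_eq_of_lt hd] at h2
    exact ⟨by omega, h2⟩
  obtain ⟨h1, e1⟩ := key hx hx' h
  obtain ⟨h2, e2⟩ := key hy hy' h1
  obtain ⟨h3, e3⟩ := key hk hk' h2
  exact ⟨h3, e3, e2, e1⟩

theorem Rel.congr_reg {n : ℕ} {r : ℕ → ℕ} {m : Mem} {s s' : State} (h : Rel n r m s)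
    (hr : ∀ i < 100, s'.reg i = s.reg i) (hm : s'.mem = s.mem) : Rel n r m s' :=
  ⟨fun i hi => (hr i (by omega)).trans (h.reg i hi), (hr 99 (by omega)).trans h.base, by
    rw [hm]; exact h.mem⟩

theorem digits_lt {B a b N : ℕ} (ha : a < N) (hb : b < B) : a * B + b < N * B := by
  calc a * B + b < a * B + B := by omega
    _ = (a + 1) * B := by ring
    _ ≤ N * B := Nat.mul_le_mul_right _ ha

/-- Effect of a piece of code on the registers below `d`, with its value left in register `d`. -/
def Computes (w : ℕ) (p : Cmd) (s : State) (c d v : ℕ) : Prop :=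
  ∃ s', Run w p s c s' ∧ s'.reg d = v ∧ s'.mem = s.mem ∧ ∀ i < d, s'.reg i = s.reg i

/-- Horner's scheme: each digit is computed in register `d + 1` and appended to the partial address
in register `d`. All partial addresses stay below `base n ^ 4`, so reduction modulo `2 ^ w` never
acts. -/
theorem computes_addr {n w : ℕ} (hw : base n ^ 4 ≤ 2 ^ w) {d : ℕ} (hd : 100 ≤ d)
    {ct ck cy cx : Cmd} {s : State} {c1 c2 c3 c4 t k y x : ℕ} (hs : s.reg 99 = base n)
    (h1 : Computes w ct s c1 d t)
    (h2 : ∀ s' : State, s'.mem = s.mem → (∀ i < d, s'.reg i = s.reg i) →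
      Computes w ck s' c2 (d + 1) k)
    (h3 : ∀ s' : State, s'.mem = s.mem → (∀ i < d, s'.reg i = s.reg i) →
      Computes w cy s' c3 (d + 1) y)
    (h4 : ∀ s' : State, s'.mem = s.mem → (∀ i < d, s'.reg i = s.reg i) →
      Computes w cx s' c4 (d + 1) x)
    (ht : t < base n) (hk : k < base n) (hy : y < base n) (hx : x < base n) :
    Computes w (Ex.addrCode d ct ck cy cx) s (c1 + c2 + c3 + c4 + 6) d (enc n t k y x) := by
  have hB : 1 ≤ base n := by unfold base; omega
  have b1 : t * base n + k < base n * base n := digits_lt ht hk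
  have b2 : (t * base n + k) * base n + y < base n * base n * base n := digits_lt b1 hy
  have b3 : ((t * base n + k) * base n + y) * base n + x < base n * base n * base n * base n :=
    digits_lt b2 hx
  have e4 : base n ^ 4 = base n * base n * base n * base n := by ring
  have l2 : base n * base n * base n ≤ base n * base n * base n * base n :=
    Nat.le_mul_of_pos_right _ hB
  have l1 : base n * base n ≤ base n * base n * base n := Nat.le_mul_of_pos_right _ hB
  obtain ⟨s1, r1, v1, m1, f1⟩ := h1
  obtain ⟨s2, r2, v2, m2, f2⟩ := h2 s1 m1 f1
  -- the two instructions that append a digit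
  have app : ∀ (s0 : State) (a b : ℕ), s0.reg d = a → s0.reg (d + 1) = b → s0.reg 99 = base n →
      a * base n + b < 2 ^ w → ∃ s', (∀ q t' s'', Run w q s' t' s'' →
        Run w (.seq (.arith .mul d d 99) (.seq (.arith .add d d (d + 1)) q)) s0 (1 + (1 + t')) s'')
        ∧ Run w (.seq (.arith .mul d d 99) (.arith .add d d (d + 1))) s0 (1 + 1) s'
        ∧ s'.reg d = a * base n + b ∧ s'.mem = s0.mem ∧ ∀ i < d, s'.reg i = s0.reg i := by
    intro s0 a b ha hb h99 hlt
    refine ⟨⟨Function.update (Function.update s0.reg d (a * base n)) d (a * base n + b), s0.mem⟩,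
      ?_, ?_, ?_, rfl, ?_⟩
    · intro q t' s'' hq
      refine Run.seq _ _ _ _ _ _ _ (Run.arith _ _ _ _ _) (Run.seq _ _ _ _ _ _ _
        (Run.arith _ _ _ _ _) ?_)
      simp only [Op.eval, ha, h99]
      rw [Nat.mod_eq_of_lt (by omega)]
      simp only [Function.update_self, Function.update_of_ne (show d + 1 ≠ d by omega), hb]
      rw [Nat.mod_eq_of_lt hlt]
      exact hq
    · have := Run.seq _ _ _ _ _ _ _ (Run.arith (w := w) .mul d d 99 s0)
        (Run.arith (w := w) .add d d (d + 1) _)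
      simp only [Op.eval, ha, h99] at this
      rw [Nat.mod_eq_of_lt (by omega)] at this
      simp only [Function.update_self, Function.update_of_ne (show d + 1 ≠ d by omega), hb] at this
      rw [Nat.mod_eq_of_lt hlt] at this
      exact this
    · simp
    · intro i hi
      simp [Function.update_of_ne (show i ≠ d by omega)]
  obtain ⟨s3, g3, -, v3, m3, f3⟩ := app s2 t k ((f2 d (by omega)).trans v1) v2
    ((f2 99 (by omega)).trans ((f1 99 (by omega)).trans hs)) (by omega)
  have F3 : ∀ i < d, s3.reg i = s.reg i := fun i hi =>
    (f3 i hi).trans ((f2 i (by omega)).trans (f1 i hi))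
  have M3 : s3.mem = s.mem := m3.trans (m2.trans m1)
  obtain ⟨s4, r4, v4, m4, f4⟩ := h3 s3 M3 F3
  obtain ⟨s5, g5, -, v5, m5, f5⟩ := app s4 _ y ((f4 d (by omega)).trans v3) v4
    ((f4 99 (by omega)).trans ((F3 99 (by omega)).trans hs)) (by omega)
  have F5 : ∀ i < d, s5.reg i = s.reg i := fun i hi =>
    (f5 i hi).trans ((f4 i (by omega)).trans (F3 i hi))
  have M5 : s5.mem = s.mem := m5.trans (m4.trans M3)
  obtain ⟨s6, r6, v6, m6, f6⟩ := h4 s5 M5 F5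
  obtain ⟨s7, -, g7, v7, m7, f7⟩ := app s6 _ x ((f6 d (by omega)).trans v5) v6
    ((f6 99 (by omega)).trans ((F5 99 (by omega)).trans hs)) (by omega)
  refine ⟨s7, ?_, v7, m7.trans (m6.trans M5), fun i hi =>
    (f7 i hi).trans ((f6 i (by omega)).trans (F5 i hi))⟩
  have := Run.seq _ _ _ _ _ _ _ r1 (Run.seq _ _ _ _ _ _ _ r2 (g3 _ _ _
    (Run.seq _ _ _ _ _ _ _ r4 (g5 _ _ _ (Run.seq _ _ _ _ _ _ _ r6 g7)))))
  rwa [show c1 + c2 + c3 + c4 + 6 =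
    c1 + (c2 + (1 + (1 + (c3 + (1 + (1 + (c4 + (1 + 1)))))))) by omega]

/-- Scratch registers form a stack: code aimed at register `d` leaves everything below `d` intact,
so the second operand can go to `d + 1` while the first waits in `d`. Since `d ≥ 100`, the program
registers and the base in register `99` survive. -/
theorem Ex.computes {n w : ℕ} (hw : base n ^ 4 ≤ 2 ^ w) {r : ℕ → ℕ} {m : Mem} (e : Ex) :
    ∀ {d : ℕ} {s : State}, 100 ≤ d → Rel n r m s → e.Ok n r m →
      Computes w (e.comp d) s e.cost d (e.eval r m) := by
  -- The largest sum that `Ex.Ok` admits still fits into a word.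
  have hB : 8 * n + 40 < 2 ^ w := by
    refine lt_of_lt_of_le ?_ hw
    have h8 : 8 ≤ base n := by unfold base; omega
    have : 8 * 8 * 8 * base n ≤ base n ^ 4 := by
      calc 8 * 8 * 8 * base n ≤ base n * base n * base n * base n := by gcongr
        _ = base n ^ 4 := by ring
    unfold base at *
    omega
  have rel : ∀ {d : ℕ} {s s' : State}, 100 ≤ d → Rel n r m s → s'.mem = s.mem →
      (∀ i < d, s'.reg i = s.reg i) → Rel n r m s' := fun hd h hm hr =>
    h.congr_reg (fun i hi => hr i (by omega)) hm
  induction e with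
  | reg i =>
    intro d s hd h hok
    have hok : i < 99 := hok
    refine ⟨_, Run.seq _ _ _ _ _ _ _ (Run.const _ _ _) (Run.arith _ _ _ _ _), ?_, rfl, ?_⟩
    · simp [Op.eval, Function.update_of_ne (show i ≠ d by omega), h.reg i hok, eval]
    · intro j hj
      simp [Function.update_of_ne (show j ≠ d by omega)]
  | lit c =>
    intro d s hd h hok
    have hok : c ≤ 8 := hok
    refine ⟨_, Run.const _ _ _, ?_, rfl, ?_⟩
    · simp only [Function.update_self, eval]
      exact Nat.mod_eq_of_lt (by omega)
    · intro j hj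
      simp [Function.update_of_ne (show j ≠ d by omega)]
  | add a b iha ihb =>
    intro d s hd h hok
    obtain ⟨ha, hb, hlt⟩ := hok
    obtain ⟨s1, r1, v1, m1, f1⟩ := iha hd h ha
    obtain ⟨s2, r2, v2, m2, f2⟩ := ihb (d := d + 1) (by omega) (rel hd h m1 f1) hb
    refine ⟨_, Run.seq _ _ _ _ _ _ _ r1 (Run.seq _ _ _ _ _ _ _ r2 (Run.arith _ _ _ _ _)), ?_,
      m2.trans m1, ?_⟩
    · simp only [Function.update_self, Op.eval, v2, f2 d (by omega), v1, eval]
      exact Nat.mod_eq_of_lt (by omega)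
    · intro j hj
      simp [Function.update_of_ne (show j ≠ d by omega), f2 j (by omega), f1 j hj]
  | sub a b iha ihb =>
    intro d s hd h hok
    obtain ⟨ha, hb⟩ := hok
    obtain ⟨s1, r1, v1, m1, f1⟩ := iha hd h ha
    obtain ⟨s2, r2, v2, m2, f2⟩ := ihb (d := d + 1) (by omega) (rel hd h m1 f1) hb
    refine ⟨_, Run.seq _ _ _ _ _ _ _ r1 (Run.seq _ _ _ _ _ _ _ r2 (Run.arith _ _ _ _ _)), ?_,
      m2.trans m1, ?_⟩
    · simp only [Function.update_self, Op.eval, v2, f2 d (by omega), v1, eval]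
    · intro j hj
      simp [Function.update_of_ne (show j ≠ d by omega), f2 j (by omega), f1 j hj]
  | cell t k y x iht ihk ihy ihx =>
    intro d s hd h hok
    obtain ⟨ht, hk, hy, hx, bt, bk, bY, bx⟩ := hok
    obtain ⟨s1, r1, v1, m1, f1⟩ := computes_addr hw hd h.base (iht hd h ht)
      (fun s' hm hr => ihk (by omega) (rel hd h hm hr) hk)
      (fun s' hm hr => ihy (by omega) (rel hd h hm hr) hy)
      (fun s' hm hr => ihx (by omega) (rel hd h hm hr) hx) bt bk bY bx
    refine ⟨_, Run.seq _ _ _ _ _ _ _ r1 (Run.load d d s1), ?_, m1, ?_⟩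
    · simp only [Function.update_self, v1, m1, eval]
      exact h.mem _ _ _ _ bt bk bY bx
    · intro j hj
      simp [Function.update_of_ne (show j ≠ d by omega), f1 j hj]

/-! ### Verification conditions and their soundness -/

/-- Structured programs. -/
inductive Pr where
  | skip
  | set (i : ℕ) (e : Ex)
  | put (t k y x e : Ex)
  | seq (p q : Pr)
  | ite (o : Cmp) (a b : Ex) (p q : Pr)
  | loop (o : Cmp) (a b : Ex) (p : Pr)

namespace Pr

/-- Translation into word RAM programs. -/
def comp : Pr → Cmd
  | skip => .skip
  | set i e => .seq (e.comp 100) (.seq (.const 101 0) (.arith .sub i 100 101))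
  | put t k y x e => .seq (Ex.addrCode 100 (t.comp 100) (k.comp 101) (y.comp 101) (x.comp 101))
      (.seq (e.comp 101) (.store 100 101))
  | seq p q => .seq p.comp q.comp
  | ite o a b p q => .seq (a.comp 100) (.seq (b.comp 101) (.cond o 100 101 p.comp q.comp))
  | loop o a b p => .seq (.seq (a.comp 100) (b.comp 101))
      (.loop o 100 101 (.seq p.comp (.seq (a.comp 100) (b.comp 101))))

/-- Verification conditions: a run of the program from the given state ends in a state with `Q`.
A loop is handled by an invariant that carries a decreasing counter. -/
def vc (n : ℕ) : Pr → (St → Prop) → St → Prop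
  | skip, Q, S => Q ⟨S.r, S.m, S.t + 1⟩
  | set i e, Q, S => i < 99 ∧ e.Ok n S.r S.m ∧
      Q ⟨Function.update S.r i (e.eval S.r S.m), S.m, S.t + (e.cost + 2)⟩
  | put t k y x e, Q, S => (Ex.cell t k y x).Ok n S.r S.m ∧ e.Ok n S.r S.m ∧
      Q ⟨S.r, upd S.m (t.eval S.r S.m) (k.eval S.r S.m) (y.eval S.r S.m) (x.eval S.r S.m)
        (e.eval S.r S.m), S.t + (t.cost + k.cost + y.cost + x.cost + e.cost + 7)⟩
  | seq p q, Q, S => p.vc n (q.vc n Q) S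
  | ite o a b p q, Q, S => a.Ok n S.r S.m ∧ b.Ok n S.r S.m ∧
      (o.Holds (a.eval S.r S.m) (b.eval S.r S.m) →
        p.vc n Q ⟨S.r, S.m, S.t + (a.cost + b.cost + 1)⟩) ∧
      (¬ o.Holds (a.eval S.r S.m) (b.eval S.r S.m) →
        q.vc n Q ⟨S.r, S.m, S.t + (a.cost + b.cost + 1)⟩)
  | loop o a b p, Q, S => ∃ I : ℕ → St → Prop, (∃ k, I k S) ∧ ∀ k S', I k S' →
      a.Ok n S'.r S'.m ∧ b.Ok n S'.r S'.m ∧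
      (o.Holds (a.eval S'.r S'.m) (b.eval S'.r S'.m) →
        p.vc n (fun S'' => ∃ j < k, I j S'') ⟨S'.r, S'.m, S'.t + (a.cost + b.cost + 1)⟩) ∧
      (¬ o.Holds (a.eval S'.r S'.m) (b.eval S'.r S'.m) →
        Q ⟨S'.r, S'.m, S'.t + (a.cost + b.cost + 1)⟩)

theorem run_two {n w : ℕ} (hw : base n ^ 4 ≤ 2 ^ w) {r : ℕ → ℕ} {m : Mem} {s : State}
    (h : Rel n r m s) {a b : Ex} (ha : a.Ok n r m) (hb : b.Ok n r m) :
    ∃ s', Run w (a.comp 100) s a.cost s' ∧ ∃ s'', Run w (b.comp 101) s' b.cost s'' ∧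
      s''.reg 100 = a.eval r m ∧ s''.reg 101 = b.eval r m ∧ Rel n r m s'' := by
  obtain ⟨s1, r1, v1, m1, f1⟩ := a.computes hw le_rfl h ha
  have h1 := h.congr_reg f1 m1
  obtain ⟨s2, r2, v2, m2, f2⟩ := b.computes hw (d := 101) (by omega) h1 hb
  exact ⟨s1, r1, s2, r2, (f2 100 (by omega)).trans v1, v2,
    h1.congr_reg (fun i hi => f2 i (by omega)) m2⟩

/-- The translation is correct. -/
theorem vc_sound {n w : ℕ} (hw : base n ^ 4 ≤ 2 ^ w) (p : Pr) :
    ∀ {Q : St → Prop} {S : St} {s : State}, p.vc n Q S → Rel n S.r S.m s →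
      ∃ t s' S', Run w p.comp s t s' ∧ Rel n S'.r S'.m s' ∧ S.t + t = S'.t ∧ Q S' := by
  induction p with
  | skip =>
    intro Q S s h hs
    exact ⟨_, _, ⟨S.r, S.m, S.t + 1⟩, Run.skip s, hs, rfl, h⟩
  | set i e =>
    intro Q S s h hs
    obtain ⟨hi, hok, hQ⟩ := h
    obtain ⟨s1, r1, v1, m1, f1⟩ := e.computes hw le_rfl hs hok
    have h1 := hs.congr_reg f1 m1
    refine ⟨_, _, ⟨_, _, _⟩, Run.seq _ _ _ _ _ _ _ r1 (Run.seq _ _ _ _ _ _ _ (Run.const _ _ _)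
      (Run.arith _ _ _ _ _)), ⟨?_, ?_, ?_⟩, ?_, hQ⟩
    · intro j hj
      by_cases hji : j = i
      · subst hji; simp [Op.eval, v1]
      · simp [hji, Function.update_of_ne (show j ≠ 101 by omega), h1.reg j hj]
    · simp [Function.update_of_ne (show 99 ≠ i by omega), h1.base]
    · exact h1.mem
    · simp only
  | put t k y x e =>
    intro Q S s h hs
    obtain ⟨⟨ht, hk, hy, hx, bt, bk, bY, bx⟩, he, hQ⟩ := h
    have rel : ∀ {s' : State}, s'.mem = s.mem →
        (∀ i < 100, s'.reg i = s.reg i) → Rel n S.r S.m s' := fun hm hr => hs.congr_reg hr hm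
    obtain ⟨s1, r1, v1, m1, f1⟩ := computes_addr hw le_rfl hs.base (t.computes hw le_rfl hs ht)
      (fun s' hm hr => k.computes hw (by omega) (rel hm hr) hk)
      (fun s' hm hr => y.computes hw (by omega) (rel hm hr) hy)
      (fun s' hm hr => x.computes hw (by omega) (rel hm hr) hx) bt bk bY bx
    have h1 := hs.congr_reg f1 m1
    obtain ⟨s2, r2, v2, m2, f2⟩ := e.computes hw (d := 101) (by omega) h1 he
    have h2 := h1.congr_reg (fun i hi => f2 i (by omega)) m2
    refine ⟨_, _, ⟨S.r, upd S.m _ _ _ _ _, S.t + (t.cost + k.cost + y.cost + x.cost + e.cost + 7)⟩,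
      Run.seq _ _ _ _ _ _ _ r1 (Run.seq _ _ _ _ _ _ _ r2 (Run.store _ _ _)),
      ⟨h2.reg, h2.base, ?_⟩, ?_, hQ⟩
    · intro t' k' y' x' ht' hk' hy' hx'
      simp only [upd, f2 100 (by omega), v1, v2]
      split_ifs with heq
      · obtain ⟨rfl, rfl, rfl, rfl⟩ := heq
        simp
      · rw [Function.update_of_ne, h2.mem _ _ _ _ ht' hk' hy' hx']
        -- Different quadruples have different addresses, so the store is invisible at every other
        -- cell.
        exact fun hc => heq (enc_inj hk' hy' hx' bk bY bx hc)
    · simp only; omega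
  | seq p q ihp ihq =>
    intro Q S s h hs
    obtain ⟨t1, s1, S1, r1, h1, e1, hq⟩ := ihp h hs
    obtain ⟨t2, s2, S2, r2, h2, e2, hQ⟩ := ihq hq h1
    exact ⟨_, s2, S2, Run.seq _ _ _ _ _ _ _ r1 r2, h2, by omega, hQ⟩
  | ite o a b p q ihp ihq =>
    intro Q S s h hs
    obtain ⟨ha, hb, hp, hq⟩ := h
    obtain ⟨s1, r1, s2, r2, va, vb, h2⟩ := run_two hw hs ha hb
    by_cases hc : o.Holds (a.eval S.r S.m) (b.eval S.r S.m)
    · obtain ⟨t3, s3, S3, r3, h3, e3, hQ⟩ := ihp (hp hc) h2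
      refine ⟨_, s3, S3, Run.seq _ _ _ _ _ _ _ r1 (Run.seq _ _ _ _ _ _ _ r2
        (Run.condTrue _ _ _ _ _ _ _ _ (by rwa [va, vb]) r3)), h3, ?_, hQ⟩
      simp only at e3; omega
    · obtain ⟨t3, s3, S3, r3, h3, e3, hQ⟩ := ihq (hq hc) h2
      refine ⟨_, s3, S3, Run.seq _ _ _ _ _ _ _ r1 (Run.seq _ _ _ _ _ _ _ r2
        (Run.condFalse _ _ _ _ _ _ _ _ (by rwa [va, vb]) r3)), h3, ?_, hQ⟩
      simp only at e3; omega
  | loop o a b p ih =>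
    intro Q S s h hs
    obtain ⟨I, ⟨k, hk⟩, hI⟩ := h
    -- Strong induction on the counter of the invariant. The evaluation of both sides of the test
    -- stands outside the machine loop, because the compiled body ends by evaluating them again for
    -- the next round.
    have main : ∀ k S, I k S → ∀ s, Rel n S.r S.m s → ∃ s1, Run w (a.comp 100) s a.cost s1 ∧
        ∃ s2, Run w (b.comp 101) s1 b.cost s2 ∧ ∃ t s' S',
        Run w (.loop o 100 101 (.seq p.comp (.seq (a.comp 100) (b.comp 101)))) s2 t s' ∧
        Rel n S'.r S'.m s' ∧ S.t + (a.cost + b.cost + t) = S'.t ∧ Q S' := by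
      intro k
      induction k using Nat.strong_induction_on with
      | _ k ihk =>
        intro S hS s hs
        obtain ⟨ha, hb, hp, hq⟩ := hI k S hS
        obtain ⟨s1, r1, s2, r2, va, vb, h2⟩ := run_two hw hs ha hb
        refine ⟨s1, r1, s2, r2, ?_⟩
        by_cases hc : o.Holds (a.eval S.r S.m) (b.eval S.r S.m)
        · obtain ⟨t3, s3, S3, r3, h3, e3, j, hj, hIj⟩ := ih (hp hc) h2
          obtain ⟨s4, r4, s5, r5, t6, s6, S6, r6, h6, e6, hQ⟩ := ihk j hj S3 hIj s3 h3
          refine ⟨_, s6, S6, Run.loopStep _ _ _ _ _ _ _ _ _ (by rwa [va, vb])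
            (Run.seq _ _ _ _ _ _ _ r3 (Run.seq _ _ _ _ _ _ _ r4 r5)) r6, h6, ?_, hQ⟩
          simp only at e3; omega
        · exact ⟨_, s2, ⟨S.r, S.m, S.t + (a.cost + b.cost + 1)⟩,
            Run.loopEnd _ _ _ _ _ (by rwa [va, vb]), h2, rfl, hq hc⟩
    obtain ⟨s1, r1, s2, r2, t, s', S', r3, h3, e3, hQ⟩ := main k S hk s hs
    exact ⟨_, s', S', Run.seq _ _ _ _ _ _ _ (Run.seq _ _ _ _ _ _ _ r1 r2) r3, h3, e3, hQ⟩

end Pr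

end RamLang

namespace RamLang

open WordRAM

/-! ### Indexed sets in memory

The slot `(k, y)` of a memory holds a list of distinct vertices: cell `3 k y 0` is its length, the
cells `2 k y i` are its entries, and cell `1 k y x` is `0` if `x` is not in the list and the
position of `x`, counted from `1`, otherwise. -/

structure Slot (n : ℕ) (m : Mem) (k y : ℕ) : Prop where
  entry : ∀ i < m 3 k y 0, m 2 k y i < n ∧ m 1 k y (m 2 k y i) = i + 1
  pos : ∀ x, m 1 k y x ≠ 0 → m 1 k y x ≤ m 3 k y 0 ∧ m 2 k y (m 1 k y x - 1) = x

theorem Slot.congr {n : ℕ} {m m' : Mem} {k y : ℕ} (h : Slot n m k y)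
    (h' : ∀ t x, m' t k y x = m t k y x) : Slot n m' k y := by
  constructor
  · intro i hi
    simp only [h'] at *
    exact h.entry i hi
  · intro x hx
    simp only [h'] at *
    exact h.pos x hx

theorem Slot.mem_lt {n : ℕ} {m : Mem} {k y x : ℕ} (h : Slot n m k y) (hx : m 1 k y x ≠ 0) :
    x < n := by
  have h1 := h.pos x hx
  have h2 := h.entry (m 1 k y x - 1) (by omega)
  rw [h1.2] at h2
  exact h2.1

theorem Slot.count_le {n : ℕ} {m : Mem} {k y : ℕ} (h : Slot n m k y) : m 3 k y 0 ≤ n := by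
  have := Finset.card_le_card_of_injOn (s := Finset.range (m 3 k y 0)) (t := Finset.range n)
    (m 2 k y) (fun i hi => by
      simpa using (h.entry i (by simpa using hi)).1) (fun i hi j hj hij => by
      have h1 := (h.entry i (by simpa using hi)).2
      have h2 := (h.entry j (by simpa using hj)).2
      rw [hij] at h1
      omega)
  simpa using this

/-- Appending `x` to a slot. -/
def pushM (m : Mem) (k y x : ℕ) : Mem :=
  upd (upd (upd m 2 k y (m 3 k y 0) x) 1 k y x (m 3 k y 0 + 1)) 3 k y 0 (m 3 k y 0 + 1)

/-- Removing `x` from a slot; the last entry takes its place. -/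
def removeM (m : Mem) (k y x : ℕ) : Mem :=
  upd (upd (upd (upd m 2 k y (m 1 k y x - 1) (m 2 k y (m 3 k y 0 - 1)))
    1 k y (m 2 k y (m 3 k y 0 - 1)) (m 1 k y x)) 1 k y x 0) 3 k y 0 (m 3 k y 0 - 1)

/-- Replacing the entry `x` of a slot by `z`. -/
def replaceM (m : Mem) (k y x z : ℕ) : Mem :=
  upd (upd (upd m 2 k y (m 1 k y x - 1) z) 1 k y z (m 1 k y x)) 1 k y x 0

theorem pushM_of_ne (m : Mem) {k y : ℕ} (x : ℕ) {t k' y' z : ℕ} (h : ¬ (k' = k ∧ y' = y)) :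
    pushM m k y x t k' y' z = m t k' y' z := by
  unfold pushM upd; grind

theorem removeM_of_ne (m : Mem) {k y : ℕ} (x : ℕ) {t k' y' z : ℕ} (h : ¬ (k' = k ∧ y' = y)) :
    removeM m k y x t k' y' z = m t k' y' z := by
  unfold removeM upd; grind

theorem replaceM_of_ne (m : Mem) {k y : ℕ} (x x' : ℕ) {t k' y' z : ℕ} (h : ¬ (k' = k ∧ y' = y)) :
    replaceM m k y x x' t k' y' z = m t k' y' z := by
  unfold replaceM upd; grind

theorem pushM_of_tag (m : Mem) (k y x : ℕ) {t k' y' z : ℕ} (h : t = 0 ∨ t = 4) :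
    pushM m k y x t k' y' z = m t k' y' z := by
  unfold pushM upd; grind

theorem removeM_of_tag (m : Mem) (k y x : ℕ) {t k' y' z : ℕ} (h : t = 0 ∨ t = 4) :
    removeM m k y x t k' y' z = m t k' y' z := by
  unfold removeM upd; grind

theorem replaceM_of_tag (m : Mem) (k y x x' : ℕ) {t k' y' z : ℕ} (h : t = 0 ∨ 3 ≤ t) :
    replaceM m k y x x' t k' y' z = m t k' y' z := by
  unfold replaceM upd; grind

theorem pushM_pos (m : Mem) (k y x k' y' z : ℕ) : pushM m k y x 1 k' y' z =
    if k' = k ∧ y' = y ∧ z = x then m 3 k y 0 + 1 else m 1 k' y' z := by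
  unfold pushM upd; grind

theorem pushM_count (m : Mem) (k y x : ℕ) : pushM m k y x 3 k y 0 = m 3 k y 0 + 1 := by
  unfold pushM upd; grind

theorem removeM_count (m : Mem) (k y x : ℕ) : removeM m k y x 3 k y 0 = m 3 k y 0 - 1 := by
  unfold removeM upd; grind

theorem Slot.push {n : ℕ} {m : Mem} {k y x : ℕ} (h : Slot n m k y) (hx : x < n)
    (h0 : m 1 k y x = 0) : Slot n (pushM m k y x) k y := by
  obtain ⟨h1, h2⟩ := h
  constructor
  · intro i hi
    unfold pushM upd at *; grind
  · intro z hz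
    unfold pushM upd at *; grind

/-- The order of the writes in `removeM` covers the case that `x` is itself the last entry: the
position just written for the last entry is then overwritten by `0`. -/
theorem Slot.remove {n : ℕ} {m : Mem} {k y x : ℕ} (h : Slot n m k y) (hx : m 1 k y x ≠ 0) :
    Slot n (removeM m k y x) k y := by
  have hn := h.mem_lt hx
  obtain ⟨h1, h2⟩ := h
  obtain ⟨h3, h4⟩ := h2 x hx
  obtain ⟨h5, h6⟩ := h1 (m 3 k y 0 - 1) (by omega)
  constructor
  · intro i hi
    simp only [removeM, upd, and_self, if_true] at hi
    obtain ⟨h7, h8⟩ := h1 i (by omega)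
    by_cases hc : i = m 1 k y x - 1
    · have : m 2 k y (m 3 k y 0 - 1) ≠ x := by rintro rfl; omega
      simp [removeM, upd, hc, this, h5]; omega
    · have a1 : m 2 k y i ≠ x := by intro e; rw [e] at h8; omega
      have a2 : m 2 k y i ≠ m 2 k y (m 3 k y 0 - 1) := by intro e; rw [e] at h8; omega
      simp [removeM, upd, hc, a1, a2, h7, h8]
  · intro z hz
    by_cases hzx : z = x
    · simp [removeM, upd, hzx] at hz
    by_cases hzl : z = m 2 k y (m 3 k y 0 - 1)
    · have : m 1 k y x ≠ m 3 k y 0 := by intro e; rw [e, ← hzl] at h4; exact hzx h4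
      have hl : m 2 k y (m 3 k y 0 - 1) ≠ x := hzl ▸ hzx
      simp [removeM, upd, hzl, hl]; omega
    · simp [removeM, upd, hzl, hzx] at hz
      obtain ⟨h7, h8⟩ := h2 z hz
      have a1 : m 1 k y z ≠ m 3 k y 0 := by intro e; rw [e] at h8; exact hzl h8.symm
      have a2 : m 1 k y z - 1 ≠ m 1 k y x - 1 := by intro e; rw [e, h4] at h8; exact hzx h8.symm
      simp [removeM, upd, hzl, hzx, a2, h8]; omega

theorem Slot.replace {n : ℕ} {m : Mem} {k y x z : ℕ} (h : Slot n m k y) (hx : m 1 k y x ≠ 0)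
    (hz : z < n) (h0 : m 1 k y z = 0) : Slot n (replaceM m k y x z) k y := by
  obtain ⟨h1, h2⟩ := h
  obtain ⟨h3, h4⟩ := h2 x hx
  have hzx : z ≠ x := by rintro rfl; exact hx h0
  constructor
  · intro i hi
    simp only [replaceM, upd] at hi
    simp at hi
    obtain ⟨h7, h8⟩ := h1 i hi
    by_cases hc : i = m 1 k y x - 1
    · simp [replaceM, upd, hc, hzx, hz]; omega
    · have a1 : m 2 k y i ≠ x := by intro e; rw [e] at h8; omega
      have a2 : m 2 k y i ≠ z := by intro e; rw [e] at h8; omega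
      simp [replaceM, upd, hc, a1, a2, h7, h8]
  · intro v hv
    by_cases hvx : v = x
    · simp [replaceM, upd, hvx] at hv
    by_cases hvz : v = z
    · simp [replaceM, upd, hvz, hzx, h3]
    · simp [replaceM, upd, hvz, hvx] at hv
      obtain ⟨h7, h8⟩ := h2 v hv
      have a2 : m 1 k y v - 1 ≠ m 1 k y x - 1 := by intro e; rw [e, h4] at h8; exact hvx h8.symm
      simp [replaceM, upd, hvz, hvx, a2, h7, h8]

/-- The last entry is recognised by its position being the length of the list. In this form the
effect on the ages of arcs can be read off without mentioning which vertex was last. -/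
theorem Slot.remove_pos {n : ℕ} {m : Mem} {k y x : ℕ} (h : Slot n m k y) (hx : m 1 k y x ≠ 0)
    (k' y' z : ℕ) : removeM m k y x 1 k' y' z =
      if k' = k ∧ y' = y then
        (if z = x then 0 else if m 1 k y z = m 3 k y 0 then m 1 k y x else m 1 k y z)
      else m 1 k' y' z := by
  obtain ⟨h1, h2⟩ := h
  obtain ⟨h3, h4⟩ := h2 x hx
  obtain ⟨h5, h6⟩ := h1 (m 3 k y 0 - 1) (by omega)
  by_cases hc : k' = k ∧ y' = y
  · obtain ⟨rfl, rfl⟩ := hc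
    by_cases hzx : z = x
    · simp [removeM, upd, hzx]
    by_cases hzl : z = m 2 k' y' (m 3 k' y' 0 - 1)
    · rw [← hzl] at h6
      have : m 1 k' y' z = m 3 k' y' 0 := by omega
      simp [removeM, upd, ← hzl, hzx, this]
    · have : m 1 k' y' z ≠ m 3 k' y' 0 := by
        intro e
        have := (h2 z (by omega)).2
        rw [e] at this; exact hzl this.symm
      simp [removeM, upd, hzl, hzx, this]
  · rw [removeM_of_ne _ _ hc, if_neg hc]

theorem Slot.remove_mem {n : ℕ} {m : Mem} {k y x : ℕ} (h : Slot n m k y) (hx : m 1 k y x ≠ 0)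
    (k' y' z : ℕ) : removeM m k y x 1 k' y' z ≠ 0 ↔
      m 1 k' y' z ≠ 0 ∧ ¬ (k' = k ∧ y' = y ∧ z = x) := by
  rw [h.remove_pos hx]
  have := h.pos x hx
  grind

theorem pushM_mem (m : Mem) (k y x k' y' z : ℕ) : pushM m k y x 1 k' y' z ≠ 0 ↔
    m 1 k' y' z ≠ 0 ∨ (k' = k ∧ y' = y ∧ z = x) := by
  rw [pushM_pos]; grind

theorem replaceM_pos (m : Mem) (k y x x' k' y' z : ℕ) : replaceM m k y x x' 1 k' y' z =
    if k' = k ∧ y' = y then (if z = x then 0 else if z = x' then m 1 k y x else m 1 k y z)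
    else m 1 k' y' z := by
  unfold replaceM upd; grind

/-- All slots of the memory are well formed. -/
def Slots (n : ℕ) (m : Mem) : Prop := ∀ k y, Slot n m k y

theorem Slots.push {n : ℕ} {m : Mem} {k y x : ℕ} (h : Slots n m) (hx : x < n)
    (h0 : m 1 k y x = 0) : Slots n (pushM m k y x) := by
  intro k' y'
  by_cases hc : k' = k ∧ y' = y
  · obtain ⟨rfl, rfl⟩ := hc
    exact (h _ _).push hx h0
  · exact (h k' y').congr fun t z => pushM_of_ne _ _ hc

theorem Slots.remove {n : ℕ} {m : Mem} {k y x : ℕ} (h : Slots n m) (hx : m 1 k y x ≠ 0) :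
    Slots n (removeM m k y x) := by
  intro k' y'
  by_cases hc : k' = k ∧ y' = y
  · obtain ⟨rfl, rfl⟩ := hc
    exact (h _ _).remove hx
  · exact (h k' y').congr fun t z => removeM_of_ne _ _ hc

theorem Slots.replace {n : ℕ} {m : Mem} {k y x z : ℕ} (h : Slots n m) (hx : m 1 k y x ≠ 0)
    (hz : z < n) (h0 : m 1 k y z = 0) : Slots n (replaceM m k y x z) := by
  intro k' y'
  by_cases hc : k' = k ∧ y' = y
  · obtain ⟨rfl, rfl⟩ := hc
    exact (h _ _).replace hx hz h0
  · exact (h k' y').congr fun t z => replaceM_of_ne _ _ _ hc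

/-! ### Programs for slots -/

/-- The expression `e` denotes the digit `v` as long as the registers below `L` do not change. -/
structure Atom (n L : ℕ) (r : ℕ → ℕ) (e : Ex) (v : ℕ) : Prop where
  cost : e.cost ≤ 2
  ok : ∀ r' m, (∀ i < L, r' i = r i) → e.Ok n r' m
  eval : ∀ r' m, (∀ i < L, r' i = r i) → e.eval r' m = v
  lt : v < base n

theorem Atom.lit {n L : ℕ} {r : ℕ → ℕ} {c : ℕ} (h : c < 8) : Atom n L r (.lit c) c :=
  ⟨by simp [Ex.cost], fun _ _ _ => by simp only [Ex.Ok]; omega, fun _ _ _ => rfl,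
    by unfold base; omega⟩

theorem Atom.reg {n L : ℕ} {r : ℕ → ℕ} {i v : ℕ} (hL : L ≤ 99) (hi : i < L) (h : r i = v)
    (hv : v < base n) : Atom n L r (.reg i) v :=
  ⟨by simp [Ex.cost], fun _ _ _ => by simp only [Ex.Ok]; omega, fun _ _ h' => by
    rw [← h]; exact h' i hi, hv⟩

/-- Append `x` to the slot `(k, y)`. -/
def push (k y x : Ex) : Pr :=
  .seq (.put (.lit 2) k y (.cell (.lit 3) k y (.lit 0)) x)
    (.seq (.put (.lit 1) k y x (.add (.cell (.lit 3) k y (.lit 0)) (.lit 1)))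
      (.put (.lit 3) k y (.lit 0) (.add (.cell (.lit 3) k y (.lit 0)) (.lit 1))))

theorem push_vc {n : ℕ} {k y x : Ex} {K Y X : ℕ} {Q : St → Prop} {r₀ : ℕ → ℕ} {m₀ : Mem} {t₀ : ℕ}
    (hk : Atom n 40 r₀ k K) (hy : Atom n 40 r₀ y Y) (hx : Atom n 40 r₀ x X)
    (hc : m₀ 3 K Y 0 ≤ n)
    (hQ : ∀ t', t' ≤ t₀ + 200 → Q ⟨r₀, pushM m₀ K Y X, t'⟩) : (push k y x).vc n Q ⟨r₀, m₀, t₀⟩ := by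
  have ck := hk.cost
  have cy := hy.cost
  have cx := hx.cost
  have bk := hk.lt
  have bY := hy.lt
  have bx := hx.lt
  have ok1 : ∀ m, k.Ok n r₀ m := fun m => hk.ok _ m fun _ _ => rfl
  have ok2 : ∀ m, y.Ok n r₀ m := fun m => hy.ok _ m fun _ _ => rfl
  have ok3 : ∀ m, x.Ok n r₀ m := fun m => hx.ok _ m fun _ _ => rfl
  have e1 : ∀ m, k.eval r₀ m = K := fun m => hk.eval _ m fun _ _ => rfl
  have e2 : ∀ m, y.eval r₀ m = Y := fun m => hy.eval _ m fun _ _ => rfl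
  have e3 : ∀ m, x.eval r₀ m = X := fun m => hx.eval _ m fun _ _ => rfl
  have hB : base n = 2 * n + 8 := rfl
  simp only [push, Pr.vc, Ex.Ok, Ex.eval, Ex.cost, ok1, ok2, ok3, e1, e2, e3]
  simp only [upd]
  simp [hB]
  constructorm* _ ∧ _
  all_goals first | omega | exact hQ _ (by omega)

/-- Remove `x` from the slot `(k, y)`. -/
def remove (k y x : Ex) : Pr :=
  .seq (.set 40 (.cell (.lit 1) k y x))
    (.seq (.set 41 (.cell (.lit 2) k y (.sub (.cell (.lit 3) k y (.lit 0)) (.lit 1))))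
      (.seq (.put (.lit 2) k y (.sub (.reg 40) (.lit 1)) (.reg 41))
        (.seq (.put (.lit 1) k y (.reg 41) (.reg 40))
          (.seq (.put (.lit 1) k y x (.lit 0))
            (.put (.lit 3) k y (.lit 0) (.sub (.cell (.lit 3) k y (.lit 0)) (.lit 1)))))))

theorem remove_vc {n : ℕ} {k y x : Ex} {K Y X : ℕ} {Q : St → Prop} {r₀ : ℕ → ℕ} {m₀ : Mem} {t₀ : ℕ}
    (hk : Atom n 40 r₀ k K) (hy : Atom n 40 r₀ y Y) (hx : Atom n 40 r₀ x X)
    (hs : Slot n m₀ K Y) (h1 : m₀ 1 K Y X ≠ 0)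
    (hQ : ∀ r' t', (∀ i < 40, r' i = r₀ i) → t' ≤ t₀ + 300 → Q ⟨r', removeM m₀ K Y X, t'⟩) :
    (remove k y x).vc n Q ⟨r₀, m₀, t₀⟩ := by
  have ck := hk.cost
  have cy := hy.cost
  have cx := hx.cost
  have bk := hk.lt
  have bY := hy.lt
  have bx := hx.lt
  have hc := hs.count_le
  have hp := hs.pos X h1
  have hl := hs.entry (m₀ 3 K Y 0 - 1) (by omega)
  have fr : ∀ (v v' : ℕ), ∀ i < 40, Function.update (Function.update r₀ 40 v) 41 v' i = r₀ i := by
    intro v v' i hi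
    rw [Function.update_of_ne (by omega), Function.update_of_ne (by omega)]
  have fr' : ∀ (v : ℕ), ∀ i < 40, Function.update r₀ 40 v i = r₀ i := by
    intro v i hi
    rw [Function.update_of_ne (by omega)]
  have ok1 : ∀ m, k.Ok n r₀ m := fun m => hk.ok _ m fun _ _ => rfl
  have ok2 : ∀ m, y.Ok n r₀ m := fun m => hy.ok _ m fun _ _ => rfl
  have ok3 : ∀ m, x.Ok n r₀ m := fun m => hx.ok _ m fun _ _ => rfl
  have e1 : ∀ m, k.eval r₀ m = K := fun m => hk.eval _ m fun _ _ => rfl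
  have e2 : ∀ m, y.eval r₀ m = Y := fun m => hy.eval _ m fun _ _ => rfl
  have e3 : ∀ m, x.eval r₀ m = X := fun m => hx.eval _ m fun _ _ => rfl
  have ok1' : ∀ m v, k.Ok n (Function.update r₀ 40 v) m := fun m v => hk.ok _ m (fr' v)
  have ok2' : ∀ m v, y.Ok n (Function.update r₀ 40 v) m := fun m v => hy.ok _ m (fr' v)
  have e1' : ∀ m v, k.eval (Function.update r₀ 40 v) m = K := fun m v => hk.eval _ m (fr' v)
  have e2' : ∀ m v, y.eval (Function.update r₀ 40 v) m = Y := fun m v => hy.eval _ m (fr' v)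
  have ok1'' : ∀ m v v', k.Ok n (Function.update (Function.update r₀ 40 v) 41 v') m :=
    fun m v v' => hk.ok _ m (fr v v')
  have ok2'' : ∀ m v v', y.Ok n (Function.update (Function.update r₀ 40 v) 41 v') m :=
    fun m v v' => hy.ok _ m (fr v v')
  have ok3'' : ∀ m v v', x.Ok n (Function.update (Function.update r₀ 40 v) 41 v') m :=
    fun m v v' => hx.ok _ m (fr v v')
  have e1'' : ∀ m v v', k.eval (Function.update (Function.update r₀ 40 v) 41 v') m = K :=
    fun m v v' => hk.eval _ m (fr v v')
  have e2'' : ∀ m v v', y.eval (Function.update (Function.update r₀ 40 v) 41 v') m = Y :=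
    fun m v v' => hy.eval _ m (fr v v')
  have e3'' : ∀ m v v', x.eval (Function.update (Function.update r₀ 40 v) 41 v') m = X :=
    fun m v v' => hx.eval _ m (fr v v')
  have hB : base n = 2 * n + 8 := rfl
  simp only [remove, Pr.vc, Ex.Ok, Ex.eval, Ex.cost, ok1, ok2, ok3, e1, e2, e3, ok1', ok2', e1',
    e2', ok1'', ok2'', ok3'', e1'', e2'', e3'']
  simp only [upd]
  simp [hB]
  constructorm* _ ∧ _
  all_goals first | omega | exact hQ _ _ (fr _ _) (by omega)

/-- Replace the entry `x` of the slot `(0, y)` by `z`. -/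
def replace (y x z : Ex) : Pr :=
  .seq (.set 40 (.cell (.lit 1) (.lit 0) y x))
    (.seq (.put (.lit 2) (.lit 0) y (.sub (.reg 40) (.lit 1)) z)
      (.seq (.put (.lit 1) (.lit 0) y z (.reg 40))
        (.put (.lit 1) (.lit 0) y x (.lit 0))))

theorem replace_vc {n : ℕ} {y x z : Ex} {Y X Z : ℕ} {Q : St → Prop} {r₀ : ℕ → ℕ} {m₀ : Mem} {t₀ : ℕ}
    (hy : Atom n 40 r₀ y Y) (hx : Atom n 40 r₀ x X) (hz : Atom n 40 r₀ z Z)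
    (hs : Slot n m₀ 0 Y) (h1 : m₀ 1 0 Y X ≠ 0)
    (hQ : ∀ r' t', (∀ i < 40, r' i = r₀ i) → t' ≤ t₀ + 200 →
      Q ⟨r', replaceM m₀ 0 Y X Z, t'⟩) :
    (replace y x z).vc n Q ⟨r₀, m₀, t₀⟩ := by
  have cy := hy.cost
  have cx := hx.cost
  have cz := hz.cost
  have bY := hy.lt
  have bx := hx.lt
  have bz := hz.lt
  have hc := hs.count_le
  have hp := hs.pos X h1
  have fr' : ∀ (v : ℕ), ∀ i < 40, Function.update r₀ 40 v i = r₀ i := by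
    intro v i hi
    rw [Function.update_of_ne (by omega)]
  have ok2 : ∀ m, y.Ok n r₀ m := fun m => hy.ok _ m fun _ _ => rfl
  have ok3 : ∀ m, x.Ok n r₀ m := fun m => hx.ok _ m fun _ _ => rfl
  have e2 : ∀ m, y.eval r₀ m = Y := fun m => hy.eval _ m fun _ _ => rfl
  have e3 : ∀ m, x.eval r₀ m = X := fun m => hx.eval _ m fun _ _ => rfl
  have ok1' : ∀ m v, z.Ok n (Function.update r₀ 40 v) m := fun m v => hz.ok _ m (fr' v)
  have ok2' : ∀ m v, y.Ok n (Function.update r₀ 40 v) m := fun m v => hy.ok _ m (fr' v)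
  have ok3' : ∀ m v, x.Ok n (Function.update r₀ 40 v) m := fun m v => hx.ok _ m (fr' v)
  have e1' : ∀ m v, z.eval (Function.update r₀ 40 v) m = Z := fun m v => hz.eval _ m (fr' v)
  have e2' : ∀ m v, y.eval (Function.update r₀ 40 v) m = Y := fun m v => hy.eval _ m (fr' v)
  have e3' : ∀ m v, x.eval (Function.update r₀ 40 v) m = X := fun m v => hx.eval _ m (fr' v)
  have hB : base n = 2 * n + 8 := rfl
  simp only [replace, Pr.vc, Ex.Ok, Ex.eval, Ex.cost, ok2, ok3, e2, e3, ok1', ok2', ok3', e1',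
    e2', e3']
  simp [hB]
  constructorm* _ ∧ _
  all_goals first | omega | exact hQ _ _ (fr' _) (by omega)

end RamLang

/-! ### Buckets and keys: moving a vertex, searching, computing a key -/

namespace RamLang

open WordRAM

/-- Register numbers act as stack levels: a routine preserves all registers below its own level, and
its callers keep their data there. Arguments therefore keep their values across calls. -/
theorem Atom.mono {n L L' : ℕ} {r r' : ℕ → ℕ} {e : Ex} {v : ℕ} (h : Atom n L r e v) (hL : L ≤ L')
    (hr : ∀ i < L, r' i = r i) : Atom n L' r' e v :=
  ⟨h.cost, fun r'' m h' => h.ok r'' m fun i hi => (h' i (by omega)).trans (hr i hi),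
    fun r'' m h' => h.eval r'' m fun i hi => (h' i (by omega)).trans (hr i hi), h.lt⟩

/-- The memory `m'` arises from `m` by moving `X` from slot `K0` to slot `K1` of each of its first
`i` out-neighbours, the entries of the slot `(0, X)`. -/
structure Rekeyed (n : ℕ) (m m' : Mem) (X K0 K1 i : ℕ) : Prop where
  zero : ∀ t y z, m' t 0 y z = m t 0 y z
  slots : Slots n m'
  mem : ∀ k y z, m' 1 k y z ≠ 0 ↔
    (m 1 k y z ≠ 0 ∧ ¬ (z = X ∧ k = K0 ∧ m 1 0 X y ≠ 0 ∧ m 1 0 X y ≤ i)) ∨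
      (z = X ∧ k = K1 ∧ m 1 0 X y ≠ 0 ∧ m 1 0 X y ≤ i)

/-- Move `x` from the slot given by register `20` to the slot given by register `21`, at each of
its out-neighbours. -/
def rekey (x : Ex) : Pr :=
  .seq (.set 30 (.lit 0))
    (.loop .lt (.reg 30) (.cell (.lit 3) (.lit 0) x (.lit 0))
      (.seq (.set 31 (.cell (.lit 2) (.lit 0) x (.reg 30)))
        (.seq (remove (.reg 20) (.reg 31) x)
          (.seq (push (.reg 21) (.reg 31) x)
            (.set 30 (.add (.reg 30) (.lit 1)))))))

/-- Each out-neighbour costs constant time. As both keys are nonzero, the out-list in slot `(0, X)`,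
which the loop traverses, is never touched. -/
theorem rekey_vc {n : ℕ} {x : Ex} {X K0 K1 : ℕ} {Q : St → Prop} {r₀ : ℕ → ℕ} {m₀ : Mem} {t₀ : ℕ}
    (hx : Atom n 30 r₀ x X) (hX : X < n) (hs : Slots n m₀) (h20 : r₀ 20 = K0)
    (h21 : r₀ 21 = K1) (hb0 : K0 < base n) (hb1 : K1 < base n)
    (hK : ∀ y, m₀ 1 0 X y ≠ 0 → K0 ≠ 0 ∧ K1 ≠ 0 ∧ m₀ 1 K0 y X ≠ 0 ∧ m₀ 1 K1 y X = 0)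
    (hQ : ∀ r' m' t', (∀ i < 30, r' i = r₀ i) → Rekeyed n m₀ m' X K0 K1 (m₀ 3 0 X 0) →
      t' ≤ t₀ + 50 + 700 * m₀ 3 0 X 0 → Q ⟨r', m', t'⟩) : (rekey x).vc n Q ⟨r₀, m₀, t₀⟩ := by
  have hB : base n = 2 * n + 8 := rfl
  have hx' : ∀ {r' : ℕ → ℕ}, (∀ i < 30, r' i = r₀ i) → Atom n 30 r' x X := fun h =>
    hx.mono le_rfl h
  have hcost := hx.cost
  have hcnt := (hs 0 X).count_le
  refine ⟨by omega, by simp [Ex.Ok], fun k T => T.r 30 + k = m₀ 3 0 X 0 ∧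
    (∀ i < 30, T.r i = r₀ i) ∧ Rekeyed n m₀ T.m X K0 K1 (T.r 30) ∧
      T.t ≤ t₀ + 10 + 700 * T.r 30, ⟨m₀ 3 0 X 0, ?_, ?_, ⟨?_, ?_, ?_⟩, ?_⟩, ?_⟩
  · simp [Ex.eval]
  · intro i hi
    exact Function.update_of_ne (by omega) _ _
  · intro t y z; rfl
  · exact hs
  · intro k y z
    simp only [Ex.eval, Function.update_self]
    omega
  · simp [Ex.eval, Ex.cost]
  · rintro k ⟨r, m, t⟩ ⟨hk, hr, hR, ht⟩
    simp only at hk hr hR ht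
    have hax := hx' hr
    have okx := hax.ok r m fun _ _ => rfl
    have evx := hax.eval r m fun _ _ => rfl
    have hc : m 3 0 X 0 = m₀ 3 0 X 0 := hR.zero 3 X 0
    refine ⟨by simp [Ex.Ok], ?_, ?_, ?_⟩
    · simp [Ex.Ok, okx, Ex.eval, evx, hB]; omega
    · intro hlt
      simp only [Ex.eval, evx, Cmp.Holds, hc] at hlt
      have hent := (hs 0 X).entry (r 30) hlt
      have e2 : m 2 0 X (r 30) = m₀ 2 0 X (r 30) := hR.zero 2 X _
      refine ⟨by omega, ?_, ?_⟩
      · simp [Ex.Ok, okx, Ex.eval, evx, hB]; omega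
      simp only [Ex.eval, evx, e2, Ex.cost]
      generalize hY : m₀ 2 0 X (r 30) = Y at hent
      obtain ⟨hYn, hYp⟩ := hent
      obtain ⟨k0, k1, p0, p1⟩ := hK Y (by omega)
      have q0 : m 1 K0 Y X ≠ 0 := by rw [hR.mem]; left; refine ⟨p0, ?_⟩; omega
      have hu : ∀ i < 30, Function.update r 31 Y i = r₀ i := fun i hi => by
        rw [Function.update_of_ne (by omega), hr i hi]
      have hu1 : Function.update r 31 Y 20 = K0 := by rw [hu 20 (by omega), h20]
      have hu2 : Function.update r 31 Y 21 = K1 := by rw [hu 21 (by omega), h21]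
      refine remove_vc (.reg (by omega) (by omega) hu1 hb0)
        (.reg (by omega) (by omega) (by simp) (by omega))
        ((hx' hu).mono (by omega) fun _ _ => rfl) (hR.slots _ _) q0 ?_
      intro r1 t1 f1 ht1
      have s1 := Slots.remove hR.slots q0
      have m1 := (hR.slots K0 Y).remove_mem q0
      have f1' : ∀ i < 30, r1 i = r₀ i := fun i hi => by rw [f1 i (by omega)]; exact hu i hi
      have f31 : r1 31 = Y := by rw [f1 31 (by omega)]; simp
      have f30 : r1 30 = r 30 := by
        rw [f1 30 (by omega)]; simp
      -- Positions in the out-list identify its entries, so `Y` is reached only in this round and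
      -- `X` cannot have been put into its new bucket before.
      have z0 : removeM m K0 Y X 1 K1 Y X = 0 := by
        by_contra hc
        have hc := (m1 K1 Y X).1 hc
        rw [hR.mem] at hc
        rcases hc.1 with h | h
        · exact h.1 p1
        · omega
      refine push_vc (.reg (by omega) (by omega) ((f1' 21 (by omega)).trans h21) hb1)
        (.reg (by omega) (by omega) f31 (by omega)) ((hx' f1').mono (by omega) fun _ _ => rfl)
        (s1 _ _).count_le ?_
      intro t2 ht2
      refine ⟨by omega, ?_, k - 1, ?_, ?_, ?_, ⟨?_, ?_, ?_⟩, ?_⟩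
      · simp only [Ex.Ok, Ex.eval]; omega
      · omega
      · simp only [Ex.eval, Function.update_self]; omega
      · intro i hi
        rw [← f1' i hi]
        exact Function.update_of_ne (by omega) _ _
      · intro t y z
        simp only
        rw [pushM_of_ne _ _ (by omega), removeM_of_ne _ _ (by omega), hR.zero]
      · exact s1.push hX z0
      · intro k' y z
        simp only [Ex.eval, Function.update_self]
        rw [pushM_mem, m1, hR.mem, f30]
        have hiff : ∀ y, m₀ 1 0 X y = r 30 + 1 → y = Y := by
          intro y hy
          have := ((hs 0 X).pos y (by omega)).2
          rw [hy, Nat.add_sub_cancel, hY] at this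
          exact this.symm
        have hy := hiff y
        have : y = Y → m₀ 1 0 X y = r 30 + 1 := by rintro rfl; exact hYp
        grind
      · simp only [Ex.eval, Ex.cost, Function.update_self] at *; omega
    · intro hge
      simp only [Ex.eval, evx, Cmp.Holds, hc] at hge
      have : r 30 = m₀ 3 0 X 0 := by omega
      rw [this] at hR ht
      refine hQ _ _ _ hr hR ?_
      simp only [Ex.cost]; omega

/-- Look for an in-neighbour of `z` with a key `2 d` or `2 d + b`, where `d` is at least the
content of register `13`.  The key goes to register `12`, which becomes `0` if there is none. -/
def search (z : Ex) (b : ℕ) : Pr :=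
  .seq (.set 12 (.lit 0))
    (.loop .ne (.cell (.lit 4) (.lit 0) (.lit 0) (.reg 13)) (.lit 0)
      (.ite .ne (.cell (.lit 3) (.add (.reg 13) (.reg 13)) z (.lit 0)) (.lit 0)
        (.seq (.set 12 (.add (.reg 13) (.reg 13))) (.set 13 (.add (.reg 2) (.lit 1))))
        (.ite .ne (.cell (.lit 3) (.add (.add (.reg 13) (.reg 13)) (.lit b)) z (.lit 0)) (.lit 0)
          (.seq (.set 12 (.add (.add (.reg 13) (.reg 13)) (.lit b)))
            (.set 13 (.add (.reg 2) (.lit 1))))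
          (.set 13 (.add (.reg 13) (.lit 1))))))

/-- The time is proportional to the range `d - D` actually traversed, so that consecutive searches
in a chain can be summed. With `b = 1` both parities of the key are tried, with `b = 0` only the
even keys, which belong to free vertices. -/
theorem search_vc {n : ℕ} {z : Ex} {b Z D : ℕ} {Q : St → Prop} {r₀ : ℕ → ℕ} {m₀ : Mem} {t₀ : ℕ}
    (hz : Atom n 12 r₀ z Z) (hb : b ≤ 1) (h2 : r₀ 2 = n) (h13 : r₀ 13 = D) (hD : D ≤ n + 1)
    (hlev : ∀ d, n < d → m₀ 4 0 0 d = 0)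
    (hQ0 : ∀ r' t' d, (∀ i < 12, r' i = r₀ i) → r' 12 = 0 → D ≤ d → m₀ 4 0 0 d = 0 →
      (∀ e, D ≤ e → e < d → m₀ 4 0 0 e ≠ 0 ∧ m₀ 3 (2 * e) Z 0 = 0 ∧ m₀ 3 (2 * e + b) Z 0 = 0) →
      t' ≤ t₀ + 200 * (d - D) + 200 → Q ⟨r', m₀, t'⟩)
    (hQ1 : ∀ r' t' d, (∀ i < 12, r' i = r₀ i) → D ≤ d → d ≤ n → m₀ 4 0 0 d ≠ 0 →
      (r' 12 = 2 * d ∨ r' 12 = 2 * d + b) →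
      m₀ 3 (r' 12) Z 0 ≠ 0 → t' ≤ t₀ + 200 * (d - D) + 400 → Q ⟨r', m₀, t'⟩) :
    (search z b).vc n Q ⟨r₀, m₀, t₀⟩ := by
  have hB : base n = 2 * n + 8 := rfl
  have hcost := hz.cost
  have hzb := hz.lt
  -- A successful search leaves the loop by setting register `13` to `n + 1`, where the level count
  -- is zero. The second alternative of the invariant describes that state.
  refine ⟨by omega, by simp [Ex.Ok], fun k T => T.r 13 + k = n + 1 ∧ T.m = m₀ ∧
    (∀ i < 12, T.r i = r₀ i) ∧
    ((T.r 12 = 0 ∧ D ≤ T.r 13 ∧ (∀ e, D ≤ e → e < T.r 13 →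
        m₀ 4 0 0 e ≠ 0 ∧ m₀ 3 (2 * e) Z 0 = 0 ∧ m₀ 3 (2 * e + b) Z 0 = 0) ∧
        T.t ≤ t₀ + 10 + 200 * (T.r 13 - D)) ∨
      ∃ d, D ≤ d ∧ d ≤ n ∧ m₀ 4 0 0 d ≠ 0 ∧ T.r 13 = n + 1 ∧
        (T.r 12 = 2 * d ∨ T.r 12 = 2 * d + b) ∧
        m₀ 3 (T.r 12) Z 0 ≠ 0 ∧ T.t ≤ t₀ + 200 * (d - D) + 300),
    ⟨n + 1 - D, ?_, rfl, ?_, Or.inl ⟨?_, ?_, ?_, ?_⟩⟩, ?_⟩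
  · simp [h13]; omega
  · intro i hi
    exact Function.update_of_ne (by omega) _ _
  · simp [Ex.eval]
  · simp [h13]
  · intro e he he'
    simp [h13] at he'; omega
  · simp [Ex.cost]; omega
  · rintro k ⟨r, m, t⟩ ⟨hk, hm, hr, h⟩
    simp only at hk hm hr h
    subst m
    have okz : ∀ r', (∀ i < 12, r' i = r₀ i) → z.Ok n r' m₀ := fun r' h => hz.ok r' _ h
    have evz : ∀ r', (∀ i < 12, r' i = r₀ i) → z.eval r' m₀ = Z := fun r' h => hz.eval r' _ h
    have okr := okz r hr
    have evr := evz r hr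
    have hr2 : r 2 = n := (hr 2 (by omega)).trans h2
    refine ⟨by simp [Ex.Ok, Ex.eval, hB]; omega, by simp [Ex.Ok], ?_, ?_⟩
    · intro hne
      simp only [Ex.eval, Cmp.Holds] at hne
      have hle : r 13 ≤ n := by
        by_contra hc; exact hne (hlev _ (by omega))
      rcases h with ⟨r12, hDd, hall, ht⟩ | ⟨d, -, -, -, e13, -⟩
      swap
      · omega
      refine ⟨?_, by simp [Ex.Ok], ?_, ?_⟩
      · simp [Ex.Ok, Ex.eval, okr, evr, hB]; omega
      · intro hc
        simp only [Ex.eval, evr, Cmp.Holds] at hc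
        refine ⟨by omega, ?_, by omega, ?_, k - (n + 1 - r 13), ?_, ?_, rfl, ?_, Or.inr
          ⟨r 13, hDd, hle, hne, ?_, ?_, ?_, ?_⟩⟩
        · simp [Ex.Ok, Ex.eval]; omega
        · simp [Ex.Ok, Ex.eval, hr2]; omega
        · omega
        · simp [Ex.eval, hr2]; omega
        · intro i hi
          simp only
          rw [Function.update_of_ne (by omega), Function.update_of_ne (by omega), hr i hi]
        · simp [Ex.eval, hr2]
        · left; simp [Ex.eval]; omega
        · simpa [Ex.eval] using hc
        · simp only [Ex.cost]; omega
      · intro hc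
        simp only [Ex.eval, evr, Cmp.Holds, not_not] at hc
        refine ⟨?_, by simp [Ex.Ok], ?_, ?_⟩
        · simp [Ex.Ok, Ex.eval, okr, evr, hB]; omega
        · intro hc
          simp only [Ex.eval, evr, Cmp.Holds] at hc
          refine ⟨by omega, ?_, by omega, ?_, k - (n + 1 - r 13), ?_, ?_, rfl, ?_, Or.inr
            ⟨r 13, hDd, hle, hne, ?_, ?_, ?_, ?_⟩⟩
          · simp [Ex.Ok, Ex.eval]; omega
          · simp [Ex.Ok, Ex.eval, hr2]; omega
          · omega
          · simp [Ex.eval, hr2]; omega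
          · intro i hi
            simp only
            rw [Function.update_of_ne (by omega), Function.update_of_ne (by omega), hr i hi]
          · simp [Ex.eval, hr2]
          · right; simp [Ex.eval]; omega
          · simpa [Ex.eval] using hc
          · simp only [Ex.cost]; omega
        · intro hc'
          simp only [Ex.eval, evr, Cmp.Holds, not_not] at hc'
          refine ⟨by omega, ?_, k - 1, ?_, ?_, rfl, ?_, Or.inl ⟨?_, ?_, ?_, ?_⟩⟩
          · simp [Ex.Ok, Ex.eval]; omega
          · omega
          · simp [Ex.eval]; omega
          · intro i hi
            simp only
            rw [Function.update_of_ne (by omega), hr i hi]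
          · simpa [Ex.eval] using r12
          · simp [Ex.eval]; omega
          · intro e he he'
            simp [Ex.eval] at he'
            by_cases hee : e = r 13
            · subst hee
              rw [two_mul]; exact ⟨hne, hc, hc'⟩
            · exact hall e he (by omega)
          · simp [Ex.eval, Ex.cost]; omega
    · intro hne
      simp only [Ex.eval, Cmp.Holds, not_not] at hne
      rcases h with ⟨r12, hDd, hall, ht⟩ | ⟨d, g1, g2, g3, g4, g5, g6, g7⟩
      · exact hQ0 _ _ (r 13) hr r12 hDd hne hall (by simp only [Ex.cost]; omega)
      · exact hQ1 _ _ d hr g1 g2 g3 g5 g6 (by simp only [Ex.cost]; omega)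

/-- The key under which `x` is stored at its out-neighbours. -/
def keyM (m : Mem) (x : ℕ) : ℕ := 2 * m 3 0 x 0 + if m 0 0 0 x = 0 then 0 else 1

/-- Compute the key of `x`. -/
def getKey (i : ℕ) (x : Ex) : Pr :=
  .seq (.set i (.add (.cell (.lit 3) (.lit 0) x (.lit 0)) (.cell (.lit 3) (.lit 0) x (.lit 0))))
    (.ite .ne (.cell (.lit 0) (.lit 0) (.lit 0) x) (.lit 0) (.set i (.add (.reg i) (.lit 1))) .skip)

theorem getKey_vc {n i : ℕ} {x : Ex} {X : ℕ} {Q : St → Prop} {r₀ : ℕ → ℕ} {m₀ : Mem} {t₀ : ℕ} (hx : Atom n i r₀ x X)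
    (hi : i < 99) (hc : m₀ 3 0 X 0 ≤ n)
    (hQ : ∀ r' t', r' i = keyM m₀ X → (∀ j, j ≠ i → r' j = r₀ j) → t' ≤ t₀ + 200 →
      Q ⟨r', m₀, t'⟩) : (getKey i x).vc n Q ⟨r₀, m₀, t₀⟩ := by
  have hB : base n = 2 * n + 8 := rfl
  have hcost := hx.cost
  have hxb := hx.lt
  have ok := hx.ok r₀ m₀ fun _ _ => rfl
  have ev := hx.eval r₀ m₀ fun _ _ => rfl
  have fr : ∀ v, ∀ j < i, Function.update r₀ i v j = r₀ j := fun v j hj =>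
    Function.update_of_ne (by omega) _ _
  have ok' := fun v => hx.ok (Function.update r₀ i v) m₀ (fr v)
  have ev' := fun v => hx.eval (Function.update r₀ i v) m₀ (fr v)
  refine ⟨hi, ?_, ?_, by simp [Ex.Ok], ?_, ?_⟩
  · simp [Ex.Ok, Ex.eval, ok, ev, hB]; omega
  · simp [Ex.Ok, Ex.eval, ok', ev', hB]; omega
  · intro h
    simp only [Ex.eval, ev', ev, Cmp.Holds] at h
    refine ⟨hi, ?_, hQ _ _ ?_ ?_ ?_⟩
    · simp [Ex.Ok, Ex.eval, ev]; omega
    · simp [Ex.eval, ev, keyM, h]; omega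
    · intro j hj; simp [hj]
    · simp only [Ex.cost]; omega
  · intro h
    simp only [Ex.eval, ev', ev, Cmp.Holds, not_not] at h
    refine hQ _ _ ?_ ?_ ?_
    · simp [Ex.eval, ev, keyM, h]; omega
    · intro j hj; simp [hj]
    · simp only [Ex.cost]; omega

end RamLang

namespace RamLang

open WordRAM

/-! ### The data structure for an orientation -/

/-- The orientation stored in a memory: `y` is an entry of the slot `(0, x)`. -/
def Arc (m : Mem) (x y : ℕ) : Prop := m 1 0 x y ≠ 0

/-- The outdegree. -/
def deg (m : Mem) (x : ℕ) : ℕ := m 3 0 x 0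

/-- The memory stores a digraph: out-neighbours in the slots `(0, x)`, the in-neighbours of `y`
with key `k` in the slot `(k, y)`, and the number of vertices of outdegree at least `d` in the cell
`4 0 0 d`. -/
structure DS (n : ℕ) (m : Mem) : Prop where
  slots : Slots n m
  src : ∀ {x y}, Arc m x y → x < n
  bucket : ∀ {k} x y, k ≠ 0 → (m 1 k y x ≠ 0 ↔ Arc m x y ∧ k = keyM m x)
  level : ∀ d, d ≠ 0 → m 4 0 0 d = ((Finset.range n).filter fun v => d ≤ deg m v).card

namespace DS

variable {n : ℕ} {m : Mem}

theorem deg_le (h : DS n m) (x : ℕ) : deg m x ≤ n := (h.slots 0 x).count_le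

theorem dst (h : DS n m) {x y : ℕ} (hxy : Arc m x y) : y < n := (h.slots 0 x).mem_lt hxy

theorem pos_le (h : DS n m) {x y : ℕ} (hxy : Arc m x y) : m 1 0 x y ≤ deg m x :=
  ((h.slots 0 x).pos y hxy).1

theorem deg_pos (h : DS n m) {x y : ℕ} (hxy : Arc m x y) : 1 ≤ deg m x :=
  (Nat.one_le_iff_ne_zero.2 hxy).trans (h.pos_le hxy)

theorem keyM_lt (h : DS n m) (x : ℕ) : keyM m x < 2 * n + 2 := by
  have := h.deg_le x
  unfold keyM deg at *
  split_ifs <;> omega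

theorem two_deg_le (x : ℕ) : 2 * deg m x ≤ keyM m x := by
  unfold keyM deg; omega

theorem level_zero (h : DS n m) {d : ℕ} (hd : n < d) : m 4 0 0 d = 0 := by
  rw [h.level d (by omega), Finset.card_eq_zero, Finset.filter_eq_empty_iff]
  intro v _ hv
  have := h.deg_le v
  omega

theorem level_ne (h : DS n m) {d x : ℕ} (hd : d ≠ 0) (hx : x < n) (hdx : d ≤ deg m x) :
    m 4 0 0 d ≠ 0 := by
  rw [h.level d hd, Finset.card_ne_zero]
  exact ⟨x, by simp [hx, hdx]⟩

theorem exists_of_level (h : DS n m) {d : ℕ} (hd : d ≠ 0) (h4 : m 4 0 0 d ≠ 0) :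
    ∃ x < n, d ≤ deg m x := by
  rw [h.level d hd, Finset.card_ne_zero] at h4
  obtain ⟨x, hx⟩ := h4
  simp at hx
  exact ⟨x, hx⟩

theorem key_ne (h : DS n m) {x y : ℕ} (hxy : Arc m x y) : keyM m x ≠ 0 := by
  have := h.deg_pos hxy
  have := two_deg_le (m := m) x
  omega

end DS

theorem keyM_congr {m m' : Mem} {x : ℕ} (h3 : deg m' x = deg m x)
    (h0 : m' 0 0 0 x = m 0 0 0 x) : keyM m' x = keyM m x := by
  unfold keyM deg at *; rw [h3, h0]

/-! ### Redirecting, adding and removing a single arc -/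

/-- Replacing the arc from `x` to `y` by an arc from `x` to `z`. -/
def redirectM (m : Mem) (x y z : ℕ) : Mem :=
  replaceM (pushM (removeM m (keyM m x) y x) (keyM m x) z x) 0 x y z

section redirect

variable {n : ℕ} {m : Mem} {x y z : ℕ}

theorem redirectM_pos (h : DS n m) (hxy : Arc m x y) (a b : ℕ) :
    redirectM m x y z 1 0 a b = if a = x then
      (if b = y then 0 else if b = z then m 1 0 x y else m 1 0 a b) else m 1 0 a b := by
  have hk := h.key_ne hxy
  unfold redirectM
  rw [replaceM_pos]
  have : ∀ b, pushM (removeM m (keyM m x) y x) (keyM m x) z x 1 0 a b = m 1 0 a b := by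
    intro b
    rw [pushM_of_ne _ _ (by omega), removeM_of_ne _ _ (by omega)]
  by_cases hax : a = x
  · subst hax; simp [this]
  · simp [hax, this]

theorem redirectM_deg (h : DS n m) (hxy : Arc m x y) (a : ℕ) :
    deg (redirectM m x y z) a = deg m a := by
  have hk := h.key_ne hxy
  unfold redirectM deg
  rw [replaceM_of_tag _ _ _ _ _ (by omega), pushM_of_ne _ _ (by omega),
    removeM_of_ne _ _ (by omega)]

theorem redirectM_tag {t : ℕ} (ht : t = 0 ∨ t = 4) (a b c : ℕ) :
    redirectM m x y z t a b c = m t a b c := by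
  unfold redirectM
  rw [replaceM_of_tag _ _ _ _ _ (by omega), pushM_of_tag _ _ _ _ ht, removeM_of_tag _ _ _ _ ht]

theorem arc_redirectM (h : DS n m) (hxy : Arc m x y) (hyz : y ≠ z) (a b : ℕ) :
    Arc (redirectM m x y z) a b ↔ (Arc m a b ∧ ¬ (a = x ∧ b = y)) ∨ (a = x ∧ b = z) := by
  unfold Arc at *
  rw [redirectM_pos h hxy]
  grind

/-- The outdegree of `x`, hence its key and all level counts, are unchanged. Only the buckets at `y`
and `z` and one entry of the out-list are affected, which is why a redirection takes constant time.
-/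
theorem DS.redirect (h : DS n m) (hxy : Arc m x y) (hxz : ¬ Arc m x z) (hz : z < n) :
    DS n (redirectM m x y z) := by
  have hk := h.key_ne hxy
  have hyz : y ≠ z := by rintro rfl; exact hxz hxy
  have b1 : m 1 (keyM m x) y x ≠ 0 := (h.bucket x y hk).2 ⟨hxy, rfl⟩
  have b2 : removeM m (keyM m x) y x 1 (keyM m x) z x = 0 := by
    rw [removeM_of_ne _ _ (by omega)]
    by_contra hc
    exact hxz ((h.bucket x z hk).1 hc).1
  have s2 := (h.slots.remove b1).push (h.src hxy) b2
  have e0 : ∀ b, pushM (removeM m (keyM m x) y x) (keyM m x) z x 1 0 x b = m 1 0 x b := by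
    intro b
    rw [pushM_of_ne _ _ (by omega), removeM_of_ne _ _ (by omega)]
  have key : ∀ a, keyM (redirectM m x y z) a = keyM m a := fun a =>
    keyM_congr (redirectM_deg h hxy a) (redirectM_tag (by omega) 0 0 a)
  refine ⟨s2.replace (by rw [e0]; exact hxy) hz (by rw [e0]; exact not_not.1 hxz), ?_, ?_, ?_⟩
  · intro a b hab
    rw [arc_redirectM h hxy hyz] at hab
    rcases hab with hab | ⟨rfl, -⟩
    · exact h.src hab.1
    · exact h.src hxy
  · intro k a b hk0
    rw [arc_redirectM h hxy hyz, key]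
    unfold redirectM
    rw [replaceM_of_ne _ _ _ (by omega), pushM_mem, (h.slots _ _).remove_mem b1, h.bucket _ _ hk0]
    grind
  · intro d hd
    rw [redirectM_tag (by omega), h.level d hd]
    simp only [redirectM_deg h hxy]

end redirect

/-- Program for `redirectM`. -/
def redirect (x y z : Ex) : Pr :=
  .seq (getKey 16 x) (.seq (remove (.reg 16) y x) (.seq (push (.reg 16) z x) (replace x y z)))

theorem redirect_vc {n : ℕ} {x y z : Ex} {X Y Z : ℕ} {Q : St → Prop} {r₀ : ℕ → ℕ} {m₀ : Mem} {t₀ : ℕ}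
    (hx : Atom n 16 r₀ x X) (hy : Atom n 16 r₀ y Y) (hz : Atom n 16 r₀ z Z) (h : DS n m₀)
    (hxy : Arc m₀ X Y)
    (hQ : ∀ r' t', (∀ i < 16, r' i = r₀ i) → t' ≤ t₀ + 1000 →
      Q ⟨r', redirectM m₀ X Y Z, t'⟩) : (redirect x y z).vc n Q ⟨r₀, m₀, t₀⟩ := by
  have hB : base n = 2 * n + 8 := rfl
  have hk := h.key_ne hxy
  have b1 : m₀ 1 (keyM m₀ X) Y X ≠ 0 := (h.bucket X Y hk).2 ⟨hxy, rfl⟩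
  have kl := h.keyM_lt X
  simp only [redirect, Pr.vc]
  refine getKey_vc hx (by omega) (h.deg_le X) fun r1 t1 e1 f1 ht1 => ?_
  have g1 : ∀ i < 16, r1 i = r₀ i := fun i hi => f1 i (by omega)
  refine remove_vc (.reg (by omega) (by omega) e1 (by omega)) (hy.mono (by omega) g1)
    (hx.mono (by omega) g1) (h.slots _ _) b1 fun r2 t2 f2 ht2 => ?_
  have g2 : ∀ i < 16, r2 i = r₀ i := fun i hi => (f2 i (by omega)).trans (g1 i hi)
  refine push_vc (.reg (by omega) (by omega) ((f2 16 (by omega)).trans e1) (by omega))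
    (hz.mono (by omega) g2) (hx.mono (by omega) g2) ((h.slots.remove b1) _ _).count_le
    fun t3 ht3 => ?_
  have e0 : ∀ t b, pushM (removeM m₀ (keyM m₀ X) Y X) (keyM m₀ X) Z X t 0 X b = m₀ t 0 X b := by
    intro t b
    rw [pushM_of_ne _ _ (by omega), removeM_of_ne _ _ (by omega)]
  refine replace_vc (hx.mono (by omega) g2) (hy.mono (by omega) g2) (hz.mono (by omega) g2)
    ((h.slots 0 X).congr e0) (ne_of_eq_of_ne (e0 1 Y) hxy) fun r4 t4 f4 ht4 => ?_
  exact hQ r4 t4 (fun i hi => (f4 i (by omega)).trans (g2 i hi)) (by omega)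

/-- Add the arc from `x` to `h`. -/
def addArc (x h : Ex) : Pr :=
  .seq (getKey 20 x) (.seq (.set 21 (.add (.reg 20) (.lit 2))) (.seq (rekey x)
    (.seq (push (.lit 0) x h) (.seq (push (.reg 21) h x)
      (.put (.lit 4) (.lit 0) (.lit 0) (.cell (.lit 3) (.lit 0) x (.lit 0))
        (.add (.cell (.lit 4) (.lit 0) (.lit 0) (.cell (.lit 3) (.lit 0) x (.lit 0)))
          (.lit 1)))))))

theorem Slots.congr_tag {n : ℕ} {m m' : Mem} (h : Slots n m)
    (h' : ∀ t k y z, t ≠ 0 → t ≠ 4 → m' t k y z = m t k y z) : Slots n m' := by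
  intro k y
  refine ⟨?_, ?_⟩
  · intro i hi
    rw [h' _ _ _ _ (by omega) (by omega)] at hi
    rw [h' _ _ _ _ (by omega) (by omega), h' _ _ _ _ (by omega) (by omega)]
    exact (h k y).entry i hi
  · intro v hv
    rw [h' _ _ _ _ (by omega) (by omega)] at hv
    rw [h' _ _ _ _ (by omega) (by omega), h' _ _ _ _ (by omega) (by omega), h' _ _ _ _ (by omega) (by omega)]
    exact (h k y).pos v hv

/-- Raising one outdegree by one crosses a single threshold, so exactly one level cell has to be
corrected. For the removal of an arc it is used with old and new outdegrees exchanged. -/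
theorem card_filter_succ {n d x : ℕ} {f f' : ℕ → ℕ} (hx : x < n) (hd : f' x = f x + 1)
    (h : ∀ v, v ≠ x → f' v = f v) :
    ((Finset.range n).filter fun v => d ≤ f' v).card =
      ((Finset.range n).filter fun v => d ≤ f v).card + if d = f x + 1 then 1 else 0 := by
  split_ifs with hc
  · rw [← Finset.card_insert_of_notMem (a := x) (by simp; omega)]
    congr 1
    ext v
    by_cases hv : v = x
    · subst hv; simp [hx, hd, hc]
    · simp [hv, h v hv]
  · rw [Nat.add_zero]
    congr 1
    ext v
    by_cases hv : v = x
    · subst hv; simp [hd]; omega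
    · simp [h v hv]

/-- One more out-neighbour raises the key by `2`, the parity bit being kept. The old out-neighbours
are rekeyed before `H` joins the list; `H` receives `X` under the new key at once. -/
theorem addArc_vc {n : ℕ} {x h : Ex} {X H : ℕ} {Q : St → Prop} {r₀ : ℕ → ℕ} {m₀ : Mem} {t₀ : ℕ}
    (hx : Atom n 20 r₀ x X) (hh : Atom n 20 r₀ h H) (hX : X < n) (hH : H < n) (hS : DS n m₀)
    (hXH : ¬ Arc m₀ X H)
    (hQ : ∀ r' m' t', (∀ i < 20, r' i = r₀ i) → DS n m' →
      (∀ a b, m' 1 0 a b = if a = X ∧ b = H then deg m₀ X + 1 else m₀ 1 0 a b) →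
      (∀ a, deg m' a = if a = X then deg m₀ X + 1 else deg m₀ a) →
      (∀ v, m' 0 0 0 v = m₀ 0 0 0 v) → t' ≤ t₀ + 1000 + 700 * deg m₀ X → Q ⟨r', m', t'⟩) :
    (addArc x h).vc n Q ⟨r₀, m₀, t₀⟩ := by
  have hB : base n = 2 * n + 8 := rfl
  have kl := hS.keyM_lt X
  have kd := DS.two_deg_le (m := m₀) X
  set κ := keyM m₀ X with hκ
  simp only [addArc, Pr.vc]
  refine getKey_vc hx (by omega) (hS.deg_le X) fun r1 t1 e1 f1 ht1 => ?_
  have g1 : ∀ i < 20, r1 i = r₀ i := fun i hi => f1 i (by omega)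
  refine ⟨by omega, ?_, ?_⟩
  · simp [Ex.Ok, Ex.eval, e1, ← hκ]; omega
  have e21 : ∀ v, Function.update r1 21 v 20 = κ := fun v => by simp [e1, hκ]
  have g2 : ∀ v, ∀ i < 20, Function.update r1 21 v i = r₀ i := fun v i hi => by
    rw [Function.update_of_ne (by omega), g1 i hi]
  simp only [Ex.eval, e1, ← hκ, Ex.cost]
  refine rekey_vc (K0 := κ) (K1 := κ + 2) (hx.mono (by omega) (g2 _)) hX hS.slots (e21 (κ + 2))
    (by simp) (by omega) (by omega) ?_ fun r3 m3 t3 f3 hR ht3 => ?_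
  · intro y hy
    have hk0 : κ ≠ 0 := hS.key_ne hy
    refine ⟨hk0, by omega, (hS.bucket X y hk0).2 ⟨hy, rfl⟩, ?_⟩
    by_contra hc
    have := ((hS.bucket X y (k := κ + 2) (by omega)).1 hc).2
    omega
  have g3 : ∀ i < 20, r3 i = r₀ i := fun i hi => (f3 i (by omega)).trans (g2 _ i hi)
  have z3 : m3 1 0 X H = 0 := by rw [hR.zero]; exact not_not.1 hXH
  refine push_vc (Atom.lit (by omega)) (hx.mono (by omega) g3) (hh.mono (by omega) g3)
    (hR.slots _ _).count_le fun t4 ht4 => ?_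
  have s4 := hR.slots.push hH z3
  have z4 : pushM m3 0 X H 1 (κ + 2) H X = 0 := by
    rw [pushM_of_ne _ _ (by omega)]
    by_contra hc
    rcases (hR.mem _ _ _).1 hc with ⟨h1, -⟩ | ⟨-, -, h1, -⟩
    · exact hXH ((hS.bucket X H (by omega)).1 h1).1
    · exact hXH h1
  refine push_vc (K := κ + 2) (.reg (by omega) (by omega)
    ((f3 21 (by omega)).trans (by simp)) (by omega))
    (hh.mono (by omega) g3) (hx.mono (by omega) g3) (s4 _ _).count_le fun t5 ht5 => ?_
  have s5 := s4.push hX z4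
  have okx : ∀ m, x.Ok n r3 m := fun m => hx.ok _ m g3
  have evx : ∀ m, x.eval r3 m = X := fun m => hx.eval _ m g3
  have d5 : pushM (pushM m3 0 X H) (κ + 2) H X 3 0 X 0 = deg m₀ X + 1 := by
    rw [pushM_of_ne _ _ (by omega), pushM_count, hR.zero]; rfl
  have c5 : ∀ d, pushM (pushM m3 0 X H) (κ + 2) H X 4 0 0 d = m₀ 4 0 0 d := by
    intro d
    rw [pushM_of_tag _ _ _ _ (by omega), pushM_of_tag _ _ _ _ (by omega), hR.zero]
  have bx := hx.lt
  have cx := hx.cost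
  -- The lengthened list still consists of distinct vertices, hence the index of the level cell is a
  -- legal digit.
  have dl : deg m₀ X + 1 ≤ n := by
    have := (s5 0 X).count_le
    rwa [d5] at this
  have c5' : m₀ 4 0 0 (deg m₀ X + 1) ≤ n := by
    rw [hS.level _ (by omega)]
    exact (Finset.card_le_card (Finset.filter_subset _ _)).trans (by simp)
  refine ⟨?_, ?_, ?_⟩
  · simp [Ex.Ok, Ex.eval, okx, evx, d5, hB]; omega
  · simp [Ex.Ok, Ex.eval, okx, evx, d5, hB, c5]; omega
  have hdeg : ∀ m' : Mem, (∀ t k y z, t ≠ 4 → m' t k y z = pushM (pushM m3 0 X H) (κ + 2) H X t k y z)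
      → ∀ a, deg m' a = if a = X then deg m₀ X + 1 else deg m₀ a := by
    intro m' hm' a
    unfold deg
    rw [hm' _ _ _ _ (by omega)]
    split_ifs with ha
    · rw [ha]; exact d5
    · rw [pushM_of_ne _ _ (by omega), pushM_of_ne _ _ (by omega), hR.zero]
  have hpos : ∀ m' : Mem, (∀ t k y z, t ≠ 4 → m' t k y z = pushM (pushM m3 0 X H) (κ + 2) H X t k y z)
      → ∀ a b, m' 1 0 a b = if a = X ∧ b = H then deg m₀ X + 1 else m₀ 1 0 a b := by
    intro m' hm' a b
    rw [hm' _ _ _ _ (by omega), pushM_of_ne _ _ (by omega), pushM_pos, hR.zero, hR.zero]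
    unfold deg
    split_ifs <;> first | rfl | omega
  simp only [evx, d5, c5]
  generalize hm' : upd (pushM (pushM m3 0 X H) (κ + 2) H X) 4 0 0 (deg m₀ X + 1)
    (m₀ 4 0 0 (deg m₀ X + 1) + 1) = m'
  have h4 : ∀ t k y z, t ≠ 4 → m' t k y z = pushM (pushM m3 0 X H) (κ + 2) H X t k y z := by
    intro t k y z ht
    rw [← hm']; unfold upd; rw [if_neg (by omega)]
  have hdeg := hdeg m' h4
  have hpos := hpos m' h4
  have h0 : ∀ v, m' 0 0 0 v = m₀ 0 0 0 v := by
    intro v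
    rw [h4 _ _ _ _ (by omega), pushM_of_tag _ _ _ _ (by omega), pushM_of_tag _ _ _ _ (by omega),
      hR.zero]
  have harc : ∀ a b, Arc m' a b ↔ Arc m₀ a b ∨ (a = X ∧ b = H) := by
    intro a b
    unfold Arc
    rw [hpos]
    split_ifs with hc <;> simp [hc]
  have hkey : ∀ a, keyM m' a = if a = X then κ + 2 else keyM m₀ a := by
    intro a
    split_ifs with ha
    · subst ha
      have := hdeg a
      simp only [if_true] at this
      rw [hκ]; unfold keyM deg at *; rw [this, h0]; ring
    · exact keyM_congr (by rw [hdeg, if_neg ha]) (h0 a)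
  refine hQ _ _ _ g3 ⟨s5.congr_tag fun t k y z _ => h4 t k y z, ?_, ?_, ?_⟩ hpos hdeg h0 ?_
  · intro a b hab
    rcases (harc a b).1 hab with h | ⟨rfl, -⟩
    · exact hS.src h
    · exact hX
  · intro k a b hk
    rw [harc, hkey, h4 _ _ _ _ (by omega), pushM_mem]
    rw [pushM_of_ne _ _ (by omega), hR.mem, hS.bucket a b hk]
    have : Arc m₀ X b → m₀ 1 0 X b ≤ m₀ 3 0 X 0 := fun hc => hS.pos_le hc
    unfold Arc at *
    grind
  · intro d hd
    rw [card_filter_succ (f := deg m₀) hX (by rw [hdeg, if_pos rfl])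
      (fun v hv => by rw [hdeg, if_neg hv]), ← hS.level d hd, ← hm']
    unfold upd
    rw [c5]
    split_ifs <;> grind
  · have : m₀ 3 0 X 0 = deg m₀ X := rfl
    omega

/-- Remove the arc from `x` to `h`. -/
def removeArc (x h : Ex) : Pr :=
  .seq (getKey 20 x) (.seq (.set 21 (.sub (.reg 20) (.lit 2)))
    (.seq (remove (.lit 0) x h) (.seq (remove (.reg 20) h x) (.seq (rekey x)
      (.put (.lit 4) (.lit 0) (.lit 0) (.add (.cell (.lit 3) (.lit 0) x (.lit 0)) (.lit 1))
        (.sub (.cell (.lit 4) (.lit 0) (.lit 0)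
          (.add (.cell (.lit 3) (.lit 0) x (.lit 0)) (.lit 1))) (.lit 1)))))))

/-- Here `H` leaves the list and its bucket first, so that the loop only rekeys the remaining
out-neighbours. The newest arc inherits the position of the removed one, as the formula for
positions records. -/
theorem removeArc_vc {n : ℕ} {x h : Ex} {X H : ℕ} {Q : St → Prop} {r₀ : ℕ → ℕ} {m₀ : Mem} {t₀ : ℕ}
    (hx : Atom n 20 r₀ x X) (hh : Atom n 20 r₀ h H) (hS : DS n m₀) (hXH : Arc m₀ X H)
    (hQ : ∀ r' m' t', (∀ i < 20, r' i = r₀ i) → DS n m' →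
      (∀ a b, m' 1 0 a b = if a = X then (if b = H then 0 else
        if m₀ 1 0 X b = deg m₀ X then m₀ 1 0 X H else m₀ 1 0 X b) else m₀ 1 0 a b) →
      (∀ a, deg m' a = if a = X then deg m₀ X - 1 else deg m₀ a) →
      (∀ v, m' 0 0 0 v = m₀ 0 0 0 v) → t' ≤ t₀ + 2000 + 700 * deg m₀ X → Q ⟨r', m', t'⟩) :
    (removeArc x h).vc n Q ⟨r₀, m₀, t₀⟩ := by
  have hB : base n = 2 * n + 8 := rfl
  have hX := hS.src hXH
  have hH := hS.dst hXH
  have kl := hS.keyM_lt X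
  have kd := DS.two_deg_le (m := m₀) X
  have dp := hS.deg_pos hXH
  have dl := hS.deg_le X
  have hk := hS.key_ne hXH
  set κ := keyM m₀ X with hκ
  simp only [removeArc, Pr.vc]
  refine getKey_vc hx (by omega) (hS.deg_le X) fun r1 t1 e1 f1 ht1 => ?_
  have g1 : ∀ i < 20, r1 i = r₀ i := fun i hi => f1 i (by omega)
  refine ⟨by omega, ?_, ?_⟩
  · simp [Ex.Ok]
  have e21 : ∀ v, Function.update r1 21 v 20 = κ := fun v => by simp [e1, hκ]
  have g2 : ∀ v, ∀ i < 20, Function.update r1 21 v i = r₀ i := fun v i hi => by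
    rw [Function.update_of_ne (by omega), g1 i hi]
  simp only [Ex.eval, e1, ← hκ, Ex.cost]
  refine remove_vc (Atom.lit (by omega)) (hx.mono (by omega) (g2 _)) (hh.mono (by omega) (g2 _))
    (hS.slots _ _) hXH fun r3 t3 f3 ht3 => ?_
  have g3 : ∀ i < 20, r3 i = r₀ i := fun i hi => (f3 i (by omega)).trans (g2 _ i hi)
  have e3 : r3 20 = κ := (f3 20 (by omega)).trans (e21 (κ - 2))
  have e3' : r3 21 = κ - 2 := (f3 21 (by omega)).trans (by simp)
  have s3 := hS.slots.remove hXH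
  have p3 := (hS.slots 0 X).remove_pos hXH
  have q3 := (hS.slots 0 X).remove_mem hXH
  have b0 : m₀ 1 κ H X ≠ 0 := (hS.bucket X H hk).2 ⟨hXH, rfl⟩
  have b1 : removeM m₀ 0 X H 1 κ H X ≠ 0 := by rwa [removeM_of_ne _ _ (by omega)]
  refine remove_vc (K := κ) (.reg (by omega) (by omega) e3 (by omega)) (hh.mono (by omega) g3)
    (hx.mono (by omega) g3) (s3 _ _) b1 fun r4 t4 f4 ht4 => ?_
  have g4 : ∀ i < 20, r4 i = r₀ i := fun i hi => (f4 i (by omega)).trans (g3 i hi)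
  have s4 := s3.remove b1
  have q4 := (s3 κ H).remove_mem b1
  have z4 : ∀ t y z, removeM (removeM m₀ 0 X H) κ H X t 0 y z = removeM m₀ 0 X H t 0 y z :=
    fun t y z => removeM_of_ne _ _ (by omega)
  have d4 : removeM (removeM m₀ 0 X H) κ H X 3 0 X 0 = deg m₀ X - 1 := by
    rw [z4, removeM_count]; rfl
  refine rekey_vc (K0 := κ) (K1 := κ - 2) (hx.mono (by omega) g4) hX s4
    ((f4 20 (by omega)).trans e3) ((f4 21 (by omega)).trans e3') (by omega) (by omega) ?_
    fun r5 m5 t5 f5 hR ht5 => ?_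
  · intro y hy
    have hy' := hy
    rw [z4, q3] at hy'
    have c := (s4 0 X).pos y hy
    rw [d4] at c
    refine ⟨hk, by omega, ?_, ?_⟩
    · rw [q4, removeM_of_ne _ _ (by omega)]
      exact ⟨(hS.bucket X y hk).2 ⟨hy'.1, rfl⟩, by omega⟩
    · by_contra hc
      rw [removeM_of_ne _ _ (by omega), removeM_of_ne _ _ (by omega)] at hc
      have := ((hS.bucket X y (k := κ - 2) (by omega)).1 hc).2
      omega
  have g5 : ∀ i < 20, r5 i = r₀ i := fun i hi => (f5 i (by omega)).trans (g4 i hi)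
  have okx : ∀ m, x.Ok n r5 m := fun m => hx.ok _ m g5
  have evx : ∀ m, x.eval r5 m = X := fun m => hx.eval _ m g5
  have d5 : m5 3 0 X 0 = deg m₀ X - 1 := (hR.zero _ _ _).trans d4
  have c5 : ∀ d, m5 4 0 0 d = m₀ 4 0 0 d := by
    intro d
    rw [hR.zero, removeM_of_tag _ _ _ _ (by omega), removeM_of_tag _ _ _ _ (by omega)]
  have bx := hx.lt
  have cx := hx.cost
  refine ⟨?_, ?_, ?_⟩
  · simp [Ex.Ok, Ex.eval, okx, evx, d5, hB]; omega
  · simp [Ex.Ok, Ex.eval, okx, evx, d5, hB]; omega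
  simp only [evx, d5, c5, Nat.sub_add_cancel dp]
  generalize hm' : upd m5 4 0 0 (deg m₀ X) (m₀ 4 0 0 (deg m₀ X) - 1) = m'
  have h4 : ∀ t k y z, t ≠ 4 → m' t k y z = m5 t k y z := by
    intro t k y z ht
    rw [← hm']; unfold upd; rw [if_neg (by omega)]
  have hdeg : ∀ a, deg m' a = if a = X then deg m₀ X - 1 else deg m₀ a := by
    intro a
    unfold deg
    rw [h4 _ _ _ _ (by omega)]
    split_ifs with ha
    · rw [ha]; exact d5
    · rw [hR.zero]
      rw [z4, removeM_of_ne _ _ (by omega)]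
  have hpos : ∀ a b, m' 1 0 a b = if a = X then (if b = H then 0 else
        if m₀ 1 0 X b = deg m₀ X then m₀ 1 0 X H else m₀ 1 0 X b) else m₀ 1 0 a b := by
    intro a b
    rw [h4 _ _ _ _ (by omega), hR.zero]
    rw [z4, p3]
    simp only [true_and]
    rfl
  have h0 : ∀ v, m' 0 0 0 v = m₀ 0 0 0 v := by
    intro v
    rw [h4 _ _ _ _ (by omega), hR.zero, removeM_of_tag _ _ _ _ (by omega),
      removeM_of_tag _ _ _ _ (by omega)]
  have harc : ∀ a b, Arc m' a b ↔ Arc m₀ a b ∧ ¬ (a = X ∧ b = H) := by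
    intro a b
    unfold Arc
    rw [h4 _ _ _ _ (by omega), hR.zero]
    rw [z4, q3]
    simp
  have hkey : ∀ a, keyM m' a = if a = X then κ - 2 else keyM m₀ a := by
    intro a
    split_ifs with ha
    · subst ha
      have := hdeg a
      simp only [if_true] at this
      rw [hκ]; unfold keyM deg at *; rw [this, h0]; omega
    · exact keyM_congr (by rw [hdeg, if_neg ha]) (h0 a)
  refine hQ _ _ _ g5 ⟨hR.slots.congr_tag fun t k y z _ => h4 t k y z, ?_, ?_, ?_⟩ hpos hdeg h0 ?_
  · intro a b hab
    exact hS.src ((harc a b).1 hab).1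
  · intro k a b hk'
    rw [harc, hkey, h4 _ _ _ _ (by omega), hR.mem]
    have e1 : removeM (removeM m₀ 0 X H) κ H X 1 k b a ≠ 0 ↔
        (Arc m₀ a b ∧ k = keyM m₀ a) ∧ ¬ (k = κ ∧ b = H ∧ a = X) := by
      rw [q4, removeM_of_ne _ _ (by omega), hS.bucket a b hk']
    have e2 : removeM (removeM m₀ 0 X H) κ H X 1 0 X b ≠ 0 ↔ Arc m₀ X b ∧ b ≠ H := by
      rw [z4, q3]; simp [Arc]
    have e3 : removeM (removeM m₀ 0 X H) κ H X 1 0 X b ≠ 0 →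
        removeM (removeM m₀ 0 X H) κ H X 1 0 X b ≤
          removeM (removeM m₀ 0 X H) κ H X 3 0 X 0 := fun hc => ((s4 0 X).pos b hc).1
    rw [e1]
    grind
  · intro d hd
    have := card_filter_succ (d := d) (f := deg m') (f' := deg m₀) hX
      (by rw [hdeg, if_pos rfl]; omega) (fun v hv => by rw [hdeg, if_neg hv])
    rw [← hS.level d hd, hdeg, if_pos rfl, Nat.sub_add_cancel dp] at this
    have e : m' 4 0 0 d = if d = deg m₀ X then m₀ 4 0 0 (deg m₀ X) - 1 else m₀ 4 0 0 d := by
      rw [← hm']; unfold upd; rw [c5]; simp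
    rw [e]
    by_cases hdd : d = deg m₀ X
    · subst hdd; simp at this ⊢; omega
    · simp [hdd] at this ⊢; omega
  · omega

end RamLang

/-! ### Ageing of out-lists: inspecting the oldest arcs and making them the newest -/

namespace RamLang

open WordRAM

/-- The memories differ at most in the unused part of the slot `(0, X)`. -/
def Same (m m' : Mem) (X : ℕ) : Prop :=
  ∀ t k y j, ¬ (t = 2 ∧ k = 0 ∧ y = X ∧ deg m X ≤ j) → m' t k y j = m t k y j

theorem DS.same {n X : ℕ} {m m' : Mem} (h : DS n m) (h' : Same m m' X) : DS n m' := by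
  have hd : ∀ a, deg m' a = deg m a := fun a => h' 3 0 a 0 (by omega)
  have hk : ∀ a, keyM m' a = keyM m a := fun a => keyM_congr (hd a) (h' 0 0 0 a (by omega))
  have ha : ∀ a b, Arc m' a b ↔ Arc m a b := fun a b => by
    unfold Arc; rw [h' 1 0 a b (by omega)]
  refine ⟨?_, fun hab => h.src ((ha _ _).1 hab), ?_, ?_⟩
  · intro k y
    refine ⟨?_, ?_⟩
    · intro i hi
      rw [h' 3 k y 0 (by omega)] at hi
      rw [h' 2 k y i (by unfold deg; rintro ⟨-, rfl, rfl, hc⟩; omega), h' 1 k y _ (by omega)]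
      exact (h.slots k y).entry i hi
    · intro x hx
      rw [h' 1 k y _ (by omega)] at hx
      have := (h.slots k y).pos x hx
      rw [h' 1 k y _ (by omega), h' 3 k y 0 (by omega),
        h' 2 k y _ (by unfold deg; rintro ⟨-, rfl, rfl, hc⟩; omega)]
      exact this
  · intro k x y hk0
    rw [h' 1 k y x (by omega), ha, hk, h.bucket x y hk0]
  · intro d hd0
    rw [h' 4 0 0 d (by omega), h.level d hd0]
    simp only [hd]

/-- Look for an out-neighbour of `x` of smaller outdegree among the first entries of the slot
`(0, x)`, as many as register `3` says, while copying these entries to the end. -/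
def scan (x : Ex) : Pr :=
  .seq (.set 12 (.lit 0)) (.seq (.set 13 (.lit 0)) (.seq (.set 14 (.reg 3))
    (.seq (.ite .lt (.cell (.lit 3) (.lit 0) x (.lit 0)) (.reg 14)
        (.set 14 (.cell (.lit 3) (.lit 0) x (.lit 0))) .skip)
      (.loop .lt (.reg 13) (.reg 14)
        (.seq (.set 15 (.cell (.lit 2) (.lit 0) x (.reg 13)))
          (.seq (.put (.lit 2) (.lit 0) x (.add (.cell (.lit 3) (.lit 0) x (.lit 0)) (.reg 13))
              (.reg 15))
            (.ite .lt (.cell (.lit 3) (.lit 0) (.reg 15) (.lit 0))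
              (.cell (.lit 3) (.lit 0) x (.lit 0))
              (.seq (.set 12 (.lit 1)) (.set 14 (.lit 0)))
              (.set 13 (.add (.reg 13) (.lit 1))))))))))

/-- Small positions are old arcs, so the scan inspects the oldest ones. The copies behind the end of
the list prepare a rotation; they reach indices up to almost `2 * n`, which `base n` accommodates.
-/
theorem scan_vc {n γ : ℕ} {x : Ex} {X : ℕ} {Q : St → Prop} {r₀ : ℕ → ℕ} {m₀ : Mem} {t₀ : ℕ}
    (hx : Atom n 12 r₀ x X) (hS : DS n m₀) (h3 : r₀ 3 = γ)
    (hQ1 : ∀ r' m' t' y, (∀ i < 12, r' i = r₀ i) → r' 12 = 1 → r' 15 = y → Arc m₀ X y →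
      deg m₀ y < deg m₀ X → Same m₀ m' X → t' ≤ t₀ + 300 + 200 * γ → Q ⟨r', m', t'⟩)
    (hQ0 : ∀ r' m' t' g, (∀ i < 12, r' i = r₀ i) → r' 12 = 0 → r' 14 = g → g = min γ (deg m₀ X) →
      (∀ y, Arc m₀ X y → m₀ 1 0 X y ≤ g → deg m₀ X ≤ deg m₀ y) → Same m₀ m' X →
      (∀ j < g, m' 2 0 X (deg m₀ X + j) = m₀ 2 0 X j) → t' ≤ t₀ + 300 + 200 * γ → Q ⟨r', m', t'⟩) :
    (scan x).vc n Q ⟨r₀, m₀, t₀⟩ := by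
  have hB : base n = 2 * n + 8 := rfl
  have cx := hx.cost
  have bx := hx.lt
  have dl := hS.deg_le X
  have hD : m₀ 3 0 X 0 = deg m₀ X := rfl
  have ok : ∀ {r : ℕ → ℕ} (_ : ∀ i < 12, r i = r₀ i) (m : Mem), x.Ok n r m :=
    fun h m => hx.ok _ m h
  have ev : ∀ {r : ℕ → ℕ} (_ : ∀ i < 12, r i = r₀ i) (m : Mem), x.eval r m = X :=
    fun h m => hx.eval _ m h
  set r1 := Function.update (Function.update (Function.update r₀ 12 0) 13 0) 14 γ with hr1
  have f1 : ∀ i < 12, r1 i = r₀ i := by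
    intro i hi
    rw [hr1, Function.update_of_ne (by omega), Function.update_of_ne (by omega),
      Function.update_of_ne (by omega)]
  -- the loop
  have loop : ∀ r t, (∀ i < 12, r i = r₀ i) → r 12 = 0 → r 13 = 0 → r 14 = min γ (deg m₀ X) →
      t ≤ t₀ + 100 → Pr.vc n (.loop .lt (.reg 13) (.reg 14)
        (.seq (.set 15 (.cell (.lit 2) (.lit 0) x (.reg 13)))
          (.seq (.put (.lit 2) (.lit 0) x (.add (.cell (.lit 3) (.lit 0) x (.lit 0)) (.reg 13))
              (.reg 15))
            (.ite .lt (.cell (.lit 3) (.lit 0) (.reg 15) (.lit 0))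
              (.cell (.lit 3) (.lit 0) x (.lit 0))
              (.seq (.set 12 (.lit 1)) (.set 14 (.lit 0)))
              (.set 13 (.add (.reg 13) (.lit 1))))))) Q ⟨r, m₀, t⟩ := by
    intro r t fr e12 e13 e14 ht
    set g := min γ (deg m₀ X) with hg
    -- Success is signalled by register `12` and ends the loop by setting the bound in register `14`
    -- to `0`; this is the second alternative.
    refine ⟨fun k T => (∀ i < 12, T.r i = r₀ i) ∧ Same m₀ T.m X ∧
      ((T.r 12 = 0 ∧ T.r 14 = g ∧ T.r 13 ≤ g ∧ T.r 13 + k = g + 1 ∧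
          (∀ y, Arc m₀ X y → m₀ 1 0 X y ≤ T.r 13 → deg m₀ X ≤ deg m₀ y) ∧
          (∀ j < T.r 13, T.m 2 0 X (deg m₀ X + j) = m₀ 2 0 X j) ∧
          T.t ≤ t₀ + 100 + 200 * T.r 13) ∨
        (T.r 12 = 1 ∧ T.r 14 = 0 ∧ Arc m₀ X (T.r 15) ∧ deg m₀ (T.r 15) < deg m₀ X ∧
          T.t ≤ t₀ + 250 + 200 * g)), ⟨g + 1, fr, fun _ _ _ _ _ => rfl, Or.inl ⟨e12, e14, ?_, ?_,
            ?_, ?_, ?_⟩⟩, ?_⟩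
    · simp only [e13]; omega
    · simp only [e13]; omega
    · intro y hy hp
      simp only [e13] at hp
      exact absurd hp (by unfold Arc at hy; omega)
    · intro j hj
      simp [e13] at hj
    · simp only [e13]; omega
    · rintro k ⟨r, m, t⟩ ⟨fr, hsame, h⟩
      simp only at fr hsame h
      refine ⟨by simp [Ex.Ok], by simp [Ex.Ok], ?_, ?_⟩
      · intro hlt
        simp only [Ex.eval, Cmp.Holds] at hlt
        rcases h with ⟨e12, e14, hle, hk, hall, hcopy, ht⟩ | ⟨e12, e14, -⟩
        swap
        · omega
        have hi : r 13 < deg m₀ X := by omega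
        obtain ⟨hyn, hyp⟩ := (hS.slots 0 X).entry (r 13) hi
        have e2 : m 2 0 X (r 13) = m₀ 2 0 X (r 13) := hsame _ _ _ _ (by omega)
        have e3 : ∀ v, m 3 0 v 0 = deg m₀ v := fun v => hsame _ _ _ _ (by omega)
        generalize hy : m₀ 2 0 X (r 13) = y at *
        have fr' : ∀ i < 12, Function.update r 15 y i = r₀ i := fun i hi => by
          rw [Function.update_of_ne (by omega), fr i hi]
        refine ⟨by omega, ?_, ?_⟩
        · simp [Ex.Ok, Ex.eval, ok fr, ev fr, hB]; omega
        simp only [Ex.eval, ev fr, e2]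
        have g13 : Function.update r 15 y 13 = r 13 := by simp
        have g15 : Function.update r 15 y 15 = y := by simp
        have e3' : ∀ j w v, upd m 2 0 X j w 3 0 v 0 = deg m₀ v := fun j w v => by
          rw [← e3]; unfold upd; simp
        have hsame' : Same m₀ (upd m 2 0 X (deg m₀ X + r 13) y) X := by
          intro t' k' y' j' hne
          rw [← hsame t' k' y' j' hne]
          unfold upd
          rw [if_neg]
          rintro ⟨h1, h2, h3, h4⟩
          exact hne ⟨h1, h2, h3, by omega⟩
        have harc : Arc m₀ X y := by unfold Arc; omega
        refine ⟨?_, by simp [Ex.Ok], ?_⟩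
        · simp [Ex.Ok, Ex.eval, ok fr', ev fr', hB, e3]; omega
        simp only [Ex.eval, ev fr', e3, g13, g15]
        refine ⟨?_, ?_, ?_, ?_⟩
        · simp [Ex.Ok, Ex.eval, hB]; omega
        · simp [Ex.Ok, Ex.eval, ok fr', ev fr', hB]; omega
        · intro hc
          simp only [Ex.eval, ev fr', e3', g15, Cmp.Holds] at hc
          refine ⟨by omega, by simp [Ex.Ok], by omega, by simp [Ex.Ok], k - 1, by omega, ?_, hsame',
            Or.inr ⟨?_, ?_, ?_, ?_, ?_⟩⟩
          · intro i hi
            simp only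
            rw [Function.update_of_ne (by omega), Function.update_of_ne (by omega), fr' i hi]
          · simp [Ex.eval]
          · simp [Ex.eval]
          · simpa using harc
          · simpa using hc
          · simp only [Ex.cost]; omega
        · intro hc
          simp only [Ex.eval, ev fr', e3', g15, Cmp.Holds, not_lt] at hc
          refine ⟨by omega, ?_, k - 1, by omega, ?_, hsame', Or.inl ⟨?_, ?_, ?_, ?_, ?_, ?_, ?_⟩⟩
          · simp [Ex.Ok, Ex.eval]; omega
          · intro i hi
            simp only
            rw [Function.update_of_ne (by omega), fr' i hi]
          · simpa [Ex.eval] using e12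
          · simpa [Ex.eval] using e14
          · simp [Ex.eval]; omega
          · simp [Ex.eval]; omega
          · intro z hz hpz
            simp [Ex.eval] at hpz
            by_cases hzy : m₀ 1 0 X z = r 13 + 1
            · have := ((hS.slots 0 X).pos z hz).2
              rw [hzy, Nat.add_sub_cancel, hy] at this
              rwa [← this]
            · exact hall z hz (by omega)
          · intro j hj
            simp [Ex.eval] at hj
            simp only [upd]
            by_cases hjj : j = r 13
            · simp [hjj, hy]
            · simp [hjj]; exact hcopy j (by omega)
          · simp [Ex.eval, Ex.cost]; omega
      · intro hge
        simp only [Ex.eval, Cmp.Holds, not_lt] at hge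
        rcases h with ⟨e12, e14, hle, hk, hall, hcopy, ht⟩ | ⟨e12, e14, h1, h2, h3⟩
        · have : r 13 = g := by omega
          rw [this] at hall hcopy ht
          refine hQ0 r m _ g fr e12 e14 hg hall hsame hcopy ?_
          simp only [Ex.cost]; omega
        · refine hQ1 r m _ _ fr e12 rfl h1 h2 hsame ?_
          simp only [Ex.cost]; omega
  refine ⟨by omega, by simp [Ex.Ok], by omega, by simp [Ex.Ok], by omega, by simp [Ex.Ok], ?_⟩
  simp only [Ex.eval]
  have e3 : Function.update (Function.update r₀ 12 0) 13 0 3 = γ := by simp [h3]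
  rw [e3, ← hr1]
  refine ⟨?_, by simp [Ex.Ok], ?_, ?_⟩
  · simp [Ex.Ok, Ex.eval, ok f1, ev f1, hB]; omega
  · intro hc
    simp only [Ex.eval, ev f1, Cmp.Holds, hD] at hc
    refine ⟨by omega, ?_, loop _ _ ?_ ?_ ?_ ?_ ?_⟩
    · simp [Ex.Ok, Ex.eval, ok f1, ev f1, hB]; omega
    · intro i hi
      rw [Function.update_of_ne (by omega)]
      exact f1 i hi
    · simp [hr1]
    · simp [hr1]
    · simp only [Ex.eval, ev f1, Function.update_self, hD]
      simp [hr1] at hc; omega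
    · simp only [Ex.cost]; omega
  · intro hc
    simp only [Ex.eval, ev f1, Cmp.Holds, hD, not_lt] at hc
    refine loop _ _ f1 ?_ ?_ ?_ ?_
    · simp [hr1]
    · simp [hr1]
    · simp [hr1] at hc ⊢; omega
    · simp only [Ex.cost]; omega

/-- Cyclic shift of the positions in the slot `(0, x)` by the content of register `14`. -/
def rotate (x : Ex) : Pr :=
  .seq (.set 13 (.lit 0))
    (.loop .lt (.reg 13) (.cell (.lit 3) (.lit 0) x (.lit 0))
      (.seq (.set 15 (.cell (.lit 2) (.lit 0) x (.add (.reg 13) (.reg 14))))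
        (.seq (.put (.lit 2) (.lit 0) x (.reg 13) (.reg 15))
          (.seq (.put (.lit 1) (.lit 0) x (.reg 15) (.add (.reg 13) (.lit 1)))
            (.set 13 (.add (.reg 13) (.lit 1)))))))

/-- The position `p` among `d` after a cyclic shift by `g`. -/
def shifted (d g p : ℕ) : ℕ := if p = 0 then 0 else if p ≤ g then p + d - g else p - g

/-- Index `i` receives the entry with index `i + g`. Beyond the end of the list that cell holds the
copy made by the scan, so no wrap-around is needed, and going upwards the loop never reads a cell
that it has already overwritten. -/
theorem rotate_vc {n g : ℕ} {x : Ex} {X : ℕ} {Q : St → Prop} {r₀ : ℕ → ℕ} {m₀ : Mem} {t₀ : ℕ}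
    (hx : Atom n 12 r₀ x X) (hS : DS n m₀) (h14 : r₀ 14 = g) (hg : g ≤ deg m₀ X)
    (hcopy : ∀ j < g, m₀ 2 0 X (deg m₀ X + j) = m₀ 2 0 X j)
    (hQ : ∀ r' m' t', (∀ i < 12, r' i = r₀ i) → DS n m' →
      (∀ t k y z, ¬ (k = 0 ∧ y = X ∧ (t = 1 ∨ t = 2)) → m' t k y z = m₀ t k y z) →
      (∀ z, m' 1 0 X z = shifted (deg m₀ X) g (m₀ 1 0 X z)) → t' ≤ t₀ + 100 + 200 * deg m₀ X →
      Q ⟨r', m', t'⟩) : (rotate x).vc n Q ⟨r₀, m₀, t₀⟩ := by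
  have hB : base n = 2 * n + 8 := rfl
  have cx := hx.cost
  have bx := hx.lt
  have dl := hS.deg_le X
  set d := deg m₀ X with hd
  have ok : ∀ {r : ℕ → ℕ} (_ : ∀ i < 12, r i = r₀ i) (m : Mem), x.Ok n r m :=
    fun h m => hx.ok _ m h
  have ev : ∀ {r : ℕ → ℕ} (_ : ∀ i < 12, r i = r₀ i) (m : Mem), x.eval r m = X :=
    fun h m => hx.eval _ m h
  -- the entry that is moved to index `i`
  have src : ∀ i < d, m₀ 2 0 X (i + g) < n ∧
      shifted d g (m₀ 1 0 X (m₀ 2 0 X (i + g))) = i + 1 ∧ m₀ 1 0 X (m₀ 2 0 X (i + g)) ≠ 0 := by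
    intro i hi
    unfold shifted
    by_cases hlt : i + g < d
    · obtain ⟨h1, h2⟩ := (hS.slots 0 X).entry (i + g) hlt
      rw [h2]
      refine ⟨h1, ?_, by omega⟩
      rw [if_neg (by omega), if_neg (by omega)]; omega
    · have e := hcopy (i + g - d) (by omega)
      rw [show d + (i + g - d) = i + g by omega] at e
      obtain ⟨h1, h2⟩ := (hS.slots 0 X).entry (i + g - d) (show _ < d by omega)
      rw [e, h2]
      refine ⟨h1, ?_, by omega⟩
      rw [if_neg (by omega), if_pos (by omega)]; omega
  -- The shift permutes the positions `1, …, d`, so each vertex is assigned its new position in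
  -- exactly one round.
  have inj : ∀ z w, m₀ 1 0 X z ≠ 0 → m₀ 1 0 X w ≠ 0 →
      shifted d g (m₀ 1 0 X z) = shifted d g (m₀ 1 0 X w) → z = w := by
    intro z w hz hw h
    obtain ⟨h1, h2⟩ := (hS.slots 0 X).pos z hz
    obtain ⟨h3, h4⟩ := (hS.slots 0 X).pos w hw
    have h1 : m₀ 1 0 X z ≤ d := h1
    have h3 : m₀ 1 0 X w ≤ d := h3
    have : m₀ 1 0 X z = m₀ 1 0 X w := by
      unfold shifted at h
      split_ifs at h <;> omega
    rw [← h2, ← h4, this]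
  have le : ∀ z, m₀ 1 0 X z ≠ 0 →
      1 ≤ shifted d g (m₀ 1 0 X z) ∧ shifted d g (m₀ 1 0 X z) ≤ d := by
    intro z hz
    have h1 : m₀ 1 0 X z ≤ d := ((hS.slots 0 X).pos z hz).1
    unfold shifted
    split_ifs <;> omega
  refine ⟨by omega, by simp [Ex.Ok], fun k T => (∀ i < 12, T.r i = r₀ i) ∧ T.r 14 = g ∧
    T.r 13 + k = d ∧
    (∀ t k y z, ¬ (k = 0 ∧ y = X ∧ (t = 1 ∨ t = 2)) → T.m t k y z = m₀ t k y z) ∧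
    (∀ j, T.m 2 0 X j = if j < T.r 13 then m₀ 2 0 X (j + g) else m₀ 2 0 X j) ∧
    (∀ z, T.m 1 0 X z = if shifted d g (m₀ 1 0 X z) ≤ T.r 13 then shifted d g (m₀ 1 0 X z)
      else m₀ 1 0 X z) ∧ T.t ≤ t₀ + 20 + 200 * T.r 13,
    ⟨d, ?_, ?_, ?_, fun _ _ _ _ _ => rfl, ?_, ?_, ?_⟩, ?_⟩
  · intro i hi
    exact Function.update_of_ne (by omega) _ _
  · simpa using h14
  · simp [Ex.eval]
  · intro j; simp [Ex.eval]
  · intro z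
    simp only [Ex.eval, Function.update_self]
    by_cases hz : m₀ 1 0 X z = 0
    · simp [hz, shifted]
    · have := le z hz
      rw [if_neg (by omega)]
  · simp only [Ex.cost]; omega
  · rintro k ⟨r, m, t⟩ ⟨fr, e14, hk, hoth, hel, hpos, ht⟩
    simp only at fr e14 hk hoth hel hpos ht
    have e3 : m 3 0 X 0 = d := hoth _ _ _ _ (by omega)
    refine ⟨by simp [Ex.Ok], ?_, ?_, ?_⟩
    · simp [Ex.Ok, Ex.eval, ok fr, ev fr, hB]; omega
    · intro hlt
      simp only [Ex.eval, ev fr, Cmp.Holds, e3] at hlt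
      obtain ⟨hyn, hyp, hy0⟩ := src (r 13) hlt
      have hely : m 2 0 X (r 13 + g) = m₀ 2 0 X (r 13 + g) := by
        rw [hel, if_neg (by omega)]
      generalize m₀ 2 0 X (r 13 + g) = y at *
      have fr' : ∀ i < 12, Function.update r 15 y i = r₀ i := fun i hi => by
        rw [Function.update_of_ne (by omega), fr i hi]
      have g13 : Function.update r 15 y 13 = r 13 := by simp
      have g15 : Function.update r 15 y 15 = y := by simp
      refine ⟨by omega, ?_, ?_⟩
      · simp [Ex.Ok, Ex.eval, ok fr, ev fr, hB, e14]; omega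
      simp only [Ex.eval, ev fr, e14, hely]
      refine ⟨?_, by simp [Ex.Ok], ?_⟩
      · simp [Ex.Ok, Ex.eval, ok fr', ev fr', hB]; omega
      simp only [Ex.eval, ev fr', g13, g15]
      refine ⟨?_, ?_, ?_⟩
      · simp [Ex.Ok, Ex.eval, ok fr', ev fr', hB]; omega
      · simp [Ex.Ok, Ex.eval]; omega
      simp only [Ex.eval, ev fr', g13, g15]
      refine ⟨by omega, ?_, k - 1, by omega, ?_, ?_, ?_, ?_, ?_, ?_, ?_⟩
      · simp [Ex.Ok, Ex.eval]; omega
      · intro i hi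
        simp only
        rw [Function.update_of_ne (by omega), fr' i hi]
      · simpa using e14
      · simp [Ex.eval]; omega
      · intro t k y' z hne
        simp only
        rw [← hoth t k y' z hne]
        unfold upd
        rw [if_neg (by omega), if_neg (by omega)]
      · intro j
        simp only [Ex.eval, g13, Function.update_self]
        have : upd (upd m 2 0 X (r 13) y) 1 0 X y (r 13 + 1) 2 0 X j =
            if j = r 13 then y else m 2 0 X j := by
          unfold upd; simp
        rw [this, hel]
        by_cases hj : j = r 13
        · subst hj
          simp only [if_true, Nat.lt_succ_self]
          rw [hel] at hely
          simpa using hely.symm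
        · simp only [hj, if_false]
          by_cases hj' : j < r 13
          · rw [if_pos hj', if_pos (by omega)]
          · rw [if_neg hj', if_neg (by omega)]
      · intro z
        simp only [Ex.eval, g13, Function.update_self]
        have : upd (upd m 2 0 X (r 13) y) 1 0 X y (r 13 + 1) 1 0 X z =
            if z = y then r 13 + 1 else m 1 0 X z := by
          unfold upd; simp
        rw [this, hpos]
        by_cases hz : z = y
        · subst hz
          rw [if_pos rfl, hyp, if_pos le_rfl]
        · rw [if_neg hz]
          have : m₀ 1 0 X z ≠ 0 → shifted d g (m₀ 1 0 X z) ≠ r 13 + 1 := fun h0 h1 =>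
            hz (inj z y h0 hy0 (h1.trans hyp.symm))
          by_cases h0 : m₀ 1 0 X z = 0
          · simp [h0, shifted]
          · have := this h0
            by_cases hle : shifted d g (m₀ 1 0 X z) ≤ r 13
            · rw [if_pos hle, if_pos (by omega)]
            · rw [if_neg hle, if_neg (by omega)]
      · simp [Ex.eval, Ex.cost]; omega
    · intro hge
      simp only [Ex.eval, ev fr, Cmp.Holds, e3, not_lt] at hge
      have h13 : r 13 = d := by omega
      simp only [h13] at hel hpos ht
      have hpos' : ∀ z, m 1 0 X z = shifted d g (m₀ 1 0 X z) := by
        intro z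
        rw [hpos]
        by_cases h0 : m₀ 1 0 X z = 0
        · simp [h0, shifted]
        · rw [if_pos (le z h0).2]
      have hne0 : ∀ z, m 1 0 X z ≠ 0 ↔ m₀ 1 0 X z ≠ 0 := by
        intro z
        rw [hpos']
        refine ⟨fun h h0 => h (by simp [h0, shifted]), fun h => ?_⟩
        have := (le z h).1
        omega
      have hdeg : ∀ a, deg m a = deg m₀ a := fun a => hoth _ _ _ _ (by omega)
      have hkey : ∀ a, keyM m a = keyM m₀ a := fun a =>
        keyM_congr (hdeg a) (hoth _ _ _ _ (by omega))
      have harc : ∀ a b, Arc m a b ↔ Arc m₀ a b := by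
        intro a b
        unfold Arc
        by_cases ha : a = X
        · subst ha; exact hne0 b
        · rw [hoth _ _ _ _ (by omega)]
      refine hQ r m _ fr ⟨?_, fun h => hS.src ((harc _ _).1 h), ?_, ?_⟩ hoth hpos' ?_
      · intro k y
        by_cases hc : k = 0 ∧ y = X
        · obtain ⟨rfl, rfl⟩ := hc
          refine ⟨?_, ?_⟩
          · intro i hi
            rw [e3] at hi
            rw [hel, if_pos hi, hpos']
            exact ⟨(src i hi).1, (src i hi).2.1⟩
          · intro z hz
            rw [hne0] at hz
            have hl := le z hz
            rw [hpos', e3, hel, if_pos (by omega)]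
            have hs := src (shifted d g (m₀ 1 0 y z) - 1) (by omega)
            exact ⟨hl.2, inj _ _ hs.2.2 hz (by rw [hs.2.1]; omega)⟩
        · exact (hS.slots k y).congr fun t z => hoth _ _ _ _ (by omega)
      · intro k a b hk
        rw [hoth _ _ _ _ (by omega), harc, hkey, hS.bucket a b hk]
      · intro e he
        rw [hoth _ _ _ _ (by omega), hS.level e he]
        simp only [hdeg]
      · simp only [Ex.cost]; omega

end RamLang

namespace RamLang

open WordRAM

/-! ### Inserting and deleting edges of the orientation -/

/-- The validity condition on the orientation: among the out-neighbours of `x`, listed from the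
newest to the oldest, those in the `i`-th block of length `γ` have outdegree at least
`deg x - i`. -/
def Valid (γ : ℕ) (m : Mem) : Prop :=
  ∀ x y, Arc m x y → γ * (deg m x - deg m y - 1) + m 1 0 x y ≤ deg m x

/-- The relation `R` contains each edge of the graph `A` in exactly one direction. -/
structure Orients (R A : ℕ → ℕ → Prop) : Prop where
  adj : ∀ a b, A a b ↔ R a b ∨ R b a
  anti : ∀ a b, R a b → ¬ R b a

theorem Orients.irrefl {R A : ℕ → ℕ → Prop} (h : Orients R A) {a b : ℕ} (hab : R a b) : a ≠ b := by
  rintro rfl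
  exact h.anti _ _ hab hab

/-- This is one round of either chain. Here `R` is the stored digraph with the arc still to be
inserted added, or with the arc still to be deleted taken out; seen this way a round reverses one
edge and the graph `A` stays fixed. -/
theorem Orients.flip {R R' A : ℕ → ℕ → Prop} (h : Orients R A) {x y : ℕ} (hxy : R x y)
    (hR : ∀ a b, R' a b ↔ (R a b ∧ ¬ (a = x ∧ b = y)) ∨ (a = y ∧ b = x)) : Orients R' A := by
  have hne := h.irrefl hxy
  have hyx := h.anti _ _ hxy
  refine ⟨fun a b => ?_, fun a b => ?_⟩
  · rw [h.adj, hR, hR]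
    grind
  · have := h.anti a b
    rw [hR, hR]
    grind

/-- No outdegree and no other position changes. The new head has outdegree at least `deg x - 1`,
which is acceptable at any age. -/
theorem Valid.redirect {n γ x y z : ℕ} {m : Mem} (hv : Valid γ m) (h : DS n m) (hxy : Arc m x y)
    (hyz : y ≠ z) (hz : deg m x ≤ deg m z + 1) : Valid γ (redirectM m x y z) := by
  intro a b hab
  rw [arc_redirectM h hxy hyz] at hab
  simp only [redirectM_deg h hxy]
  rw [redirectM_pos h hxy]
  have p := h.pos_le hxy
  rcases hab with ⟨hab, hne⟩ | ⟨rfl, rfl⟩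
  · have := hv a b hab
    by_cases ha : a = x
    · subst ha
      rw [if_pos rfl, if_neg (by tauto)]
      split_ifs with hb
      · subst hb
        rw [show deg m a - deg m b - 1 = 0 by omega]; omega
      · exact this
    · rw [if_neg ha]; exact this
  · rw [if_pos rfl, if_neg (Ne.symm hyz), if_pos rfl,
      show deg m a - deg m b - 1 = 0 by omega]
    omega

/-- The outdegree of `x` grows by one, so each old out-neighbour needs one more block of slack. The
rotation moves the uninspected ones `γ` positions towards the old end, exactly one block. The
inspected ones and `h` have outdegree at least the old `deg x` and may therefore be newest. For arcs
into `x` the condition only becomes weaker. -/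
theorem Valid.add {n γ g x h : ℕ} {m m' : Mem} {R A : ℕ → ℕ → Prop} (hv : Valid γ m) (hS : DS n m)
    (hA : Orients R A) (hR : ∀ a b, R a b ↔ Arc m a b ∨ (a = x ∧ b = h))
    (hd : deg m x ≤ deg m h) (hg : g = min γ (deg m x))
    (hscan : ∀ y, Arc m x y → m 1 0 x y ≤ g → deg m x ≤ deg m y)
    (hpos : ∀ a b, m' 1 0 a b = if a = x ∧ b = h then deg m x + 1 else
      if a = x then shifted (deg m x) g (m 1 0 a b) else m 1 0 a b)
    (hdeg : ∀ a, deg m' a = if a = x then deg m x + 1 else deg m a) : Valid γ m' := by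
  have irr : ∀ a b, Arc m a b → a ≠ b := fun a b hab => hA.irrefl ((hR a b).2 (Or.inl hab))
  have hxh : x ≠ h := hA.irrefl ((hR x h).2 (Or.inr ⟨rfl, rfl⟩))
  intro a b hab
  unfold Arc at hab
  rw [hpos] at hab
  rw [hpos, hdeg, hdeg]
  by_cases hc : a = x ∧ b = h
  · obtain ⟨rfl, rfl⟩ := hc
    simp only [and_self, if_true]
    rw [if_neg (Ne.symm hxh), show deg m a + 1 - deg m b - 1 = 0 by omega]
    omega
  rw [if_neg hc] at hab ⊢
  by_cases ha : a = x
  · subst ha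
    rw [if_pos rfl] at hab
    have harc : Arc m a b := by
      intro h0; exact hab (by rw [h0]; rfl)
    have hne := irr a b harc
    have hp := hS.pos_le harc
    have hva := hv a b harc
    rw [if_pos rfl, if_pos rfl, if_neg (Ne.symm hne)]
    unfold Arc at harc
    unfold shifted
    rw [if_neg harc]
    by_cases hpg : m 1 0 a b ≤ g
    · have := hscan b harc hpg
      rw [if_pos hpg, show deg m a + 1 - deg m b - 1 = 0 by omega]
      omega
    · rw [if_neg hpg]
      have hgγ : g = γ := by omega
      by_cases hq : deg m a ≤ deg m b
      · rw [show deg m a + 1 - deg m b - 1 = 0 by omega]; omega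
      · rw [show deg m a + 1 - deg m b - 1 = (deg m a - deg m b - 1) + 1 by omega, Nat.mul_succ]
        omega
  · rw [if_neg ha] at hab
    have hva := hv a b hab
    rw [if_neg ha, if_neg ha]
    by_cases hb : b = x
    · subst hb
      rw [if_pos rfl]
      have : γ * (deg m a - (deg m b + 1) - 1) ≤ γ * (deg m a - deg m b - 1) :=
        Nat.mul_le_mul_left _ (by omega)
      omega
    · rw [if_neg hb]; exact hva

/-- An out-neighbour that used slack gains a whole block, which pays for the shorter list because `γ
≥ 1`. The newest arc, moved to the gap, uses no slack. For arcs into `x` the hypothesis `hin` is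
decisive: the tails are no larger than `x`, so they tolerate the loss of one. -/
theorem Valid.remove {n γ x h : ℕ} {m m' : Mem} {R A : ℕ → ℕ → Prop} (hγ : 1 ≤ γ) (hv : Valid γ m)
    (hS : DS n m) (hA : Orients R A) (hR : ∀ a b, R a b ↔ Arc m a b ∧ ¬ (a = x ∧ b = h))
    (hxh : Arc m x h) (hin : ∀ y, Arc m y x → deg m y ≤ deg m x)
    (hpos : ∀ a b, m' 1 0 a b = if a = x then (if b = h then 0 else
        if m 1 0 x b = deg m x then m 1 0 x h else m 1 0 x b) else m 1 0 a b)
    (hdeg : ∀ a, deg m' a = if a = x then deg m x - 1 else deg m a) : Valid γ m' := by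
  have hph := hS.pos_le hxh
  have hdp := hS.deg_pos hxh
  intro a b hab
  unfold Arc at hab
  rw [hpos] at hab
  rw [hpos, hdeg, hdeg]
  by_cases ha : a = x
  · subst ha
    rw [if_pos rfl] at hab
    by_cases hb : b = h
    · simp [hb] at hab
    rw [if_neg hb] at hab
    have harc : Arc m a b := by
      unfold Arc
      split_ifs at hab with hc <;> omega
    have hne : a ≠ b := hA.irrefl ((hR a b).2 ⟨harc, by tauto⟩)
    have hp := hS.pos_le harc
    have hva := hv a b harc
    rw [if_pos rfl, if_pos rfl, if_neg (Ne.symm hne), if_neg hb]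
    have hlt : m 1 0 a b = deg m a → m 1 0 a h ≠ deg m a := by
      intro h1 h2
      have e1 := ((hS.slots 0 a).pos b harc).2
      have e2 := ((hS.slots 0 a).pos h hxh).2
      rw [h1] at e1
      rw [h2, e1] at e2
      exact hb e2
    by_cases hq : deg m a - deg m b - 1 = 0
    · rw [show deg m a - 1 - deg m b - 1 = 0 by omega]
      split_ifs with hc <;> omega
    · obtain ⟨q, hq'⟩ : ∃ q, deg m a - deg m b - 1 = q + 1 := ⟨_, (Nat.succ_pred hq).symm⟩
      rw [hq', Nat.mul_succ] at hva
      rw [show deg m a - 1 - deg m b - 1 = q by omega, if_neg (by omega)]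
      omega
  · rw [if_neg ha] at hab
    have hva := hv a b hab
    rw [if_neg ha, if_neg ha]
    by_cases hb : b = x
    · subst hb
      have := hin a hab
      rw [if_pos rfl, show deg m a - (deg m b - 1) - 1 = 0 by omega]
      have := hS.pos_le hab
      omega
    · rw [if_neg hb]; exact hva

/-- Insert an edge, oriented from the vertex in register `10` to the one in register `11`. -/
def insArc : Pr :=
  .seq (.set 12 (.lit 1))
    (.seq (.loop .ne (.reg 12) (.lit 0)
      (.seq (scan (.reg 10)) (.ite .ne (.reg 12) (.lit 0)
        (.seq (redirect (.reg 10) (.reg 15) (.reg 11))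
          (.seq (.set 11 (.reg 10)) (.set 10 (.reg 15)))) .skip)))
    (.seq (rotate (.reg 10)) (addArc (.reg 10) (.reg 11))))

/-- The common part of the loop invariants. -/
structure ChainInv (n γ : ℕ) (r₀ r : ℕ → ℕ) (m₀ m : Mem) (A R : ℕ → ℕ → Prop) : Prop where
  reg : ∀ i < 10, r i = r₀ i
  ds : DS n m
  valid : Valid γ m
  orients : Orients R A
  deg : ∀ v, RamLang.deg m v = RamLang.deg m₀ v
  mate : ∀ v, m 0 0 0 v = m₀ 0 0 0 v

theorem Same.arc {m m' : Mem} {X : ℕ} (h : Same m m' X) (a b : ℕ) : Arc m' a b ↔ Arc m a b := by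
  unfold Arc; rw [h _ _ _ _ (by omega)]

theorem Same.deg {m m' : Mem} {X : ℕ} (h : Same m m' X) (a : ℕ) : deg m' a = deg m a :=
  h _ _ _ _ (by omega)

theorem Same.valid {γ : ℕ} {m m' : Mem} {X : ℕ} (h : Same m m' X) (hv : Valid γ m) :
    Valid γ m' := by
  intro a b hab
  rw [h.arc] at hab
  rw [h.deg, h.deg, h _ _ _ _ (by omega)]
  exact hv a b hab

/-- Registers `10` and `11` hold the pending arc, whose tail never has larger outdegree than its
head. Each round costs `O(γ)` and lowers the outdegree of the tail, so there are at most `D + 1`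
rounds; one rotation and one arc addition follow. -/
theorem insArc_vc {n γ X H D : ℕ} {A : ℕ → ℕ → Prop} {Q : St → Prop} {r₀ : ℕ → ℕ} {m₀ : Mem}
    {t₀ : ℕ} (h3 : r₀ 3 = γ) (hγ : 1 ≤ γ) (h10 : r₀ 10 = X) (h11 : r₀ 11 = H) (hX : X < n)
    (hH : H < n) (hS : DS n m₀) (hv : Valid γ m₀)
    (hA : Orients (fun a b => Arc m₀ a b ∨ (a = X ∧ b = H)) A) (hXH : ¬ Arc m₀ X H)
    (hd : deg m₀ X ≤ deg m₀ H) (hD : ∀ v, deg m₀ v ≤ D)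
    (hQ : ∀ r' m' t', (∀ i < 10, r' i = r₀ i) → DS n m' → Valid γ m' → Orients (Arc m') A →
      (∀ v, deg m' v ≤ deg m₀ v + 1) → (∀ v, m' 0 0 0 v = m₀ 0 0 0 v) →
      t' ≤ t₀ + 5000 * (γ * (D + 1)) → Q ⟨r', m', t'⟩) : insArc.vc n Q ⟨r₀, m₀, t₀⟩ := by
  have hB : base n = 2 * n + 8 := rfl
  -- The remaining time budget is proportional to `γ` times the outdegree of the current tail, and
  -- its drop pays for a round. When register `12` is `0`, the last scan failed and its findings are
  -- kept for the rotation.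
  refine ⟨by omega, by simp [Ex.Ok], fun k T => ChainInv n γ r₀ T.r m₀ T.m A
    (fun a b => Arc T.m a b ∨ (a = T.r 10 ∧ b = T.r 11)) ∧ T.r 10 < n ∧ T.r 11 < n ∧
    ¬ Arc T.m (T.r 10) (T.r 11) ∧ deg m₀ (T.r 10) ≤ deg m₀ (T.r 11) ∧
    ((T.r 12 = 1 ∧ k = deg m₀ (T.r 10) + 1 ∧
        T.t + 2000 * (γ * deg m₀ (T.r 10)) ≤ t₀ + 10 + 2000 * (γ * D)) ∨
      (T.r 12 = 0 ∧ T.r 14 = min γ (deg T.m (T.r 10)) ∧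
        (∀ y, Arc T.m (T.r 10) y → T.m 1 0 (T.r 10) y ≤ T.r 14 →
          deg T.m (T.r 10) ≤ deg T.m y) ∧
        (∀ j < T.r 14, T.m 2 0 (T.r 10) (deg T.m (T.r 10) + j) = T.m 2 0 (T.r 10) j) ∧
        T.t ≤ t₀ + 10 + 2000 * (γ * D) + 2000 * γ)),
    ⟨deg m₀ X + 1, ⟨?_, hS, hv, ?_, fun _ => rfl, fun _ => rfl⟩, ?_, ?_, ?_, ?_,
      Or.inl ⟨?_, ?_, ?_⟩⟩, ?_⟩
  · intro i hi
    exact Function.update_of_ne (by omega) _ _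
  · simpa [h10, h11] using hA
  · simpa [h10] using hX
  · simpa [h11] using hH
  · simpa [h10, h11] using hXH
  · simpa [h10, h11] using hd
  · simp [Ex.eval]
  · simp [h10]
  · have : γ * deg m₀ X ≤ γ * D := Nat.mul_le_mul_left _ (hD X)
    simp [h10, Ex.cost]; omega
  · rintro k ⟨r, m, t⟩ ⟨⟨fr, dS, vl, ori, dg, mt⟩, b10, b11, narc, dle, h⟩
    simp only at fr dS vl ori dg mt b10 b11 narc dle h
    have a10 : Atom n 12 r (.reg 10) (r 10) := .reg (by omega) (by omega) rfl (by omega)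
    have a11 : Atom n 12 r (.reg 11) (r 11) := .reg (by omega) (by omega) rfl (by omega)
    refine ⟨by simp [Ex.Ok], by simp [Ex.Ok], ?_, ?_⟩
    · intro hne
      simp only [Ex.eval, Cmp.Holds] at hne
      rcases h with ⟨e12, hk, ht⟩ | ⟨e12, -⟩
      swap
      · exact absurd e12 hne
      simp only [Pr.vc]
      refine scan_vc a10 dS ((fr 3 (by omega)).trans h3) ?_ ?_
      · intro r1 m1 t1 y f1 e1 e15 hxy hlt hsame ht1
        have fy : y < n := dS.dst hxy
        have dS1 := dS.same hsame
        have hxy1 : Arc m1 (r 10) y := (hsame.arc _ _).2 hxy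
        have narc1 : ¬ Arc m1 (r 10) (r 11) := by rwa [hsame.arc]
        have hyh : y ≠ r 11 := by rintro rfl; exact narc hxy
        refine ⟨by simp [Ex.Ok], by simp [Ex.Ok], fun _ => ?_, fun hc => ?_⟩
        swap
        · exact absurd e1 (by simp [Ex.eval, Cmp.Holds] at hc; omega)
        simp only
        refine redirect_vc (a10.mono (by omega) f1)
          (.reg (by omega) (by omega) e15 (by omega)) (a11.mono (by omega) f1) dS1 hxy1 ?_
        intro r2 t2 f2 ht2
        have g10 : r2 10 = r 10 := (f2 10 (by omega)).trans (f1 10 (by omega))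
        have g15 : r2 15 = y := (f2 15 (by omega)).trans e15
        have g12 : r2 12 = 1 := (f2 12 (by omega)).trans e1
        have arcs := arc_redirectM (z := r 11) dS1 hxy1 hyh
        have degs : ∀ v, deg (redirectM m1 (r 10) y (r 11)) v = deg m₀ v := fun v => by
          rw [redirectM_deg dS1 hxy1, hsame.deg, dg]
        rw [dg, dg] at hlt
        refine ⟨by omega, by simp [Ex.Ok], by omega, by simp [Ex.Ok], deg m₀ y + 1, by omega, ?_⟩
        have w10 : Function.update (Function.update r2 11 (r2 10)) 10
            (Function.update r2 11 (r2 10) 15) 10 = y := by simp [g15]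
        have w11 : Function.update (Function.update r2 11 (r2 10)) 10
            (Function.update r2 11 (r2 10) 15) 11 = r 10 := by simp [g10]
        have w12 : Function.update (Function.update r2 11 (r2 10)) 10
            (Function.update r2 11 (r2 10) 15) 12 = 1 := by simp [g12]
        simp only [Ex.eval, w10, w11, w12]
        refine ⟨⟨?_, dS1.redirect hxy1 narc1 b11, ?_, ?_, degs, ?_⟩, fy, b10, ?_, hlt.le,
          Or.inl ⟨trivial, trivial, ?_⟩⟩
        · intro i hi
          rw [Function.update_of_ne (by omega), Function.update_of_ne (by omega), f2 i (by omega),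
            f1 i (by omega), fr i hi]
        · refine (hsame.valid vl).redirect dS1 hxy1 hyh ?_
          rw [hsame.deg, hsame.deg, dg, dg]; omega
        · refine ori.flip (x := r 10) (y := y) (Or.inl hxy) fun a b => ?_
          rw [arcs, hsame.arc]
          grind
        · intro v
          rw [redirectM_tag (by omega), hsame _ _ _ _ (by omega), mt]
        · rw [arcs, hsame.arc]
          have := ori.anti _ _ (Or.inl hxy)
          grind
        · have : γ * (deg m₀ y + 1) ≤ γ * deg m₀ (r 10) := Nat.mul_le_mul_left _ hlt
          rw [Nat.mul_succ] at this
          simp only [Ex.cost] at *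
          omega
      · intro r1 m1 t1 g f1 e1 e14 hg hscan hsame hcopy ht1
        refine ⟨by simp [Ex.Ok], by simp [Ex.Ok], fun hc => ?_, fun _ => ?_⟩
        · exact absurd e1 (by simpa [Ex.eval, Cmp.Holds] using hc)
        have g10 : r1 10 = r 10 := f1 10 (by omega)
        have g11 : r1 11 = r 11 := f1 11 (by omega)
        refine ⟨0, by omega, ?_⟩
        simp only [g10, g11, e1, e14]
        refine ⟨⟨fun i hi => (f1 i (by omega)).trans (fr i hi), dS.same hsame, hsame.valid vl, ?_,
          fun v => (hsame.deg v).trans (dg v), fun v => ?_⟩, b10, b11, ?_, dle,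
          Or.inr ⟨trivial, ?_, ?_, ?_, ?_⟩⟩
        · simpa only [hsame.arc] using ori
        · rw [hsame _ _ _ _ (by omega), mt]
        · rwa [hsame.arc]
        · rw [hsame.deg, hg]
        · intro y hy hp
          rw [hsame.arc] at hy
          rw [hsame _ _ _ _ (by omega)] at hp
          rw [hsame.deg, hsame.deg]
          exact hscan y hy hp
        · intro j hj
          rw [hsame.deg, hcopy j hj, hsame _ _ _ _ (by omega)]
        · have : 1 * deg m₀ (r 10) ≤ γ * deg m₀ (r 10) := Nat.mul_le_mul_right _ hγ
          simp only [Ex.cost] at *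
          omega
    · intro hne
      simp only [Ex.eval, Cmp.Holds, not_not] at hne
      rcases h with ⟨e12, -⟩ | ⟨-, e14, hscan, hcopy, ht⟩
      · omega
      have hgd : r 14 ≤ deg m (r 10) := by omega
      simp only [Pr.vc]
      refine rotate_vc a10 dS rfl hgd hcopy ?_
      intro r1 m1 t1 f1 dS1 hoth hpos ht1
      have hdeg1 : ∀ v, deg m1 v = deg m v := fun v => hoth _ _ _ _ (by omega)
      have hz : ∀ b, m1 1 0 (r 10) b = 0 ↔ m 1 0 (r 10) b = 0 := by
        intro b
        rw [hpos]
        have : m 1 0 (r 10) b ≠ 0 → m 1 0 (r 10) b ≤ deg m (r 10) := fun hc => dS.pos_le hc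
        unfold shifted
        split_ifs <;> omega
      have harc : ∀ a b, Arc m1 a b ↔ Arc m a b := by
        intro a b
        unfold Arc
        by_cases ha : a = r 10
        · subst ha; exact not_congr (hz b)
        · rw [hoth _ _ _ _ (by omega)]
      refine addArc_vc (a10.mono (by omega) f1) (a11.mono (by omega) f1) b10 b11 dS1
        (by rwa [harc]) ?_
      intro r2 m2 t2 f2 dS2 hpos2 hdeg2 hmate2 ht2
      have hxh : r 10 ≠ r 11 := ori.irrefl (Or.inr ⟨rfl, rfl⟩)
      refine hQ r2 m2 t2 (fun i hi => ?_) dS2 ?_ ?_ ?_ ?_ ?_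
      · rw [f2 i (by omega), f1 i (by omega), fr i hi]
      · refine vl.add dS ori (fun a b => Iff.rfl) (by rwa [dg, dg]) e14 hscan ?_ ?_
        · intro a b
          rw [hpos2, hdeg1]
          by_cases hc : a = r 10 ∧ b = r 11
          · rw [if_pos hc, if_pos hc]
          · rw [if_neg hc, if_neg hc]
            by_cases ha : a = r 10
            · subst ha; rw [if_pos rfl, hpos]
            · rw [if_neg ha, hoth _ _ _ _ (by omega)]
        · intro a
          rw [hdeg2, hdeg1, hdeg1]
      · have : ∀ a b, Arc m2 a b ↔ Arc m a b ∨ (a = r 10 ∧ b = r 11) := by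
          intro a b
          rw [← harc]
          unfold Arc
          rw [hpos2]
          split_ifs with hc <;> simp [hc]
        have hfun : Arc m2 = fun a b => Arc m a b ∨ (a = r 10 ∧ b = r 11) := by
          funext a b; exact propext (this a b)
        rw [hfun]; exact ori
      · intro v
        rw [hdeg2]
        split_ifs with hc
        · rw [hdeg1, dg, hc]
        · rw [hdeg1, dg]; omega
      · intro v
        rw [hmate2, hoth _ _ _ _ (by omega), mt]
      · have e1 : deg m (r 10) ≤ D := by rw [dg]; exact hD _
        have e2 : deg m1 (r 10) ≤ D := by rw [hdeg1, dg]; exact hD _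
        have e3 : 1 * D ≤ γ * D := Nat.mul_le_mul_right _ hγ
        rw [Nat.mul_succ]
        simp only [Ex.cost] at *
        omega

/-- Delete an edge that is oriented from the vertex in register `10` to the one in register
`11`. -/
def delArc : Pr :=
  .seq (.set 12 (.lit 1))
    (.seq (.loop .ne (.reg 12) (.lit 0)
      (.seq (.set 13 (.add (.cell (.lit 3) (.lit 0) (.reg 10) (.lit 0)) (.lit 1)))
        (.seq (search (.reg 10) 1) (.ite .ne (.reg 12) (.lit 0)
          (.seq (.set 15 (.cell (.lit 2) (.reg 12) (.reg 10) (.lit 0)))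
            (.seq (redirect (.reg 10) (.reg 11) (.reg 15))
              (.seq (.set 11 (.reg 10)) (.set 10 (.reg 15))))) .skip))))
    (removeArc (.reg 10) (.reg 11)))

/-- The pending arc remains stored until the chain ends. Each search starts just above the outdegree
of the current tail, where the previous one stopped, so all searches together inspect `O(D + 1)`
levels; hence no factor `γ` arises. -/
theorem delArc_vc {n γ X H D : ℕ} {A : ℕ → ℕ → Prop} {Q : St → Prop} {r₀ : ℕ → ℕ} {m₀ : Mem}
    {t₀ : ℕ} (h2 : r₀ 2 = n) (hγ : 1 ≤ γ) (h10 : r₀ 10 = X) (h11 : r₀ 11 = H)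
    (hS : DS n m₀) (hv : Valid γ m₀)
    (hA : Orients (fun a b => Arc m₀ a b ∧ ¬ (a = X ∧ b = H)) A) (hXH : Arc m₀ X H)
    (hHX : ¬ Arc m₀ H X) (hD : ∀ v, deg m₀ v ≤ D)
    (hQ : ∀ r' m' t', (∀ i < 10, r' i = r₀ i) → DS n m' → Valid γ m' → Orients (Arc m') A →
      (∀ v, deg m' v ≤ deg m₀ v) → (∀ v, m' 0 0 0 v = m₀ 0 0 0 v) →
      t' ≤ t₀ + 10000 * (D + 1) → Q ⟨r', m', t'⟩) : delArc.vc n Q ⟨r₀, m₀, t₀⟩ := by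
  have hB : base n = 2 * n + 8 := rfl
  refine ⟨by omega, by simp [Ex.Ok], fun k T => ChainInv n γ r₀ T.r m₀ T.m A
    (fun a b => Arc T.m a b ∧ ¬ (a = T.r 10 ∧ b = T.r 11)) ∧
    Arc T.m (T.r 10) (T.r 11) ∧ (Arc T.m (T.r 11) (T.r 10) → deg m₀ (T.r 11) ≤ deg m₀ (T.r 10)) ∧
    ((T.r 12 ≠ 0 ∧ k + deg m₀ (T.r 10) = n + 1 ∧ T.t ≤ t₀ + 10 + 4000 * deg m₀ (T.r 10)) ∨
      (T.r 12 = 0 ∧ (∀ y, Arc T.m y (T.r 10) → deg T.m y ≤ deg T.m (T.r 10)) ∧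
        T.t ≤ t₀ + 10 + 4000 * (D + 1))),
    ⟨n + 1 - deg m₀ X, ⟨?_, hS, hv, ?_, fun _ => rfl, fun _ => rfl⟩, ?_, ?_,
      Or.inl ⟨?_, ?_, ?_⟩⟩, ?_⟩
  · intro i hi
    exact Function.update_of_ne (by omega) _ _
  · simpa [h10, h11] using hA
  · simpa [h10, h11] using hXH
  · simp [h10, h11, hHX]
  · simp [Ex.eval]
  · have := hS.deg_le X
    simp [h10]; omega
  · simp [Ex.cost]; omega
  · rintro k ⟨r, m, t⟩ ⟨⟨fr, dS, vl, ori, dg, mt⟩, arc, back, h⟩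
    simp only at fr dS vl ori dg mt arc back h
    have b10 : r 10 < n := dS.src arc
    have b11 : r 11 < n := dS.dst arc
    have a10 : Atom n 12 r (.reg 10) (r 10) := .reg (by omega) (by omega) rfl (by omega)
    have a11 : Atom n 12 r (.reg 11) (r 11) := .reg (by omega) (by omega) rfl (by omega)
    have dl := dS.deg_le (r 10)
    refine ⟨by simp [Ex.Ok], by simp [Ex.Ok], ?_, ?_⟩
    · intro hne
      simp only [Ex.eval, Cmp.Holds] at hne
      rcases h with ⟨e12, hk, ht⟩ | ⟨e12, -⟩
      swap
      · exact absurd e12 hne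
      have d3 : m 3 0 (r 10) 0 = deg m (r 10) := rfl
      refine ⟨by omega, ?_, ?_⟩
      · simp [Ex.Ok, Ex.eval, hB, d3]; omega
      simp only [Ex.eval, d3, Pr.vc]
      have f0 : ∀ i < 12, Function.update r 13 (deg m (r 10) + 1) i = r i := fun i hi => by
        rw [Function.update_of_ne (by omega)]
      refine search_vc (D := deg m (r 10) + 1) (a10.mono le_rfl f0) le_rfl
        ((f0 2 (by omega)).trans ((fr 2 (by omega)).trans h2)) (by simp) (by omega)
        (fun d hd => dS.level_zero hd) ?_ ?_
      · intro r1 t1 d f1 e1 hle h4 hall ht1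
        refine ⟨by simp [Ex.Ok], by simp [Ex.Ok], fun hc => ?_, fun _ => ?_⟩
        · exact absurd e1 (by simpa [Ex.eval, Cmp.Holds] using hc)
        have g10 : r1 10 = r 10 := (f1 10 (by omega)).trans (f0 10 (by omega))
        have g11 : r1 11 = r 11 := (f1 11 (by omega)).trans (f0 11 (by omega))
        refine ⟨0, by have := dS.deg_le (r 10); rw [dg] at this; omega, ?_⟩
        simp only [g10, g11, e1]
        refine ⟨⟨fun i hi => (f1 i (by omega)).trans ((f0 i (by omega)).trans (fr i hi)), dS, vl,
          ori, dg, mt⟩, arc, back, Or.inr ⟨trivial, ?_, ?_⟩⟩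
        · intro y hy
          by_contra hlt
          -- A larger in-neighbour would have an outdegree among those searched, since no vertex has
          -- outdegree `d` or more; its bucket was found empty.
          push Not at hlt
          have hyn := dS.src hy
          have hdd : deg m y < d := by
            by_contra hc
            exact dS.level_ne (d := d) (by omega) hyn (by omega) h4
          obtain ⟨-, c0, c1⟩ := hall (deg m y) (by omega) hdd
          have hk := dS.key_ne hy
          have hb := (dS.bucket y (r 10) hk).2 ⟨hy, rfl⟩
          have hp := ((dS.slots _ _).pos y hb).1
          have : keyM m y = 2 * deg m y ∨ keyM m y = 2 * deg m y + 1 := by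
            unfold keyM deg; split_ifs <;> omega
          rcases this with e | e <;> rw [e] at hp hb <;> omega
        -- Level `D + 1` is empty, so the search cannot pass it.
        · have hdD : d ≤ D + 1 := by
            by_contra hc
            have hrD : deg m (r 10) ≤ D := by rw [dg]; exact hD _
            obtain ⟨h5, -⟩ := hall (D + 1) (by omega) (by omega)
            obtain ⟨v, -, hv⟩ := dS.exists_of_level (by omega) h5
            have := hD v
            rw [dg] at hv
            omega
          rw [dg] at *
          simp only [Ex.cost] at *
          omega
      · intro r1 t1 d f1 hle hdn h4 e1 hcnt ht1
        have g10 : r1 10 = r 10 := (f1 10 (by omega)).trans (f0 10 (by omega))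
        have f1' : ∀ i < 12, r1 i = r i := fun i hi => (f1 i hi).trans (f0 i hi)
        have hb12 : r1 12 < base n := by omega
        have hne12 : r1 12 ≠ 0 := by omega
        refine ⟨by simp [Ex.Ok], by simp [Ex.Ok], fun _ => ?_, fun hc => ?_⟩
        swap
        · exact absurd (by simpa [Ex.eval, Cmp.Holds] using hc) hne12
        obtain ⟨hyn, hyp⟩ := (dS.slots (r1 12) (r 10)).entry 0 (by omega)
        refine ⟨by omega, ?_, ?_⟩
        · simp [Ex.Ok, Ex.eval, hB, g10]; omega
        simp only [g10]
        generalize m 2 (r1 12) (r 10) 0 = y at *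
        obtain ⟨hyx, hky⟩ := (dS.bucket y (r 10) hne12).1 (by omega)
        have hdy : deg m y = d := by
          unfold keyM at hky
          unfold deg
          split_ifs at hky <;> omega
        have hlt : deg m (r 10) < deg m y := by omega
        have hyx' : y ≠ r 10 := by rintro rfl; omega
        -- After a round the replacement arc from `r 11` to `r 10` is stored along with the pending
        -- one. The invariant `back` prevents the search from selecting it, because its tail is not
        -- larger.
        have hyh : y ≠ r 11 := by
          rintro rfl
          have := back hyx
          rw [dg, dg] at hlt
          omega
        have narc : ¬ Arc m (r 10) y := by
          intro hc
          exact ori.anti _ _ ⟨hc, by tauto⟩ ⟨hyx, by tauto⟩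
        have f2 : ∀ i < 12, Function.update r1 15 y i = r i := fun i hi => by
          rw [Function.update_of_ne (by omega), f1' i hi]
        refine redirect_vc (a10.mono (by omega) f2) (a11.mono (by omega) f2)
          (.reg (v := y) (by omega) (by omega) (by simp) (by omega)) dS arc ?_
        intro r3 t3 f3 ht3
        have q10 : r3 10 = r 10 := (f3 10 (by omega)).trans (f2 10 (by omega))
        have q15 : r3 15 = y := (f3 15 (by omega)).trans (by simp)
        have q12 : r3 12 = r1 12 := (f3 12 (by omega)).trans (by simp)
        have arcs := arc_redirectM (z := y) dS arc (Ne.symm hyh)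
        have degs : ∀ v, deg (redirectM m (r 10) (r 11) y) v = deg m₀ v := fun v => by
          rw [redirectM_deg dS arc, dg]
        have hyl := dS.deg_le y
        rw [dg, dg] at hlt
        rw [dg] at hyl
        refine ⟨by omega, by simp [Ex.Ok], by omega, by simp [Ex.Ok], n + 1 - deg m₀ y, by omega,
          ?_⟩
        have w10 : Function.update (Function.update r3 11 (r3 10)) 10
            (Function.update r3 11 (r3 10) 15) 10 = y := by simp [q15]
        have w11 : Function.update (Function.update r3 11 (r3 10)) 10
            (Function.update r3 11 (r3 10) 15) 11 = r 10 := by simp [q10]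
        have w12 : Function.update (Function.update r3 11 (r3 10)) 10
            (Function.update r3 11 (r3 10) 15) 12 = r1 12 := by simp [q12]
        simp only [w10, w11, w12]
        refine ⟨⟨?_, dS.redirect arc narc hyn, ?_, ?_, degs, ?_⟩, ?_, fun _ => hlt.le,
          Or.inl ⟨hne12, ?_, ?_⟩⟩
        · intro i hi
          rw [Function.update_of_ne (by omega), Function.update_of_ne (by omega), f3 i (by omega),
            f2 i (by omega), fr i hi]
        · refine vl.redirect dS arc (Ne.symm hyh) ?_
          rw [dg, dg]; omega
        · refine ori.flip (x := y) (y := r 10) ⟨hyx, by tauto⟩ fun a b => ?_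
          rw [arcs]
          grind
        · intro v
          rw [redirectM_tag (by omega), mt]
        · rw [arcs]
          left
          exact ⟨hyx, by tauto⟩
        · omega
        · rw [dg] at *
          simp only [Ex.cost] at *
          omega
    · intro hne
      simp only [Ex.eval, Cmp.Holds, not_not] at hne
      rcases h with ⟨e12, -⟩ | ⟨-, hin, ht⟩
      · exact absurd hne e12
      simp only
      refine removeArc_vc (a10.mono (by omega) fun _ _ => rfl) (a11.mono (by omega) fun _ _ => rfl)
        dS arc ?_
      intro r1 m1 t1 f1 dS1 hpos hdeg hmate ht1
      refine hQ r1 m1 t1 (fun i hi => ?_) dS1 ?_ ?_ ?_ ?_ ?_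
      · rw [f1 i (by omega), fr i hi]
      · exact vl.remove hγ dS ori (fun a b => Iff.rfl) arc hin hpos hdeg
      · have : ∀ a b, Arc m1 a b ↔ Arc m a b ∧ ¬ (a = r 10 ∧ b = r 11) := by
          intro a b
          have hp : Arc m (r 10) (r 11) := arc
          unfold Arc at *
          rw [hpos]
          have := dS.deg_pos hp
          by_cases ha : a = r 10
          · subst ha
            by_cases hb : b = r 11
            · simp [hb]
            · rw [if_pos rfl, if_neg hb]
              split_ifs with hc
              · simp [hb, hc, hp]; omega
              · simp [hb]
          · simp [ha]
        have hfun : Arc m1 = fun a b => Arc m a b ∧ ¬ (a = r 10 ∧ b = r 11) := by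
          funext a b; exact propext (this a b)
        rw [hfun]; exact ori
      · intro v
        rw [hdeg]
        split_ifs with hc
        · rw [dg, hc]; omega
        · rw [dg]
      · intro v
        rw [hmate, mt]
      · have : deg m (r 10) ≤ D := by rw [dg]; exact hD _
        simp only [Ex.cost] at *
        omega

end RamLang

namespace RamLang

open WordRAM

/-! ### Mates -/

/-- The memories store the same digraph in the same order. -/
def SameArcs (m m' : Mem) : Prop := ∀ t y z, t ≠ 0 → m' t 0 y z = m t 0 y z

theorem SameArcs.trans {m m' m'' : Mem} (h : SameArcs m m') (h' : SameArcs m' m'') :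
    SameArcs m m'' := fun t y z ht => (h' t y z ht).trans (h t y z ht)

theorem SameArcs.deg {m m' : Mem} (h : SameArcs m m') (a : ℕ) : deg m' a = deg m a :=
  h 3 a 0 (by omega)

theorem SameArcs.arc {m m' : Mem} (h : SameArcs m m') : Arc m' = Arc m := by
  funext a b; unfold Arc; rw [h 1 a b (by omega)]

theorem SameArcs.valid {γ : ℕ} {m m' : Mem} (h : SameArcs m m') (hv : Valid γ m) :
    Valid γ m' := by
  intro a b hab
  rw [h.arc] at hab
  rw [h.deg, h.deg, h 1 a b (by omega)]
  exact hv a b hab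

/-- Set the mate of `x`. -/
def setMate (x e : Ex) : Pr :=
  .seq (getKey 20 x) (.seq (.put (.lit 0) (.lit 0) (.lit 0) x e) (.seq (getKey 21 x) (rekey x)))

/-- By `hE` the vertex passes from free to matched or back, so the parity bit flips and the old and
new keys differ. That is what moving `X` between buckets requires. -/
theorem setMate_vc {n : ℕ} {x e : Ex} {X E : ℕ} {Q : St → Prop} {r₀ : ℕ → ℕ} {m₀ : Mem} {t₀ : ℕ}
    (hx : Atom n 20 r₀ x X) (he : Atom n 20 r₀ e E) (hX : X < n) (hS : DS n m₀)
    (hE : m₀ 0 0 0 X = 0 ↔ E ≠ 0)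
    (hQ : ∀ r' m' t', (∀ i < 20, r' i = r₀ i) → DS n m' → SameArcs m₀ m' →
      (∀ v, m' 0 0 0 v = if v = X then E else m₀ 0 0 0 v) →
      t' ≤ t₀ + 1000 + 700 * deg m₀ X → Q ⟨r', m', t'⟩) :
    (setMate x e).vc n Q ⟨r₀, m₀, t₀⟩ := by
  have hB : base n = 2 * n + 8 := rfl
  have bx := hx.lt
  have cx := hx.cost
  have ce := he.cost
  have kl := hS.keyM_lt X
  simp only [setMate, Pr.vc]
  refine getKey_vc hx (by omega) (hS.deg_le X) fun r1 t1 e1 f1 ht1 => ?_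
  have g1 : ∀ i < 20, r1 i = r₀ i := fun i hi => f1 i (by omega)
  refine ⟨⟨by simp [Ex.Ok], by simp [Ex.Ok], by simp [Ex.Ok], hx.ok _ _ g1, ?_⟩, he.ok _ _ g1, ?_⟩
  · simp [Ex.eval, hx.eval _ m₀ g1, hB]; omega
  simp only [Ex.eval, hx.eval _ m₀ g1, he.eval _ m₀ g1]
  generalize hm1 : upd m₀ 0 0 0 X E = m1
  have h1 : ∀ t k y z, t ≠ 0 → m1 t k y z = m₀ t k y z := by
    intro t k y z ht
    rw [← hm1]; unfold upd; rw [if_neg (by omega)]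
  have h10 : ∀ v, m1 0 0 0 v = if v = X then E else m₀ 0 0 0 v := by
    intro v
    rw [← hm1]; simp [upd]
  have hne : keyM m1 X ≠ keyM m₀ X := by
    unfold keyM
    rw [h1 _ _ _ _ (by omega), h10, if_pos rfl]
    split_ifs <;> omega
  have kl1 : keyM m1 X < 2 * n + 2 := by
    have := hS.deg_le X
    unfold keyM deg at *
    rw [h1 _ _ _ _ (by omega)]
    split_ifs <;> omega
  have hpos : ∀ y, Arc m₀ X y → keyM m1 X ≠ 0 := by
    intro y hy
    have := hS.deg_pos hy
    unfold keyM deg at *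
    rw [h1 _ _ _ _ (by omega)]
    omega
  have s1 : Slots n m1 := hS.slots.congr_tag fun t k y z h0 _ => h1 t k y z h0
  refine getKey_vc (hx.mono (by omega) g1) (by omega)
    (by rw [h1 _ _ _ _ (by omega)]; exact hS.deg_le X) fun r2 t2 e2 f2 ht2 => ?_
  have g2 : ∀ i < 20, r2 i = r₀ i := fun i hi => (f2 i (by omega)).trans (g1 i hi)
  refine rekey_vc (K0 := keyM m₀ X) (K1 := keyM m1 X) (hx.mono (by omega) g2) hX s1
    ((f2 20 (by omega)).trans e1) e2 (by omega) (by omega) ?_ fun r3 m3 t3 f3 hR ht3 => ?_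
  · intro y hy
    rw [h1 _ _ _ _ (by omega)] at hy
    rw [h1 _ _ _ _ (by omega), h1 _ _ _ _ (by omega)]
    have hk := hS.key_ne hy
    refine ⟨hk, hpos y hy, (hS.bucket X y hk).2 ⟨hy, rfl⟩, ?_⟩
    by_contra hc
    exact hne ((hS.bucket X y (hpos y hy)).1 hc).2
  have same : SameArcs m₀ m3 := fun t y z ht => by rw [hR.zero, h1 _ _ _ _ ht]
  have mates : ∀ v, m3 0 0 0 v = if v = X then E else m₀ 0 0 0 v := fun v => by
    rw [hR.zero, h10]
  have hkey : ∀ a, keyM m3 a = if a = X then keyM m1 X else keyM m₀ a := by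
    intro a
    split_ifs with ha
    · subst ha
      unfold keyM
      rw [hR.zero, hR.zero]
    · exact keyM_congr (same.deg a) (by rw [mates, if_neg ha])
  have d1 : m1 3 0 X 0 = deg m₀ X := h1 _ _ _ _ (by omega)
  refine hQ _ _ _ (fun i hi => (f3 i (by omega)).trans (g2 i hi)) ⟨hR.slots, ?_, ?_, ?_⟩ same
    mates ?_
  · intro a b hab
    rw [same.arc] at hab
    exact hS.src hab
  · intro k a b hk
    rw [hR.mem, same.arc, hkey, h1 _ _ _ _ (by omega), h1 _ _ _ _ (by omega),
      hS.bucket a b hk, d1]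
    have : Arc m₀ X b → m₀ 1 0 X b ≤ deg m₀ X := fun hc => hS.pos_le hc
    unfold Arc at *
    grind
  · intro d hd
    rw [same 4 0 d (by omega), hS.level d hd]
    simp only [same.deg]
  · rw [d1] at ht3
    simp only [Ex.cost] at *
    omega

/-- Set the mates of `x` and `y`. -/
def setPair (x e y f : Ex) : Pr := .seq (setMate x e) (setMate y f)

theorem setPair_vc {n D : ℕ} {x e y f : Ex} {X E Y F : ℕ} {Q : St → Prop} {r₀ : ℕ → ℕ} {m₀ : Mem}
    {t₀ : ℕ} (hx : Atom n 20 r₀ x X) (he : Atom n 20 r₀ e E) (hy : Atom n 20 r₀ y Y)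
    (hf : Atom n 20 r₀ f F) (hX : X < n) (hY : Y < n) (hXY : X ≠ Y) (hS : DS n m₀)
    (hE : m₀ 0 0 0 X = 0 ↔ E ≠ 0) (hF : m₀ 0 0 0 Y = 0 ↔ F ≠ 0) (hD : ∀ v, deg m₀ v ≤ D)
    (hQ : ∀ r' m' t', (∀ i < 20, r' i = r₀ i) → DS n m' → SameArcs m₀ m' →
      (∀ v, m' 0 0 0 v = if v = X then E else if v = Y then F else m₀ 0 0 0 v) →
      t' ≤ t₀ + 2000 * (D + 1) → Q ⟨r', m', t'⟩) :
    (setPair x e y f).vc n Q ⟨r₀, m₀, t₀⟩ := by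
  simp only [setPair, Pr.vc]
  refine setMate_vc hx he hX hS hE fun r1 m1 t1 f1 dS1 same1 mate1 ht1 => ?_
  refine setMate_vc (hy.mono le_rfl f1) (hf.mono le_rfl f1) hY dS1
    (by rw [mate1, if_neg (Ne.symm hXY)]; exact hF) fun r2 m2 t2 f2 dS2 same2 mate2 ht2 => ?_
  refine hQ _ _ _ (fun i hi => (f2 i hi).trans (f1 i hi)) dS2 (same1.trans same2) ?_ ?_
  · intro v
    rw [mate2, mate1]
    grind
  · have := hD X
    have := hD Y
    rw [same1.deg] at ht2
    omega

/-- Look for a free neighbour of `z`; if there is none, the result is `z` itself. -/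
def findFree (z : Ex) : Pr :=
  .seq (.set 13 (.lit 1)) (.seq (search z 0) (.ite .ne (.reg 12) (.lit 0)
    (.set 15 (.cell (.lit 2) (.reg 12) z (.lit 0)))
    (.seq (.set 15 z) (.seq (.set 13 (.lit 0))
      (.loop .lt (.reg 13) (.cell (.lit 3) (.lit 0) z (.lit 0))
        (.seq (.set 14 (.cell (.lit 2) (.lit 0) z (.reg 13)))
          (.ite .eq (.cell (.lit 0) (.lit 0) (.lit 0) (.reg 14)) (.lit 0)
            (.seq (.set 15 (.reg 14)) (.set 13 (.cell (.lit 3) (.lit 0) z (.lit 0))))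
            (.set 13 (.add (.reg 13) (.lit 1))))))))))

/-- Free in-neighbours sit in buckets with even keys `2 * d`, where `1 ≤ d ≤ D`, so one probe per
`d` suffices; the at most `D` out-neighbours are inspected directly. As there are no loops, `Z`
itself can serve as the answer "none". -/
theorem findFree_vc {n D : ℕ} {z : Ex} {Z : ℕ} {Q : St → Prop} {r₀ : ℕ → ℕ} {m₀ : Mem} {t₀ : ℕ}
    (hz : Atom n 12 r₀ z Z) (h2 : r₀ 2 = n) (hS : DS n m₀) (hn : 1 ≤ n)
    (hirr : ∀ a, ¬ Arc m₀ a a) (hD : ∀ v, deg m₀ v ≤ D)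
    (hQ1 : ∀ r' t' y, (∀ i < 12, r' i = r₀ i) → r' 15 = y → y ≠ Z → (Arc m₀ Z y ∨ Arc m₀ y Z) →
      m₀ 0 0 0 y = 0 → t' ≤ t₀ + 2000 * (D + 1) → Q ⟨r', m₀, t'⟩)
    (hQ0 : ∀ r' t', (∀ i < 12, r' i = r₀ i) → r' 15 = Z →
      (∀ y, Arc m₀ Z y ∨ Arc m₀ y Z → m₀ 0 0 0 y ≠ 0) → t' ≤ t₀ + 2000 * (D + 1) →
      Q ⟨r', m₀, t'⟩) : (findFree z).vc n Q ⟨r₀, m₀, t₀⟩ := by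
  have hB : base n = 2 * n + 8 := rfl
  have bz := hz.lt
  have cz := hz.cost
  have dl := hS.deg_le Z
  have dD := hD Z
  have d3 : m₀ 3 0 Z 0 = deg m₀ Z := rfl
  have ok : ∀ {r : ℕ → ℕ} (_ : ∀ i < 12, r i = r₀ i), z.Ok n r m₀ := fun h => hz.ok _ _ h
  have ev : ∀ {r : ℕ → ℕ} (_ : ∀ i < 12, r i = r₀ i), z.eval r m₀ = Z := fun h => hz.eval _ _ h
  have lvl : ∀ d, 1 ≤ d → m₀ 4 0 0 d ≠ 0 → d ≤ D := by
    intro d hd h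
    obtain ⟨v, -, hv⟩ := hS.exists_of_level (by omega) h
    exact hv.trans (hD v)
  have f0 : ∀ i < 12, Function.update r₀ 13 1 i = r₀ i := fun i hi => by
    rw [Function.update_of_ne (by omega)]
  refine ⟨by omega, by simp [Ex.Ok], ?_⟩
  simp only [Ex.eval, Pr.vc]
  refine search_vc (D := 1) (hz.mono le_rfl f0) (by omega) ((f0 2 (by omega)).trans h2) (by simp)
    (by omega) (fun d hd => hS.level_zero hd) ?_ ?_
  · intro r1 t1 d f1 e1 hle h4 hall ht1
    have g1 : ∀ i < 12, r1 i = r₀ i := fun i hi => (f1 i hi).trans (f0 i hi)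
    have hdD : d ≤ D + 1 := by
      by_contra hc
      have := lvl (D + 1) (by omega) (hall (D + 1) (by omega) (by omega)).1
      omega
    have hin : ∀ y, Arc m₀ y Z → m₀ 0 0 0 y ≠ 0 := by
      intro y hy h0
      have hk := hS.key_ne hy
      have hdp := hS.deg_pos hy
      have hdd : deg m₀ y < d := by
        by_contra hc
        exact hS.level_ne (d := d) (by omega) (hS.src hy) (by omega) h4
      have hke : keyM m₀ y = 2 * deg m₀ y := by
        unfold keyM deg; rw [if_pos h0]; rfl
      have hb := (hS.bucket y Z hk).2 ⟨hy, rfl⟩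
      have := ((hS.slots _ _).pos y hb).1
      rw [hke] at this hb
      rw [(hall _ hdp hdd).2.1] at this
      omega
    refine ⟨by simp [Ex.Ok], by simp [Ex.Ok], fun hc => ?_, fun _ => ?_⟩
    · exact absurd e1 (by simpa [Ex.eval, Cmp.Holds] using hc)
    simp only
    have g2 : ∀ i < 12, Function.update (Function.update r1 15 Z) 13 0 i = r₀ i := fun i hi => by
      rw [Function.update_of_ne (by omega), Function.update_of_ne (by omega), g1 i hi]
    refine ⟨by omega, ok g1, by omega, by simp [Ex.Ok], fun k T => (∀ i < 12, T.r i = r₀ i) ∧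
      T.m = m₀ ∧ T.r 13 ≤ deg m₀ Z ∧ T.r 13 + k = deg m₀ Z ∧
      T.t ≤ t₀ + 700 + 200 * D + 200 * T.r 13 ∧
      ((T.r 15 = Z ∧ ∀ y, Arc m₀ Z y → m₀ 1 0 Z y ≤ T.r 13 → m₀ 0 0 0 y ≠ 0) ∨
        (T.r 13 = deg m₀ Z ∧ Arc m₀ Z (T.r 15) ∧ m₀ 0 0 0 (T.r 15) = 0)),
      ⟨deg m₀ Z, ?_, rfl, ?_, ?_, ?_, Or.inl ⟨?_, ?_⟩⟩, ?_⟩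
    · simpa only [ev g1, Ex.eval] using g2
    · simp
    · simp
    · simp only [Ex.cost, Function.update_self] at *; omega
    · simp [ev g1]
    · intro y hy hp
      simp at hp
      exact absurd hp hy
    · rintro k ⟨r, m, t⟩ ⟨fr, em, hle', hk, ht, h⟩
      simp only at fr em hle' hk ht h
      subst em
      refine ⟨by simp [Ex.Ok], ?_, ?_, ?_⟩
      · simp [Ex.Ok, ok fr, Ex.eval, ev fr, hB]; omega
      · intro hlt
        simp only [Cmp.Holds, ev fr, d3] at hlt
        rcases h with ⟨e15, hall'⟩ | ⟨e13, -⟩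
        swap
        · omega
        obtain ⟨hyn, hyp⟩ := (hS.slots 0 Z).entry (r 13) hlt
        refine ⟨by omega, ?_, ?_⟩
        · simp [Ex.Ok, ok fr, Ex.eval, ev fr, hB]; omega
        simp only [ev fr]
        generalize hy : m 2 0 Z (r 13) = y at *
        have fr' : ∀ i < 12, Function.update r 14 y i = r₀ i := fun i hi => by
          rw [Function.update_of_ne (by omega), fr i hi]
        have hZy : Arc m Z y := by unfold Arc; omega
        refine ⟨?_, by simp [Ex.Ok], fun h0 => ?_, fun h0 => ?_⟩
        · simp [Ex.Ok, Ex.eval, hB]; omega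
        · simp [Cmp.Holds] at h0
          have fr2 : ∀ i < 12, Function.update (Function.update r 14 y) 15 y i = r₀ i := fun i hi => by
            rw [Function.update_of_ne (by omega), fr' i hi]
          simp only [Function.update_self]
          refine ⟨by omega, by simp [Ex.Ok], by omega, ?_, 0, by omega, ?_, trivial, ?_, ?_, ?_,
            Or.inr ⟨?_, ?_, ?_⟩⟩
          · simp [Ex.Ok, ok fr2, Ex.eval, ev fr2, hB]; omega
          · intro i hi
            rw [Function.update_of_ne (by omega), fr2 i hi]
          all_goals simp only [ev fr2, d3]
          · exact le_rfl
          · simp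
          · simp only [Ex.cost]; omega
          · simpa using hZy
          · simpa using h0
        · simp [Cmp.Holds] at h0
          refine ⟨by omega, ?_, k - 1, by omega, ?_, trivial, ?_, ?_, ?_, Or.inl ⟨?_, ?_⟩⟩
          · simp [Ex.Ok, Ex.eval]; omega
          · intro i hi
            rw [Function.update_of_ne (by omega), fr' i hi]
          · simp; omega
          · simp; omega
          · simp [Ex.cost]; omega
          · simp [e15]
          · intro v hv hp
            simp at hp
            by_cases hp' : m 1 0 Z v ≤ r 13
            · exact hall' v hv hp'
            · have e2 := ((hS.slots 0 Z).pos v hv).2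
              rw [show m 1 0 Z v - 1 = r 13 by omega, hy] at e2
              rwa [← e2]
      · intro hge
        simp only [Cmp.Holds, ev fr, d3, not_lt] at hge
        simp only [Ex.cost]
        rcases h with ⟨e15, hall'⟩ | ⟨-, hZy, h0⟩
        · refine hQ0 _ _ fr e15 (fun y hy => ?_) (by omega)
          rcases hy with hy | hy
          · exact hall' y hy (by have := hS.pos_le hy; omega)
          · exact hin y hy
        · refine hQ1 _ _ _ fr rfl ?_ (Or.inl hZy) h0 (by omega)
          intro hc
          rw [hc] at hZy
          exact hirr _ hZy
  · intro r1 t1 d f1 hle hdn h4 e1 hcnt ht1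
    have g1 : ∀ i < 12, r1 i = r₀ i := fun i hi => (f1 i hi).trans (f0 i hi)
    have hdD := lvl d hle h4
    have e1' : r1 12 = 2 * d := by omega
    have hne12 : r1 12 ≠ 0 := by omega
    refine ⟨by simp [Ex.Ok], by simp [Ex.Ok], fun _ => ?_, fun hc => ?_⟩
    swap
    · exact absurd (by simpa [Ex.eval, Cmp.Holds] using hc) hne12
    obtain ⟨hyn, hyp⟩ := (hS.slots (r1 12) Z).entry 0 (by omega)
    refine ⟨by omega, ?_, ?_⟩
    · simp [Ex.Ok, ok g1, Ex.eval, ev g1, hB]; omega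
    simp only [ev g1]
    generalize m₀ 2 (r1 12) Z 0 = y at *
    obtain ⟨hyx, hky⟩ := (hS.bucket y Z hne12).1 (by omega)
    refine hQ1 _ _ y (fun i hi => ?_) (by simp) ?_ (Or.inr hyx) ?_ ?_
    · rw [Function.update_of_ne (by omega), g1 i hi]
    · rintro rfl; exact hirr _ hyx
    · by_contra hc
      unfold keyM at hky
      rw [if_neg hc] at hky
      omega
    · simp only [Ex.cost] at *; omega

end RamLang

namespace RamLang

open WordRAM

/-- The function `f` describes a matching of the graph `A`, coded by `f v = x + 1` if `v` is
matched to `x` and `f v = 0` if `v` is free, such that no two adjacent vertices with the property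
`P` are free. -/
structure MaxMates (P : ℕ → Prop) (f : ℕ → ℕ) (A : ℕ → ℕ → Prop) : Prop where
  cons : ∀ v x, f v = x + 1 → f x = v + 1 ∧ A v x
  max : ∀ a b, A a b → P a → P b → f a ≠ 0 ∨ f b ≠ 0

/-- If `z` is free, match it to a free neighbour. -/
def rematch (z : Ex) : Pr :=
  .ite .eq (.cell (.lit 0) (.lit 0) (.lit 0) z) (.lit 0)
    (.seq (findFree z) (.ite .ne (.reg 15) z
      (.seq (.set 16 (.add (.reg 15) (.lit 1))) (.seq (.set 17 (.add z (.lit 1)))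
        (setPair z (.reg 16) (.reg 15) (.reg 17)))) .skip)) .skip

/-- Afterwards `Z` is matched or has no free neighbour, so it may join the vertices for which
maximality is guaranteed. Matching further vertices cannot destroy that guarantee elsewhere. -/
theorem rematch_vc {n D : ℕ} {z : Ex} {Z : ℕ} {P : ℕ → Prop} {A : ℕ → ℕ → Prop} {Q : St → Prop}
    {r₀ : ℕ → ℕ} {m₀ : Mem} {t₀ : ℕ} (hz : Atom n 12 r₀ z Z) (h2 : r₀ 2 = n) (hS : DS n m₀)
    (hZ : Z < n) (hA : Orients (Arc m₀) A) (hM : MaxMates P (m₀ 0 0 0) A)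
    (hD : ∀ v, deg m₀ v ≤ D)
    (hQ : ∀ r' m' t', (∀ i < 12, r' i = r₀ i) → DS n m' → SameArcs m₀ m' →
      MaxMates (fun v => P v ∨ v = Z) (m' 0 0 0) A → t' ≤ t₀ + 5000 * (D + 1) → Q ⟨r', m', t'⟩) :
    (rematch z).vc n Q ⟨r₀, m₀, t₀⟩ := by
  have hB : base n = 2 * n + 8 := rfl
  have bz := hz.lt
  have cz := hz.cost
  have ok : ∀ {r : ℕ → ℕ} (_ : ∀ i < 12, r i = r₀ i) m, z.Ok n r m := fun h m => hz.ok _ m h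
  have ev : ∀ {r : ℕ → ℕ} (_ : ∀ i < 12, r i = r₀ i) m, z.eval r m = Z := fun h m => hz.eval _ m h
  have f0 : ∀ i < 12, r₀ i = r₀ i := fun _ _ => rfl
  have symm : ∀ a b, A a b → A b a := fun a b h => (hA.adj _ _).2 ((hA.adj _ _).1 h).symm
  refine ⟨?_, by simp [Ex.Ok], fun h0 => ?_, fun h0 => ?_⟩
  · simp [Ex.Ok, ok f0, Ex.eval, ev f0, hB]; omega
  · simp only [Ex.eval, ev f0, Cmp.Holds] at h0
    simp only [Pr.vc]
    refine findFree_vc hz h2 hS (by omega) (fun a h => hA.irrefl h rfl) hD ?_ ?_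
    · intro r1 t1 y f1 e15 hyZ hy hy0 ht1
      have hyA : A Z y := (hA.adj _ _).2 hy
      have hyn : y < n := hy.elim hS.dst hS.src
      refine ⟨by simp [Ex.Ok], ok f1 _, fun _ => ?_, fun hc => ?_⟩
      swap
      · simp [Ex.eval, Cmp.Holds, ev f1, e15, hyZ] at hc
      simp only
      have g1 : ∀ v w, ∀ i < 12, Function.update (Function.update r1 16 v) 17 w i = r₀ i :=
        fun v w i hi => by
          rw [Function.update_of_ne (by omega), Function.update_of_ne (by omega), f1 i hi]
      have g0 : ∀ v, ∀ i < 12, Function.update r1 16 v i = r₀ i :=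
        fun v i hi => by rw [Function.update_of_ne (by omega), f1 i hi]
      refine ⟨by omega, ?_, by omega, ⟨ok (g0 _) _, by simp [Ex.Ok], ?_⟩, ?_⟩
      · simp [Ex.Ok, Ex.eval, e15]; omega
      · simp [ev (g0 _), Ex.eval]; omega
      simp only [Ex.eval, ev (g0 _), e15]
      refine setPair_vc (E := y + 1) (F := Z + 1) (hz.mono (by omega) (g1 _ _))
        (.reg (by omega) (by omega) (by simp) (by omega))
        (.reg (v := y) (by omega) (by omega) (by simp [e15]) (by omega))
        (.reg (by omega) (by omega) (by simp) (by omega)) hZ hyn (Ne.symm hyZ) hS (by simp [h0])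
        (by simp [hy0]) hD fun r2 m2 t2 f2 dS2 same2 mate2 ht2 => ?_
      refine hQ _ _ _ (fun i hi => (f2 i (by omega)).trans (g1 _ _ i hi)) dS2 same2 ⟨?_, ?_⟩ ?_
      · intro v x hv
        rw [mate2] at hv ⊢
        have c := hM.cons
        have c1 := c v x
        have := symm _ _ hyA
        by_cases hvZ : v = Z
        · rw [if_pos hvZ] at hv
          have hxy : x = y := by omega
          rw [hxy, if_neg hyZ, if_pos rfl, hvZ]
          exact ⟨rfl, hyA⟩
        · rw [if_neg hvZ] at hv
          by_cases hvy : v = y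
          · rw [if_pos hvy] at hv
            have hxZ : x = Z := by omega
            rw [hxZ, if_pos rfl, hvy]
            exact ⟨rfl, this⟩
          · rw [if_neg hvy] at hv
            have c1 := c1 hv
            rw [if_neg, if_neg]
            · exact c1
            · rintro rfl; omega
            · rintro rfl; omega
      · intro a b hab ha hb
        rw [mate2, mate2]
        have := hM.max a b hab
        split_ifs
        all_goals first | (left; omega) | (right; omega) | skip
        exact this (ha.resolve_right ‹_›) (hb.resolve_right ‹_›)
      · simp only [Ex.cost] at *; linarith
    · intro r1 t1 f1 e15 hall ht1
      refine ⟨by simp [Ex.Ok], ok f1 _, fun hc => ?_, fun _ => ?_⟩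
      · simp [Ex.eval, Cmp.Holds, ev f1, e15] at hc
      refine hQ _ _ _ f1 hS (fun _ _ _ _ => rfl) ⟨hM.cons, ?_⟩ ?_
      · intro a b hab ha hb
        by_cases haZ : a = Z
        · subst haZ; right; exact hall b ((hA.adj _ _).1 hab)
        · by_cases hbZ : b = Z
          · subst hbZ; left; exact hall a ((hA.adj _ _).1 (symm _ _ hab))
          · exact hM.max a b hab (ha.resolve_right haZ) (hb.resolve_right hbZ)
      · simp only [Ex.cost] at *; omega
  · simp only [Ex.eval, ev f0, Cmp.Holds] at h0
    refine hQ _ _ _ f0 hS (fun _ _ _ _ => rfl) ⟨hM.cons, ?_⟩ ?_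
    · intro a b hab ha hb
      by_cases haZ : a = Z
      · subst haZ; left; exact h0
      · by_cases hbZ : b = Z
        · subst hbZ; right; exact h0
        · exact hM.max a b hab (ha.resolve_right haZ) (hb.resolve_right hbZ)
    · simp only [Ex.cost]; omega

/-! ### The update programs -/

/-- The invariant of the data structure. -/
structure Inv (n γ : ℕ) (m : Mem) (A : ℕ → ℕ → Prop) : Prop where
  ds : DS n m
  valid : Valid γ m
  orients : Orients (Arc m) A
  mates : MaxMates (fun _ => True) (m 0 0 0) A

/-- Insertion of the edge between the vertices in registers `0` and `1`. -/
def insertPr : Pr :=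
  .seq (.ite .le (.cell (.lit 3) (.lit 0) (.reg 0) (.lit 0))
      (.cell (.lit 3) (.lit 0) (.reg 1) (.lit 0))
      (.seq (.set 10 (.reg 0)) (.set 11 (.reg 1))) (.seq (.set 10 (.reg 1)) (.set 11 (.reg 0))))
    (.seq insArc (.ite .eq (.cell (.lit 0) (.lit 0) (.lit 0) (.reg 0)) (.lit 0)
      (.ite .eq (.cell (.lit 0) (.lit 0) (.lit 0) (.reg 1)) (.lit 0)
        (.seq (.set 16 (.add (.reg 1) (.lit 1))) (.seq (.set 17 (.add (.reg 0) (.lit 1)))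
          (setPair (.reg 0) (.reg 16) (.reg 1) (.reg 17)))) .skip) .skip))

/-- The new edge is the only one that can violate maximality, and it does so only if both ends are
free; then the two are matched to each other. -/
theorem insertPr_vc {n γ D u v : ℕ} {A A' : ℕ → ℕ → Prop} {Q : St → Prop} {r₀ : ℕ → ℕ} {m₀ : Mem}
    {t₀ : ℕ} (hu : r₀ 0 = u) (hv : r₀ 1 = v) (h3 : r₀ 3 = γ) (hγ : 1 ≤ γ)
    (hun : u < n) (hvn : v < n) (huv : u ≠ v) (hI : Inv n γ m₀ A) (hA : ¬ A u v)
    (hA' : ∀ a b, A' a b ↔ A a b ∨ (a = u ∧ b = v) ∨ (a = v ∧ b = u)) (hD : ∀ v, deg m₀ v ≤ D)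
    (hQ : ∀ r' m' t', Inv n γ m' A' → t' ≤ t₀ + 10000 * (γ * (D + 1)) → Q ⟨r', m', t'⟩) :
    insertPr.vc n Q ⟨r₀, m₀, t₀⟩ := by
  have hB : base n = 2 * n + 8 := rfl
  obtain ⟨hS, hV, hO, hM⟩ := hI
  have narc : ¬ Arc m₀ u v ∧ ¬ Arc m₀ v u := by
    rw [hO.adj] at hA; tauto
  have hγD : 1 * (D + 1) ≤ γ * (D + 1) := Nat.mul_le_mul_right _ hγ
  have main : ∀ r t x h, (∀ i < 10, r i = r₀ i) → r 10 = x → r 11 = h →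
      ((x = u ∧ h = v) ∨ (x = v ∧ h = u)) → deg m₀ x ≤ deg m₀ h → t ≤ t₀ + 100 →
      (Pr.seq insArc (.ite .eq (.cell (.lit 0) (.lit 0) (.lit 0) (.reg 0)) (.lit 0)
      (.ite .eq (.cell (.lit 0) (.lit 0) (.lit 0) (.reg 1)) (.lit 0)
        (.seq (.set 16 (.add (.reg 1) (.lit 1))) (.seq (.set 17 (.add (.reg 0) (.lit 1)))
          (setPair (.reg 0) (.reg 16) (.reg 1) (.reg 17)))) .skip) .skip)).vc n Q ⟨r, m₀, t⟩ := by
    intro r t x h fr e10 e11 hxh hd ht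
    have hxA : Orients (fun a b => Arc m₀ a b ∨ (a = x ∧ b = h)) A' := by
      refine ⟨fun a b => ?_, fun a b => ?_⟩
      · rw [hA', hO.adj]
        rcases hxh with ⟨rfl, rfl⟩ | ⟨rfl, rfl⟩ <;> tauto
      · have := hO.anti a b
        rintro (h1 | ⟨rfl, rfl⟩) (h2 | ⟨h2, h2'⟩)
        · exact this h1 h2
        · subst h2 h2'
          rcases hxh with ⟨rfl, rfl⟩ | ⟨rfl, rfl⟩ <;> tauto
        · rcases hxh with ⟨rfl, rfl⟩ | ⟨rfl, rfl⟩ <;> tauto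
        · rcases hxh with ⟨rfl, rfl⟩ | ⟨rfl, rfl⟩ <;> omega
    refine insArc_vc ((fr 3 (by omega)).trans h3) hγ e10 e11 (by omega) (by omega) hS hV hxA
      (by rcases hxh with ⟨rfl, rfl⟩ | ⟨rfl, rfl⟩ <;> tauto) hd hD ?_
    intro r1 m1 t1 f1 dS1 vl1 or1 dg1 mt1 ht1
    have e0 : r1 0 = u := (f1 0 (by omega)).trans ((fr 0 (by omega)).trans hu)
    have e1 : r1 1 = v := (f1 1 (by omega)).trans ((fr 1 (by omega)).trans hv)
    have cons1 : ∀ a b, m1 0 0 0 a = b + 1 → m1 0 0 0 b = a + 1 ∧ A' a b := by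
      intro a b hab
      rw [mt1] at hab ⊢
      obtain ⟨h1, h2⟩ := hM.cons a b hab
      exact ⟨h1, (hA' _ _).2 (Or.inl h2)⟩
    have max1 : ∀ a b, A a b → m1 0 0 0 a ≠ 0 ∨ m1 0 0 0 b ≠ 0 := by
      intro a b hab
      rw [mt1, mt1]
      exact hM.max a b hab trivial trivial
    have done : m1 0 0 0 u ≠ 0 ∨ m1 0 0 0 v ≠ 0 → Inv n γ m1 A' := by
      intro h
      refine ⟨dS1, vl1, or1, cons1, fun a b hab _ _ => ?_⟩
      rcases (hA' _ _).1 hab with h1 | ⟨rfl, rfl⟩ | ⟨rfl, rfl⟩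
      · exact max1 a b h1
      · exact h
      · exact h.symm
    refine ⟨?_, by simp [Ex.Ok], fun hu0 => ⟨?_, by simp [Ex.Ok], fun hv0 => ?_, fun hv0 => ?_⟩,
      fun hu0 => ?_⟩
    · simp [Ex.Ok, Ex.eval, hB, e0]; omega
    · simp [Ex.Ok, Ex.eval, hB, e1]; omega
    · simp only [Ex.eval, Cmp.Holds, e0, e1] at hu0 hv0
      refine ⟨by omega, ?_, by omega, ?_, ?_⟩
      · simp [Ex.Ok, Ex.eval, e1]; omega
      · simp [Ex.Ok, Ex.eval, e0]; omega
      simp only [Ex.eval, Function.update_of_ne (show (0 : ℕ) ≠ 16 by omega), e0, e1]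
      -- The insertion may have raised an outdegree by one.
      refine setPair_vc (D := D + 1) (E := v + 1) (F := u + 1)
        (.reg (v := u) (by omega) (by omega) (by simp [e0]) (by omega))
        (.reg (by omega) (by omega) (by simp) (by omega))
        (.reg (v := v) (by omega) (by omega) (by simp [e1]) (by omega))
        (.reg (by omega) (by omega) (by simp) (by omega)) hun hvn huv dS1 (by simp [hu0])
        (by simp [hv0]) (fun a => (dg1 a).trans (Nat.succ_le_succ (hD a)))
        fun r2 m2 t2 f2 dS2 same2 mate2 ht2 => ?_
      refine hQ _ _ _ ⟨dS2, same2.valid vl1, by rw [same2.arc]; exact or1, ?_, ?_⟩ ?_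
      · intro a b hab
        rw [mate2] at hab ⊢
        have c := cons1 a b
        have auv := (hA' u v).2 (by tauto)
        have avu := (hA' v u).2 (by tauto)
        by_cases hau : a = u
        · rw [if_pos hau] at hab
          obtain rfl : b = v := by omega
          rw [if_neg (Ne.symm huv), if_pos rfl, hau]
          exact ⟨rfl, auv⟩
        · rw [if_neg hau] at hab
          by_cases hav : a = v
          · rw [if_pos hav] at hab
            obtain rfl : b = u := by omega
            rw [if_pos rfl, hav]
            exact ⟨rfl, avu⟩
          · rw [if_neg hav] at hab
            have c := c hab
            rw [if_neg, if_neg]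
            · exact c
            · rintro rfl; omega
            · rintro rfl; omega
      · intro a b hab _ _
        rw [mate2, mate2]
        rcases (hA' _ _).1 hab with h1 | ⟨rfl, rfl⟩ | ⟨rfl, rfl⟩
        · have := max1 a b h1
          split_ifs <;> omega
        · left; simp
        · right; simp
      · simp only [Ex.cost] at *; omega
    · simp only [Ex.eval, Cmp.Holds, e1] at hv0
      refine hQ _ _ _ (done (Or.inr hv0)) ?_
      simp only [Ex.cost] at *; omega
    · simp only [Ex.eval, Cmp.Holds, e0] at hu0
      refine hQ _ _ _ (done (Or.inl hu0)) ?_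
      simp only [Ex.cost] at *; omega
  have d3 : ∀ a, m₀ 3 0 a 0 = deg m₀ a := fun _ => rfl
  refine ⟨?_, ?_, fun hc => ⟨by omega, by simp [Ex.Ok], by omega, by simp [Ex.Ok], ?_⟩,
    fun hc => ⟨by omega, by simp [Ex.Ok], by omega, by simp [Ex.Ok], ?_⟩⟩
  · simp [Ex.Ok, Ex.eval, hB, hu]; omega
  · simp [Ex.Ok, Ex.eval, hB, hv]; omega
  · simp only [Ex.eval, Cmp.Holds, hu, hv, d3] at hc
    dsimp only
    refine main _ _ u v (fun i hi => ?_) ?_ ?_ (by tauto) hc ?_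
    · rw [Function.update_of_ne (by omega), Function.update_of_ne (by omega)]
    · simp [Ex.eval, hu]
    · simp [Ex.eval, hv]
    · simp only [Ex.cost]; omega
  · simp only [Ex.eval, Cmp.Holds, hu, hv, d3] at hc
    dsimp only
    refine main _ _ v u (fun i hi => ?_) ?_ ?_ (by tauto) (by omega) ?_
    · rw [Function.update_of_ne (by omega), Function.update_of_ne (by omega)]
    · simp [Ex.eval, hv]
    · simp [Ex.eval, hu]
    · simp only [Ex.cost]; omega

/-- Deletion of the edge between the vertices in registers `0` and `1`. -/
def deletePr : Pr :=
  .seq (.ite .ne (.cell (.lit 1) (.lit 0) (.reg 0) (.reg 1)) (.lit 0)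
      (.seq (.set 10 (.reg 0)) (.set 11 (.reg 1))) (.seq (.set 10 (.reg 1)) (.set 11 (.reg 0))))
    (.ite .eq (.cell (.lit 0) (.lit 0) (.lit 0) (.reg 0)) (.add (.reg 1) (.lit 1))
      (.seq (setPair (.reg 0) (.lit 0) (.reg 1) (.lit 0))
        (.seq delArc (.seq (rematch (.reg 0)) (rematch (.reg 1))))) delArc)

/-- Deleting an unmatched edge leaves the matching maximal. Deleting a matched one frees `u` and
`v`, and only edges at these two vertices can become violations; rematching them in turn restores
maximality. -/
theorem deletePr_vc {n γ D u v : ℕ} {A A' : ℕ → ℕ → Prop} {Q : St → Prop} {r₀ : ℕ → ℕ} {m₀ : Mem}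
    {t₀ : ℕ} (hu : r₀ 0 = u) (hv : r₀ 1 = v) (h2 : r₀ 2 = n) (hγ : 1 ≤ γ)
    (hI : Inv n γ m₀ A) (hA : A u v)
    (hA' : ∀ a b, A' a b ↔ A a b ∧ ¬ ((a = u ∧ b = v) ∨ (a = v ∧ b = u)))
    (hD : ∀ v, deg m₀ v ≤ D)
    (hQ : ∀ r' m' t', Inv n γ m' A' → t' ≤ t₀ + 30000 * (D + 1) → Q ⟨r', m', t'⟩) :
    deletePr.vc n Q ⟨r₀, m₀, t₀⟩ := by
  have hB : base n = 2 * n + 8 := rfl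
  obtain ⟨hS, hV, hO, hM⟩ := hI
  have huv : u ≠ v := by
    rcases (hO.adj _ _).1 hA with h | h
    · exact hO.irrefl h
    · exact (hO.irrefl h).symm
  have hun : u < n := ((hO.adj _ _).1 hA).elim hS.src hS.dst
  have hvn : v < n := ((hO.adj _ _).1 hA).elim hS.dst hS.src
  have main : ∀ r t x h, (∀ i < 10, r i = r₀ i) → r 10 = x → r 11 = h →
      ((x = u ∧ h = v) ∨ (x = v ∧ h = u)) → Arc m₀ x h → t ≤ t₀ + 100 →
      (Pr.ite .eq (.cell (.lit 0) (.lit 0) (.lit 0) (.reg 0)) (.add (.reg 1) (.lit 1))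
      (.seq (setPair (.reg 0) (.lit 0) (.reg 1) (.lit 0))
        (.seq delArc (.seq (rematch (.reg 0)) (rematch (.reg 1))))) delArc).vc n Q ⟨r, m₀, t⟩ := by
    intro r t x h fr e10 e11 hxh harc ht
    have back := hO.anti _ _ harc
    have hxA : Orients (fun a b => Arc m₀ a b ∧ ¬ (a = x ∧ b = h)) A' := by
      refine ⟨fun a b => ?_, fun a b h1 h2 => hO.anti a b h1.1 h2.1⟩
      rw [hA', hO.adj]
      rcases hxh with ⟨rfl, rfl⟩ | ⟨rfl, rfl⟩ <;> grind
    have e0 : r 0 = u := (fr 0 (by omega)).trans hu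
    have e1 : r 1 = v := (fr 1 (by omega)).trans hv
    have e2 : r 2 = n := (fr 2 (by omega)).trans h2
    refine ⟨?_, ?_, fun hm => ?_, fun hm => ?_⟩
    · simp [Ex.Ok, Ex.eval, hB, e0]; omega
    · simp [Ex.Ok, Ex.eval, e1]; omega
    · simp only [Ex.eval, Cmp.Holds, e0, e1] at hm
      have hm' := (hM.cons _ _ hm).1
      simp only [Pr.vc]
      refine setPair_vc (X := u) (Y := v) (.reg (by omega) (by omega) e0 (by omega))
        (.lit (by omega)) (.reg (by omega) (by omega) e1 (by omega)) (.lit (by omega)) hun hvn huv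
        hS (by simp [hm]) (by simp [hm']) hD fun r1 m1 t1 f1 dS1 same1 mate1 ht1 => ?_
      have arcs := same1.arc
      refine delArc_vc (X := x) (H := h) (A := A') (D := D) ((f1 2 (by omega)).trans e2) hγ
        ((f1 10 (by omega)).trans e10) ((f1 11 (by omega)).trans e11) dS1 (same1.valid hV)
        (by rw [arcs]; exact hxA) (by rw [arcs]; exact harc) (by rw [arcs]; exact back)
        (fun a => by rw [same1.deg]; exact hD a) fun r2 m2 t2 f2 dS2 vl2 or2 dg2 mt2 ht2 => ?_
      have hD2 : ∀ a, deg m2 a ≤ D := fun a => (dg2 a).trans (by rw [same1.deg]; exact hD a)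
      -- Maximality is asserted only away from the two freed vertices, which the two calls of
      -- `rematch` add back.
      have hM2 : MaxMates (fun a => a ≠ u ∧ a ≠ v) (m2 0 0 0) A' := by
        refine ⟨fun a b hab => ?_, fun a b hab ha hb => ?_⟩
        · rw [mt2, mate1] at hab
          rw [mt2, mate1, hA']
          have hau : a ≠ u := by rintro rfl; simp at hab
          have hav : a ≠ v := by rintro rfl; simp at hab
          rw [if_neg hau, if_neg hav] at hab
          obtain ⟨h1, h2⟩ := hM.cons a b hab
          rw [if_neg, if_neg]
          · exact ⟨h1, h2, by tauto⟩
          · rintro rfl; omega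
          · rintro rfl; omega
        · rw [mt2, mt2, mate1, mate1, if_neg ha.1, if_neg ha.2, if_neg hb.1, if_neg hb.2]
          exact hM.max a b ((hA' _ _).1 hab).1 trivial trivial
      refine rematch_vc (Z := u) (.reg (by omega) (by omega) ((f2 0 (by omega)).trans
        ((f1 0 (by omega)).trans e0)) (by omega)) ((f2 2 (by omega)).trans
        ((f1 2 (by omega)).trans e2)) dS2 hun or2 hM2 hD2 fun r3 m3 t3 f3 dS3 same3 hM3 ht3 => ?_
      refine rematch_vc (Z := v) (.reg (by omega) (by omega) ((f3 1 (by omega)).trans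
        ((f2 1 (by omega)).trans ((f1 1 (by omega)).trans e1))) (by omega))
        ((f3 2 (by omega)).trans ((f2 2 (by omega)).trans ((f1 2 (by omega)).trans e2))) dS3 hvn
        (by rw [same3.arc]; exact or2) hM3 (fun a => by rw [same3.deg]; exact hD2 a)
        fun r4 m4 t4 f4 dS4 same4 hM4 ht4 => ?_
      have same24 := same3.trans same4
      refine hQ _ _ _ ⟨dS4, same24.valid vl2, by rw [same24.arc]; exact or2, hM4.cons,
        fun a b hab _ _ => hM4.max a b hab (by tauto) (by tauto)⟩ ?_
      simp only [Ex.cost] at *; linarith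
    · simp only [Ex.eval, Cmp.Holds, e0, e1] at hm
      refine delArc_vc (A := A') e2 hγ e10 e11 hS hV hxA harc back hD
        fun r1 m1 t1 f1 dS1 vl1 or1 dg1 mt1 ht1 => ?_
      refine hQ _ _ _ ⟨dS1, vl1, or1, fun a b hab => ?_, fun a b hab _ _ => ?_⟩ ?_
      · rw [mt1] at hab
        rw [mt1, hA']
        obtain ⟨h1, h2⟩ := hM.cons a b hab
        refine ⟨h1, h2, ?_⟩
        rintro (⟨rfl, rfl⟩ | ⟨rfl, rfl⟩)
        · exact hm hab
        · exact hm h1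
      · rw [mt1, mt1]
        exact hM.max a b ((hA' _ _).1 hab).1 trivial trivial
      · simp only [Ex.cost] at *; linarith
  refine ⟨?_, by simp [Ex.Ok], fun hc => ⟨by omega, by simp [Ex.Ok], by omega, by simp [Ex.Ok], ?_⟩,
    fun hc => ⟨by omega, by simp [Ex.Ok], by omega, by simp [Ex.Ok], ?_⟩⟩
  · simp [Ex.Ok, Ex.eval, hB, hu, hv]; omega
  · simp only [Ex.eval, Cmp.Holds, hu, hv] at hc
    dsimp only
    refine main _ _ u v (fun i hi => ?_) ?_ ?_ (by tauto) hc ?_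
    · rw [Function.update_of_ne (by omega), Function.update_of_ne (by omega)]
    · simp [Ex.eval, hu]
    · simp [Ex.eval, hv]
    · simp only [Ex.cost]; omega
  · simp only [Ex.eval, Cmp.Holds, hu, hv] at hc
    dsimp only
    refine main _ _ v u (fun i hi => ?_) ?_ ?_ (by tauto)
      (((hO.adj _ _).1 hA).resolve_left hc) ?_
    · rw [Function.update_of_ne (by omega), Function.update_of_ne (by omega)]
    · simp [Ex.eval, hv]
    · simp [Ex.eval, hu]
    · simp only [Ex.cost]; omega

/-- The zero memory is a legal initial state because level counts are demanded only for `d ≠ 0`: for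
`d = 0` the count would have to be `n`. -/
theorem Inv.zero (n γ : ℕ) : Inv n γ (fun _ _ _ _ => 0) fun _ _ => False where
  ds := by
    refine ⟨fun k y => ⟨by simp, by simp⟩, fun h => absurd rfl h, by simp [Arc], fun d hd => ?_⟩
    rw [eq_comm, Finset.card_eq_zero, Finset.filter_eq_empty_iff]
    intro v _ hv
    exact hd (Nat.le_zero.1 hv)
  valid := fun x y h => absurd rfl h
  orients := ⟨by simp [Arc], by simp [Arc]⟩
  mates := ⟨by simp, by simp⟩

end RamLang

namespace RamLang

/-! ### Arboricity and outdegrees -/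

theorem arboricity_spec {V : Type*} [Fintype V] (G : SimpleGraph V) :
    1 ≤ arboricity G ∧ ∀ U : Finset V, U.Nonempty →
      (G.induce (U : Set V)).edgeSet.ncard ≤ arboricity G * (U.card - 1) := by
  classical
  refine Nat.sInf_mem (s := {a : ℕ | 1 ≤ a ∧ ∀ U : Finset V, U.Nonempty →
    (G.induce (U : Set V)).edgeSet.ncard ≤ a * (U.card - 1)})
    -- A crude admissible value. A one-element set, for which the right-hand side vanishes, spans no
    -- edges.
    ⟨1 + ∑ U : Finset V, (G.induce (U : Set V)).edgeSet.ncard, by omega, fun U hU => ?_⟩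
  rcases Nat.lt_or_ge 1 U.card with h | h
  · have h1 : (G.induce (U : Set V)).edgeSet.ncard ≤
        ∑ U : Finset V, (G.induce (U : Set V)).edgeSet.ncard :=
      Finset.single_le_sum (f := fun U : Finset V => (G.induce (U : Set V)).edgeSet.ncard)
        (fun _ _ => Nat.zero_le _) (Finset.mem_univ U)
    refine h1.trans ((Nat.le_add_left _ 1).trans (Nat.le_mul_of_pos_right _ (by omega)))
  · have hsub : Subsingleton (U : Set V) := by
      rw [Set.subsingleton_coe]
      exact fun a ha b hb => Finset.card_le_one.1 h a ha b hb
    have : (G.induce (U : Set V)).edgeSet = ∅ := by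
      rw [SimpleGraph.edgeSet_eq_empty]
      ext a b
      simp only [SimpleGraph.bot_adj, iff_false]
      intro hab
      exact hab.ne (Subsingleton.elim a b)
    rw [this]
    simp

theorem one_le_arboricity {V : Type*} [Fintype V] (G : SimpleGraph V) : 1 ≤ arboricity G :=
  (arboricity_spec G).1

theorem arboricity_mono {V : Type*} [Fintype V] {G H : SimpleGraph V} (h : G ≤ H) :
    arboricity G ≤ arboricity H := by
  refine Nat.sInf_le ⟨one_le_arboricity H, fun U hU => le_trans ?_ ((arboricity_spec H).2 U hU)⟩
  exact Set.ncard_le_ncard (SimpleGraph.edgeSet_mono (SimpleGraph.comap_monotone _ h))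
    (Set.toFinite _)

-- Antisymmetry makes the map from arcs to undirected edges injective, so the edge bound of the
-- arboricity also bounds arcs.
open Classical in
theorem card_arcs_le {V : Type*} [Fintype V] (G : SimpleGraph V) {R : V → V → Prop}
    (hR : ∀ a b, R a b → G.Adj a b) (hanti : ∀ a b, R a b → ¬ R b a) {U : Finset V}
    (hU : U.Nonempty) :
    ((U ×ˢ U).filter fun p => R p.1 p.2).card ≤ arboricity G * (U.card - 1) := by
  refine le_trans ?_ ((arboricity_spec G).2 U hU)
  rw [← Set.ncard_image_of_injective _ (Sym2.map.injective Subtype.val_injective)]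
  have hinj : Set.InjOn (fun p : V × V => s(p.1, p.2))
      ((U ×ˢ U).filter fun p => R p.1 p.2 : Finset (V × V)) := by
    rintro ⟨a, b⟩ hab ⟨c, d⟩ hcd he
    simp only [Finset.coe_filter, Set.mem_ofPred_eq] at hab hcd
    rcases Sym2.eq_iff.1 he with ⟨h1, h2⟩ | ⟨h1, h2⟩
    · exact Prod.ext h1 h2
    · simp only at h1 h2
      subst h1 h2
      exact absurd hcd.2 (hanti _ _ hab.2)
  rw [← Finset.card_image_of_injOn hinj, ← Set.ncard_coe_finset]
  refine Set.ncard_le_ncard ?_ (Set.toFinite _)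
  intro e he
  simp only [Finset.coe_image, Set.mem_image, Finset.coe_filter, Set.mem_ofPred_eq,
    Finset.mem_product] at he
  obtain ⟨⟨a, b⟩, ⟨⟨ha, hb⟩, hab⟩, rfl⟩ := he
  exact ⟨s(⟨a, ha⟩, ⟨b, hb⟩), hR _ _ hab, rfl⟩

/-! ### Expansion: bounded arboricity forces small outdegrees -/

open Classical in
/-- The vertices that can be reached from `v₀` by at most `k` steps. -/
noncomputable def reach {V : Type*} [Fintype V] (R : V → V → Prop) (v₀ : V) :
    ℕ → Finset V
  | 0 => {v₀}
  | k + 1 => reach R v₀ k ∪ (reach R v₀ k).biUnion fun x => {y | R x y}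

-- All arcs leaving the set `W` reached in `k` steps end in the next set `W'`. Counting them gives
-- `β * a * |W| ≤ a * |W'|`, that is, expansion by the factor `β`.
open Classical in
theorem pow_le_card_reach {V : Type*} [Fintype V] {G : SimpleGraph V} {R : V → V → Prop}
    (hR : ∀ a b, R a b → G.Adj a b) (hanti : ∀ a b, R a b → ¬ R b a) {d : V → ℕ}
    (hd : ∀ x y, R x y → d x ≤ d y + 1) {β a : ℝ} (hβ : 0 ≤ β) (ha : arboricity G ≤ a)
    (hout : ∀ x, β * a ≤ d x → β * a ≤ (Finset.univ.filter (R x)).card) (v₀ : V) (k : ℕ) :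
    (∀ x ∈ reach R v₀ k, d v₀ ≤ d x + k) ∧
      (β * a + k ≤ d v₀ + 1 → β ^ k ≤ (reach R v₀ k).card) := by
  induction k with
  | zero => simp [reach]
  | succ k ih =>
    obtain ⟨ih1, ih2⟩ := ih
    refine ⟨?_, fun hk => ?_⟩
    · intro x hx
      simp only [reach, Finset.mem_union, Finset.mem_biUnion, Finset.mem_filter] at hx
      rcases hx with hx | ⟨y, hy, -, hyx⟩
      · have := ih1 x hx; omega
      · have := ih1 y hy
        have := hd _ _ hyx
        omega
    · push_cast at hk
      have ih2 := ih2 (by linarith)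
      set W := reach R v₀ k with hW
      set W' := reach R v₀ (k + 1) with hW'
      have hsub : W ⊆ W' := Finset.subset_union_left
      have hv : v₀ ∈ W := by
        clear_value W'
        rw [hW]
        clear * -
        induction k with
        | zero => simp [reach]
        | succ k ih => exact Finset.mem_union_left _ ih
      have hne : W'.Nonempty := ⟨v₀, hsub hv⟩
      have hcard := card_arcs_le G hR hanti hne
      have h1 : ∑ x ∈ W, (Finset.univ.filter (R x)).card ≤
          ((W' ×ˢ W').filter fun p => R p.1 p.2).card := by
        rw [Finset.card_filter, Finset.sum_product]
        refine (Finset.sum_le_sum fun x hx => ?_).trans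
          (Finset.sum_le_sum_of_subset hsub)
        rw [← Finset.card_filter]
        refine Finset.card_le_card fun y hy => ?_
        simp only [Finset.mem_filter, Finset.mem_univ, true_and] at hy ⊢
        refine ⟨?_, hy⟩
        rw [hW', reach]
        refine Finset.mem_union_right _ (Finset.mem_biUnion.2 ⟨x, hx, by simpa using hy⟩)
      have h2 : (W.card : ℝ) * (β * a) ≤ ((∑ x ∈ W, (Finset.univ.filter (R x)).card : ℕ) : ℝ) := by
        push_cast
        rw [← nsmul_eq_mul]
        -- A vertex reached in `k` steps has lost at most `k` from the outdegree of `v₀`, so by `hk`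
        -- it is still at the threshold `β * a`.
        refine Finset.card_nsmul_le_sum _ _ _ fun x hx => hout x ?_
        have : (d v₀ : ℝ) ≤ d x + k := by exact_mod_cast ih1 x hx
        linarith
      have h3 : ((∑ x ∈ W, (Finset.univ.filter (R x)).card : ℕ) : ℝ) ≤ a * W'.card := by
        have : ∑ x ∈ W, (Finset.univ.filter (R x)).card ≤ arboricity G * W'.card :=
          h1.trans (hcard.trans (Nat.mul_le_mul_left _ (Nat.sub_le _ _)))
        calc ((∑ x ∈ W, (Finset.univ.filter (R x)).card : ℕ) : ℝ)
            ≤ ((arboricity G * W'.card : ℕ) : ℝ) := by exact_mod_cast this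
          _ = arboricity G * W'.card := by push_cast; ring
          _ ≤ a * W'.card := by gcongr
      have ha0 : 0 < a := lt_of_lt_of_le (by exact_mod_cast one_le_arboricity G) ha
      have h4 : a * (β * W.card) ≤ a * W'.card := by linarith
      have h5 := le_of_mul_le_mul_left h4 ha0
      calc β ^ (k + 1) = β * β ^ k := by ring
        _ ≤ β * W.card := by gcongr
        _ ≤ W'.card := h5

theorem le_degBound {n : ℕ} {G : SimpleGraph (Fin n)} {R : Fin n → Fin n → Prop}
    (hR : ∀ a b, R a b → G.Adj a b) (hanti : ∀ a b, R a b → ¬ R b a) {d : Fin n → ℕ}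
    (hd : ∀ x y, R x y → d x ≤ d y + 1) {β : ℝ} (hβ : 1 < β) {a : ℕ} (ha : arboricity G ≤ a)
    (hout : ∀ x, β * a ≤ d x → ∃ S : Finset (Fin n), (∀ y ∈ S, R x y) ∧ β * a ≤ S.card)
    (v : Fin n) : (d v : ℝ) ≤ degBound n a β := by
  classical
  have hn : (1 : ℝ) ≤ n := by exact_mod_cast (Nat.zero_lt_of_lt v.2)
  unfold degBound
  by_cases h : β * a ≤ d v
  swap
  · have := Real.logb_nonneg hβ hn
    push Not at h
    linarith
  -- The largest number of steps that the expansion permits. It exceeds `d v - β * a`, so `k ≤ log_β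
  -- n` is just what is needed.
  set k := ⌊(d v : ℝ) - β * a⌋₊ + 1 with hk
  have hk1 : (d v : ℝ) - β * a < k := by
    rw [hk]; push_cast; exact Nat.lt_floor_add_one _
  have hk2 : (k : ℝ) ≤ d v - β * a + 1 := by
    rw [hk]; push_cast
    have := Nat.floor_le (sub_nonneg.2 h)
    linarith
  have := (pow_le_card_reach (G := G) hR hanti hd (β := β) (a := a) (by linarith)
    (by exact_mod_cast ha) (fun x hx => ?_) v k).2 (by linarith)
  · have hc : ((reach R v k).card : ℝ) ≤ n := by
      exact_mod_cast (Finset.card_le_univ _).trans (by simp)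
    have hle : (k : ℝ) ≤ Real.logb β n := by
      rw [Real.le_logb_iff_rpow_le hβ (by linarith), Real.rpow_natCast]
      exact this.trans hc
    linarith
  · obtain ⟨S, hS, hc⟩ := hout x hx
    refine hc.trans ?_
    exact_mod_cast Finset.card_le_card fun y hy => by simp [hS y hy]

/-! ### The degree bound for the stored orientation -/

/-- A graph on `Fin n` as a relation on the natural numbers. -/
def natAdj {n : ℕ} (G : SimpleGraph (Fin n)) (a b : ℕ) : Prop :=
  ∃ (ha : a < n) (hb : b < n), G.Adj ⟨a, ha⟩ ⟨b, hb⟩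

theorem natAdj_coe {n : ℕ} (G : SimpleGraph (Fin n)) (a b : Fin n) :
    natAdj G a b ↔ G.Adj a b := ⟨fun ⟨_, _, h⟩ => h, fun h => ⟨a.2, b.2, h⟩⟩

/-- The expansion is applied to arcs along which the outdegree falls by at most one; by validity the
newest `γ` arcs of each vertex are among them. If `n ≤ γ`, these are all its arcs, and the
truncation of the parameter at `n` does no harm. -/
theorem Inv.deg_le_degBound {n γ : ℕ} {G : SimpleGraph (Fin n)} {m : Mem}
    (hI : Inv n γ m (natAdj G)) {β : ℝ} (hβ : 1 < β) {a : ℕ} (ha : arboricity G ≤ a)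
    (hγ : β * a ≤ γ ∨ n ≤ γ) (v : Fin n) : (deg m v : ℝ) ≤ degBound n a β := by
  refine le_degBound (G := G) (R := fun x y : Fin n => Arc m x y ∧ deg m x ≤ deg m y + 1)
    (d := fun x => deg m x) ?_ ?_ (fun x y h => h.2) hβ ha ?_ v
  · intro x y h
    exact (natAdj_coe G x y).1 ((hI.orients.adj _ _).2 (Or.inl h.1))
  · intro x y h h'
    exact hI.orients.anti _ _ h.1 h'.1
  · intro x hx
    have hdn := hI.ds.deg_le x
    -- The newest out-neighbours, counted from the end of the list.
    let f : Fin (min γ (deg m x)) → Fin n := fun j =>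
      ⟨m 2 0 x (deg m x - 1 - j), ((hI.ds.slots 0 x).entry (deg m x - 1 - j)
        (by have := j.2; unfold deg at *; omega)).1⟩
    have hf : ∀ j, m 1 0 x (f j) = deg m x - 1 - j + 1 := fun j =>
      ((hI.ds.slots 0 x).entry (deg m x - 1 - j) (by have := j.2; unfold deg at *; omega)).2
    have hinj : Function.Injective f := by
      intro i j hij
      have h1 := hf i
      have h2 := hf j
      rw [hij, h2] at h1
      have := i.2
      have := j.2
      exact Fin.ext (by omega)
    refine ⟨Finset.univ.map ⟨f, hinj⟩, ?_, ?_⟩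
    · intro y hy
      simp only [Finset.mem_map, Finset.mem_univ, true_and, Function.Embedding.coeFn_mk] at hy
      obtain ⟨j, rfl⟩ := hy
      have hj := hf j
      have hj2 := j.2
      have harc : Arc m x (f j) := by unfold Arc; omega
      refine ⟨harc, ?_⟩
      have hva := hI.valid _ _ harc
      by_contra hc
      -- A drop by two or more would force the position to be at most `deg m x - γ`, but `j < γ`
      -- makes it larger.
      have : γ * 1 ≤ γ * (deg m x - deg m (f j) - 1) := Nat.mul_le_mul_left _ (by omega)
      omega
    · rw [Finset.card_map, Finset.card_univ, Fintype.card_fin]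
      rcases hγ with h | h
      · push_cast
        exact le_min h hx
      · rwa [min_eq_right (by omega)]

end RamLang

namespace RamLang

open WordRAM DynAlg

/-! ### The algorithm -/

/-- The machine code of a program that expects the register `99` to hold `base n`. -/
def machineCode (p : Pr) : Cmd :=
  .seq (.arith .add 99 2 2) (.seq (.const 100 8) (.seq (.arith .add 99 99 100) p.comp))

/-- The algorithm. -/
def algorithm : DynAlg := ⟨machineCode insertPr, machineCode deletePr⟩

/-- The machine memory `M` holds `m`. -/
def Holds (n : ℕ) (M : ℕ → ℕ) (m : Mem) : Prop :=
  ∀ t k y x, t < base n → k < base n → y < base n → x < base n → M (enc n t k y x) = m t k y x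

/-- The initial registers. -/
def inputReg (n γ u v : ℕ) : ℕ → ℕ := fun i => match i with
  | 0 => u
  | 1 => v
  | 2 => n
  | 3 => γ
  | _ => 0

theorem call_of_vc {w n γ : ℕ} (hw : base n ^ 4 ≤ 2 ^ w) {p : Pr} {Q : St → Prop} {u v : Fin n}
    {M : ℕ → ℕ} {m : Mem} (hM : Holds n M m) (h : p.vc n Q ⟨inputReg n γ u v, m, 0⟩) :
    ∃ t M' S, Call w n γ (machineCode p) u v M (t + 3) M' ∧ Holds n M' S.m ∧ S.t = t ∧ Q S := by
  have hB : base n < 2 ^ w := by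
    refine lt_of_lt_of_le ?_ hw
    have : 1 < base n := by unfold base; omega
    calc base n = base n ^ 1 := (pow_one _).symm
      _ < base n ^ 4 := Nat.pow_lt_pow_right this (by omega)
  have hB' : base n = 2 * n + 8 := rfl
  obtain ⟨t, s', S', hr, hrel, ht, hQ⟩ := p.vc_sound hw (s := ⟨Function.update (Function.update
    (Function.update (inputReg n γ u v) 99 (n + n)) 100 8) 99 (base n), M⟩) h
    ⟨fun i hi => by
      simp only
      rw [Function.update_of_ne (by omega), Function.update_of_ne (by omega),
        Function.update_of_ne (by omega)], by simp, hM⟩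
  refine ⟨t, s'.mem, S', ⟨s'.reg, ?_⟩, hrel.mem, by simpa using ht.symm, hQ⟩
  have e1 : (n + n) % 2 ^ w = n + n := Nat.mod_eq_of_lt (by omega)
  have e2 : 8 % 2 ^ w = 8 := Nat.mod_eq_of_lt (by omega)
  have e3 : (n + n + 8) % 2 ^ w = base n := by
    rw [Nat.mod_eq_of_lt (by omega)]; omega
  have hr' : Run w p.comp ⟨Function.update (Function.update (Function.update
      (inputReg n γ u v) 99 ((n + n) % 2 ^ w)) 100 (8 % 2 ^ w)) 99
      ((Function.update (Function.update (inputReg n γ u v) 99 ((n + n) % 2 ^ w)) 100 (8 % 2 ^ w) 99 +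
        Function.update (Function.update (inputReg n γ u v) 99 ((n + n) % 2 ^ w)) 100
          (8 % 2 ^ w) 100) % 2 ^ w), M⟩ t s' := by
    simpa only [e1, e2, Function.update_self,
      Function.update_of_ne (show (99 : ℕ) ≠ 100 by omega), e3] using hr
  rw [show t + 3 = 1 + (1 + (1 + t)) by omega]
  exact Run.seq _ _ _ _ _ _ _ (Run.arith (w := w) .add 99 2 2 ⟨inputReg n γ u v, M⟩)
    (Run.seq _ _ _ _ _ _ _ (Run.const 100 8 _) (Run.seq _ _ _ _ _ _ _
      (Run.arith .add 99 99 100 _) hr'))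

/-! ### Correctness and running time on the word RAM -/

/-- The machine memory `M` stores the graph `G` together with a maximal matching. -/
structure Stores {n : ℕ} (γ : ℕ) (G : SimpleGraph (Fin n)) (M : ℕ → ℕ) (m : Mem) : Prop where
  holds : Holds n M m
  inv : Inv n γ m (natAdj G)

theorem DS.deg_le_of_fin {n D : ℕ} {m : Mem} (h : DS n m) (hD : ∀ v : Fin n, deg m v ≤ D) (v : ℕ) :
    deg m v ≤ D := by
  by_cases hv : v < n
  · exact hD ⟨v, hv⟩
  · by_contra hc
    have : 0 < m 3 0 v 0 := by unfold deg at hc; omega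
    have := (h.slots 0 v).entry 0 this
    exact hv (h.src (y := m 2 0 v 0) (by unfold Arc; omega))

theorem natAdj_sup_edge {n : ℕ} (G : SimpleGraph (Fin n)) {u v : Fin n} (h : u ≠ v) (a b : ℕ) :
    natAdj (G ⊔ SimpleGraph.edge u v) a b ↔
      natAdj G a b ∨ (a = u ∧ b = v) ∨ (a = v ∧ b = u) := by
  constructor
  · rintro ⟨ha, hb, hab⟩
    rw [SimpleGraph.sup_adj, SimpleGraph.edge_adj] at hab
    rcases hab with hab | ⟨⟨h1, h2⟩ | ⟨h1, h2⟩, -⟩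
    · exact Or.inl ⟨ha, hb, hab⟩
    · exact Or.inr (Or.inl ⟨congrArg Fin.val h1, congrArg Fin.val h2⟩)
    · exact Or.inr (Or.inr ⟨congrArg Fin.val h1, congrArg Fin.val h2⟩)
  · rintro (⟨ha, hb, hab⟩ | ⟨rfl, rfl⟩ | ⟨rfl, rfl⟩)
    · exact ⟨ha, hb, Or.inl hab⟩
    · exact ⟨u.2, v.2, by simp [SimpleGraph.sup_adj, SimpleGraph.edge_adj, h]⟩
    · exact ⟨v.2, u.2, by simp [SimpleGraph.sup_adj, SimpleGraph.edge_adj, h.symm]⟩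

theorem natAdj_deleteEdges {n : ℕ} (G : SimpleGraph (Fin n)) (u v : Fin n) (a b : ℕ) :
    natAdj (G.deleteEdges {s(u, v)}) a b ↔
      natAdj G a b ∧ ¬ ((a = u ∧ b = v) ∨ (a = v ∧ b = u)) := by
  unfold natAdj
  simp only [SimpleGraph.deleteEdges_adj, Set.mem_singleton_iff, Sym2.eq_iff, Fin.ext_iff]
  exact ⟨fun ⟨ha, hb, h, h'⟩ => ⟨⟨ha, hb, h⟩, h'⟩, fun ⟨⟨ha, hb, h⟩, h'⟩ => ⟨ha, hb, h, h'⟩⟩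

theorem Stores.insert {w n γ D : ℕ} (hw : base n ^ 4 ≤ 2 ^ w) (hγ : 1 ≤ γ)
    {G : SimpleGraph (Fin n)} {M : ℕ → ℕ} {m : Mem} (h : Stores γ G M m) {u v : Fin n}
    (huv : u ≠ v) (hG : ¬ G.Adj u v) (hD : ∀ v : Fin n, deg m v ≤ D) :
    ∃ t M' m', Call w n γ algorithm.ins u v M t M' ∧
      Stores γ (G ⊔ SimpleGraph.edge u v) M' m' ∧ t ≤ 10003 * (γ * (D + 1)) := by
  obtain ⟨t, M', S, hc, hM', rfl, hI, ht⟩ := call_of_vc (γ := γ) (u := u) (v := v) hw h.holds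
    (p := insertPr) (Q := fun S => Inv n γ S.m (natAdj (G ⊔ SimpleGraph.edge u v)) ∧
      S.t ≤ 0 + 10000 * (γ * (D + 1)))
    (insertPr_vc rfl rfl rfl hγ u.2 v.2 (fun hc => huv (Fin.ext hc)) h.inv
      (by rwa [← natAdj_coe] at hG) (natAdj_sup_edge G huv) (h.inv.ds.deg_le_of_fin hD)
      (fun r' m' t' h1 h2 => ⟨h1, h2⟩))
  refine ⟨_, M', S.m, hc, ⟨hM', hI⟩, ?_⟩
  have : 1 * 1 ≤ γ * (D + 1) := Nat.mul_le_mul hγ (by omega)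
  omega

theorem Stores.delete {w n γ D : ℕ} (hw : base n ^ 4 ≤ 2 ^ w) (hγ : 1 ≤ γ)
    {G : SimpleGraph (Fin n)} {M : ℕ → ℕ} {m : Mem} (h : Stores γ G M m) {u v : Fin n}
    (hG : G.Adj u v) (hD : ∀ v : Fin n, deg m v ≤ D) :
    ∃ t M' m', Call w n γ algorithm.del u v M t M' ∧
      Stores γ (G.deleteEdges {s(u, v)}) M' m' ∧ t ≤ 30003 * (D + 1) := by
  obtain ⟨t, M', S, hc, hM', rfl, hI, ht⟩ := call_of_vc (γ := γ) (u := u) (v := v) hw h.holds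
    (p := deletePr) (Q := fun S => Inv n γ S.m (natAdj (G.deleteEdges {s(u, v)})) ∧
      S.t ≤ 0 + 30000 * (D + 1))
    (deletePr_vc rfl rfl rfl hγ h.inv
      (by rwa [← natAdj_coe] at hG) (natAdj_deleteEdges G u v) (h.inv.ds.deg_le_of_fin hD)
      (fun r' m' t' h1 h2 => ⟨h1, h2⟩))
  exact ⟨_, M', S.m, hc, ⟨hM', hI⟩, by omega⟩

/-- The quadruple `(0, 0, 0, v)` has address `v`, so the mates lie exactly where they are to be
displayed. A larger matching adds nothing: each of its edges has an end that is matched already, and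
the partner there is unique. -/
theorem Stores.displays {n γ : ℕ} {G : SimpleGraph (Fin n)} {M : ℕ → ℕ} {m : Mem}
    (h : Stores γ G M m) :
    ∃ S : G.Subgraph, Maximal SimpleGraph.Subgraph.IsMatching S ∧ Displays M S := by
  have hmate : ∀ v : Fin n, M v = m 0 0 0 v := by
    intro v
    have := v.2
    have hB : base n = 2 * n + 8 := rfl
    have := h.holds 0 0 0 v (by omega) (by omega) (by omega) (by omega)
    rwa [show enc n 0 0 0 v = v by simp [enc]] at this
  have cons : ∀ v x : Fin n, M v = x + 1 → M x = v + 1 ∧ G.Adj v x := by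
    intro v x hv
    rw [hmate] at hv
    rw [hmate]
    have := h.inv.mates.cons v x hv
    rwa [natAdj_coe] at this
  have ex : ∀ v : Fin n, M v ≠ 0 → ∃ x : Fin n, M v = x + 1 := by
    intro v hv
    obtain ⟨y, hy⟩ := Nat.exists_eq_succ_of_ne_zero hv
    have hc := h.inv.mates.cons v y (by rw [← hmate]; exact hy)
    obtain ⟨-, hyn, -⟩ := hc.2
    exact ⟨⟨y, hyn⟩, hy⟩
  let S : G.Subgraph :=
    { verts := {v | M v ≠ 0}
      Adj := fun v x => M v = x + 1
      adj_sub := fun {v x} hvx => (cons v x hvx).2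
      edge_vert := fun {v x} hvx => by
        change M v ≠ 0
        omega
      symm := ⟨fun v x hvx => (cons v x hvx).1⟩ }
  refine ⟨S, ⟨?_, ?_⟩, fun v => ⟨?_, fun x => Iff.rfl⟩⟩
  · intro v hv
    obtain ⟨x, hx⟩ := ex v hv
    refine ⟨x, hx, fun y hy => ?_⟩
    have hy : M v = y + 1 := hy
    exact Fin.ext (by omega)
  · intro S' hS' hle
    have key : ∀ a b, S'.Adj a b → M a ≠ 0 → M a = b + 1 := by
      intro a b hab ha
      obtain ⟨x, hx⟩ := ex a ha
      have hax : S'.Adj a x := hle.2 hx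
      rw [← hS'.eq_of_adj_left hax hab]
      exact hx
    have sub : ∀ a b, S'.Adj a b → M a = b + 1 := by
      intro a b hab
      have hG := S'.adj_sub hab
      have hmax := h.inv.mates.max a b ((natAdj_coe G a b).2 hG) trivial trivial
      rw [← hmate, ← hmate] at hmax
      rcases hmax with ha | hb
      · exact key a b hab ha
      · exact (cons b a (key b a hab.symm hb)).1
    refine ⟨fun v hv => ?_, fun a b hab => sub a b hab⟩
    obtain ⟨x, hx, -⟩ := hS' hv
    have := sub v x hx
    change M v ≠ 0
    omega
  · change M v = 0 ↔ ¬ (M v ≠ 0)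
    simp

theorem arboricity_bot {n : ℕ} : arboricity (⊥ : SimpleGraph (Fin n)) ≤ 1 := by
  refine Nat.sInf_le ⟨le_rfl, fun U _ => ?_⟩
  have : ((⊥ : SimpleGraph (Fin n)).induce (U : Set (Fin n))) = ⊥ := by
    ext a b; simp
  rw [this]
  simp

/-- Reachability speaks of arbitrary halting calls; determinism of the machine identifies each with
the verified run. Time is irrelevant here, so the trivial bound `n` on outdegrees is used. -/
theorem Stores.of_reaches {w n γ α : ℕ} (hw : base n ^ 4 ≤ 2 ^ w) (hγ : 2 ≤ n → 1 ≤ γ)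
    (hα : 1 ≤ α) {G : SimpleGraph (Fin n)} {M : ℕ → ℕ} (h : algorithm.Reaches w n γ α G M) :
    arboricity G ≤ α ∧ ∃ m, Stores γ G M m := by
  have two : ∀ {u v : Fin n}, u ≠ v → 2 ≤ n := by
    intro u v huv
    have := u.2
    have := v.2
    by_contra hc
    exact huv (Fin.ext (by omega))
  induction h with
  | start =>
    refine ⟨arboricity_bot.trans hα, fun _ _ _ _ => 0, fun _ _ _ _ _ _ _ _ => rfl, ?_⟩
    convert Inv.zero n γ using 1
    funext a b
    simp [natAdj]
  | insert G M M' u v t _ huv hG harb hcall ih =>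
    obtain ⟨-, m, hm⟩ := ih
    obtain ⟨t', M'', m', hc, hs, -⟩ := hm.insert hw (hγ (two huv)) huv hG
      (fun v => hm.inv.ds.deg_le v)
    obtain ⟨r1, h1⟩ := hcall
    obtain ⟨r2, h2⟩ := hc
    have := (h1.deterministic h2).2
    simp only [State.mk.injEq] at this
    rw [this.2]
    exact ⟨harb, m', hs⟩
  | delete G M M' u v t _ hG hcall ih =>
    obtain ⟨harb, m, hm⟩ := ih
    obtain ⟨t', M'', m', hc, hs, -⟩ := hm.delete hw (hγ (two hG.ne)) hG
      (fun v => hm.inv.ds.deg_le v)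
    obtain ⟨r1, h1⟩ := hcall
    obtain ⟨r2, h2⟩ := hc
    have := (h1.deterministic h2).2
    simp only [State.mk.injEq] at this
    rw [this.2]
    exact ⟨(arboricity_mono (SimpleGraph.deleteEdges_le _)).trans harb, m', hs⟩

theorem base_pow_le {n w : ℕ} (h : (n + 2) ^ 12 ≤ 2 ^ w) : base n ^ 4 ≤ 2 ^ w := by
  refine le_trans ?_ h
  rw [show 12 = 3 * 4 from rfl, pow_mul]
  refine Nat.pow_le_pow_left ?_ 4
  unfold base
  calc 2 * n + 8 ≤ (n + 2) * (2 * 2) := by omega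
    _ ≤ (n + 2) * ((n + 2) * (n + 2)) := by gcongr <;> omega
    _ = (n + 2) ^ 3 := by ring

/-- The program sees only `γ`, so the analysis may choose a different `β` for every graph. An
insertion works with the outdegrees before it, and monotonicity of the arboricity expresses their
bound through the graph after it. -/
theorem algorithm_maintains {w n γ α : ℕ} (hw : (n + 2) ^ 12 ≤ 2 ^ w) (hα : 1 ≤ α)
    {insTime delTime : SimpleGraph (Fin n) → ℝ} (hγ : 2 ≤ n → 1 ≤ γ)
    (hT : 2 ≤ n → ∀ G : SimpleGraph (Fin n), arboricity G ≤ α → ∃ β : ℝ, 1 < β ∧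
      (β * arboricity G ≤ γ ∨ n ≤ γ) ∧
      30003 * (γ * (degBound n (arboricity G) β + 1)) ≤ insTime G ∧
      30003 * (degBound n (arboricity G) β + 1) ≤ delTime G) :
    algorithm.MaintainsMaximalMatching w n γ α insTime delTime := by
  have hw := base_pow_le hw
  intro G M hR
  obtain ⟨harb, m, hm⟩ := Stores.of_reaches hw hγ hα hR
  have two : ∀ {u v : Fin n}, u ≠ v → 2 ≤ n := by
    intro u v huv
    have := u.2
    have := v.2
    by_contra hc
    exact huv (Fin.ext (by omega))
  refine ⟨hm.displays, fun u v huv hG harb' => ?_, fun u v hG => ?_⟩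
  · have h2 := two huv
    obtain ⟨β, hβ, hβγ, hins, -⟩ := hT h2 _ harb'
    have hd := fun x => hm.inv.deg_le_degBound hβ
      (arboricity_mono (le_sup_left : G ≤ G ⊔ SimpleGraph.edge u v)) hβγ x
    set B := degBound n (arboricity (G ⊔ SimpleGraph.edge u v)) β with hB
    have hB0 : 0 ≤ B := le_trans (Nat.cast_nonneg _) (hd u)
    obtain ⟨t, M', m', hc, -, ht⟩ := hm.insert hw (hγ h2) huv hG (D := ⌊B⌋₊)
      (fun x => Nat.le_floor (hd x))
    refine ⟨t, M', hc, le_trans ?_ hins⟩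
    have ht' : (t : ℝ) ≤ 10003 * (γ * (⌊B⌋₊ + 1)) := by exact_mod_cast ht
    have hfl := Nat.floor_le hB0
    have : (γ : ℝ) * (⌊B⌋₊ + 1) ≤ γ * (B + 1) := by gcongr
    have : 0 ≤ (γ : ℝ) * (B + 1) := by positivity
    linarith
  · have h2 := two hG.ne
    obtain ⟨β, hβ, hβγ, -, hdel⟩ := hT h2 _ harb
    have hd := fun x => hm.inv.deg_le_degBound hβ le_rfl hβγ x
    set B := degBound n (arboricity G) β with hB
    have hB0 : 0 ≤ B := le_trans (Nat.cast_nonneg _) (hd u)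
    obtain ⟨t, M', m', hc, -, ht⟩ := hm.delete hw (hγ h2) hG (D := ⌊B⌋₊)
      (fun x => Nat.le_floor (hd x))
    refine ⟨t, M', hc, le_trans ?_ hdel⟩
    have ht' : (t : ℝ) ≤ 30003 * (⌊B⌋₊ + 1) := by exact_mod_cast ht
    have hfl := Nat.floor_le hB0
    linarith

end RamLang

namespace RamLang

open DynAlg

/-! ### The choice of the parameter -/

theorem one_le_degBound {n a : ℕ} (hn : 1 ≤ n) (ha : 1 ≤ a) {β : ℝ} (hβ : 1 < β) :
    1 ≤ degBound n a β := by
  unfold degBound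
  have h1 : 0 ≤ Real.logb β n := Real.logb_nonneg hβ (by exact_mod_cast hn)
  have h2 : (1 : ℝ) ≤ a := by exact_mod_cast ha
  nlinarith

/-- Both summands are nonnegative. Values of `β` that do at least as well as `2` are thus bounded
above through the first and away from `1` through the second, and a continuous function attains its
minimum on the resulting compact interval. -/
theorem exists_isLeast_degBound {n a : ℕ} (hn : 2 ≤ n) (ha : 1 ≤ a) :
    ∃ β : ℝ, 1 < β ∧ ∀ β' : ℝ, 1 < β' → degBound n a β ≤ degBound n a β' := by
  have hL : 0 < Real.log n := Real.log_pos (by exact_mod_cast hn)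
  have ha' : (1 : ℝ) ≤ a := by exact_mod_cast ha
  set F := degBound n a 2 with hF
  have hlog2 : 0 < Real.log 2 := Real.log_pos (by norm_num)
  have hF1 : Real.log n / Real.log 2 ≤ F := by
    rw [hF]; unfold degBound Real.logb; linarith
  have hF2 : 2 ≤ F := by
    have : 0 < Real.log n / Real.log 2 := by positivity
    rw [hF]; unfold degBound Real.logb; linarith
  have hF0 : 0 < F := by linarith
  have hexp : 1 < Real.exp (Real.log n / F) := by
    rw [Real.one_lt_exp_iff]; positivity
  have mem : ∀ β : ℝ, 1 < β → degBound n a β ≤ F → β ∈ Set.Icc (Real.exp (Real.log n / F)) F := by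
    intro β hβ h
    unfold degBound Real.logb at h
    have hlog : 0 < Real.log β := Real.log_pos hβ
    have h0 : 0 < Real.log n / Real.log β := by positivity
    constructor
    · rw [← Real.le_log_iff_exp_le (by linarith), div_le_iff₀ hF0]
      have : Real.log n / Real.log β ≤ F := by nlinarith
      rw [div_le_iff₀ hlog] at this
      linarith
    · nlinarith
  have hcont : ContinuousOn (degBound n a) (Set.Icc (Real.exp (Real.log n / F)) F) := by
    unfold degBound Real.logb
    refine ContinuousOn.add (by fun_prop) (ContinuousOn.div continuousOn_const ?_ ?_)
    · exact Real.continuousOn_log.mono fun x hx => by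
        have : 0 < x := by linarith [hx.1]
        simpa using this.ne'
    · intro x hx
      exact (Real.log_pos (lt_of_lt_of_le hexp hx.1)).ne'
  obtain ⟨β, hβ, hmin⟩ := isCompact_Icc.exists_isMinOn ⟨2, mem 2 (by norm_num) le_rfl⟩ hcont
  refine ⟨β, lt_of_lt_of_le hexp hβ.1, fun β' hβ' => ?_⟩
  rcases le_or_gt (degBound n a β') F with h | h
  · exact hmin (mem β' hβ' h)
  · exact (hmin (mem 2 (by norm_num) le_rfl)).trans h.le

theorem optDegBound_eq {n a : ℕ} {β : ℝ} (hβ : 1 < β)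
    (h : ∀ β' : ℝ, 1 < β' → degBound n a β ≤ degBound n a β') :
    degBound n a β = optDegBound n a := by
  unfold optDegBound
  have : Nonempty (Set.Ioi (1 : ℝ)) := ⟨⟨β, hβ⟩⟩
  refine le_antisymm (le_ciInf fun β' => h β' β'.2) ?_
  exact ciInf_le (f := fun β : Set.Ioi (1 : ℝ) => degBound n a β)
    ⟨degBound n a β, by rintro _ ⟨β', rfl⟩; exact h β' β'.2⟩ ⟨β, hβ⟩

/-- The parameter is tuned to `α`, while the claimed bound is optimal for the current arboricity
`a`. If the optimum `b` for `a` is too large for the parameter, then `β' = β * α / a`, the largest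
value with `β' * a ≤ β * α`, does no worse: passing from `β` to `y = b * a / α` does not pay for
`α`, and scaling both by `α / a` makes the logarithmic gain of such a step smaller still. -/
theorem exists_degBound_le_optDegBound {n a α : ℕ} (hn : 2 ≤ n) (ha : 1 ≤ a) (haα : a ≤ α) {β : ℝ}
    (hβ : 1 < β) (h : ∀ β' : ℝ, 1 < β' → degBound n α β ≤ degBound n α β') :
    ∃ β' : ℝ, 1 < β' ∧ β' * a ≤ β * α ∧ degBound n a β' ≤ optDegBound n a := by
  obtain ⟨b, hb, hmin⟩ := exists_isLeast_degBound hn ha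
  rw [← optDegBound_eq hb hmin]
  by_cases hba : b * a ≤ β * α
  · exact ⟨b, hb, hba, le_rfl⟩
  push Not at hba
  have hL : 0 < Real.log n := Real.log_pos (by exact_mod_cast hn)
  have ha0 : (0 : ℝ) < a := by exact_mod_cast ha
  have hα0 : (0 : ℝ) < α := by exact_mod_cast (lt_of_lt_of_le ha haα)
  have hle : (a : ℝ) ≤ α := by exact_mod_cast haα
  set c : ℝ := α / a with hc
  have hc1 : 1 ≤ c := by rw [hc, le_div_iff₀ ha0]; linarith
  have hca : c * a = α := div_mul_cancel₀ _ ha0.ne'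
  set y : ℝ := b / c with hy
  have hcy : y * c = b := div_mul_cancel₀ _ (by linarith)
  have hyβ : β < y := by
    have : β * (c * a) < y * (c * a) := by rw [hca, ← hca, ← mul_assoc y, hcy, hca]; exact hba
    exact lt_of_mul_lt_mul_right this (by rw [hca]; exact hα0.le)
  have hs : 0 < Real.log β := Real.log_pos hβ
  have hst : Real.log β < Real.log y := Real.log_lt_log (by linarith) hyβ
  have hδ : 0 ≤ Real.log c := Real.log_nonneg hc1
  have hopt := h y (by linarith)
  refine ⟨β * c, by nlinarith, by rw [mul_assoc, hca], ?_⟩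
  unfold degBound Real.logb at hopt ⊢
  rw [mul_assoc, hca, ← hcy, mul_assoc, hca, Real.log_mul (by linarith) (by linarith),
    Real.log_mul (by linarith) (by linarith)]
  set s := Real.log β
  set t := Real.log y
  set δ := Real.log c
  -- The reciprocal flattens out: shifting both arguments to the right shrinks the difference of its
  -- values.
  have key : 1 / (s + δ) - 1 / (t + δ) ≤ 1 / s - 1 / t := by
    have ht : 0 < t := by linarith
    rw [div_sub_div _ _ (by linarith) (by linarith), div_sub_div _ _ hs.ne' ht.ne']
    have e1 : 1 * (t + δ) - (s + δ) * 1 = t - s := by ring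
    have e2 : 1 * t - s * 1 = t - s := by ring
    rw [e1, e2]
    refine div_le_div_of_nonneg_left (by linarith) (by positivity) ?_
    exact mul_le_mul (by linarith) (by linarith) ht.le (by linarith)
  have key' := mul_le_mul_of_nonneg_left key hL.le
  have e : ∀ x : ℝ, Real.log n / x = Real.log n * (1 / x) := fun x => by ring
  rw [e, e] at hopt ⊢
  linarith

theorem algorithm_maintains_min {n α w : ℕ} {β : ℝ} (hα : 1 ≤ α) (hβ : 1 < β)
    (hw : (n + 2) ^ 12 ≤ 2 ^ w) {T : SimpleGraph (Fin n) → ℝ}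
    (hT : 2 ≤ n → ∀ G : SimpleGraph (Fin n), arboricity G ≤ α → ∃ β' : ℝ, 1 < β' ∧
      β' * arboricity G ≤ β * α ∧ degBound n (arboricity G) β' ≤ T G) :
    algorithm.MaintainsMaximalMatching w n (min ⌈β * α⌉₊ n) α
      (fun G => 120012 * (α * β * T G)) (fun G => 120012 * T G) := by
  have hα' : (1 : ℝ) ≤ α := by exact_mod_cast hα
  have hβα : 1 < β * α := by nlinarith
  refine algorithm_maintains hw hα (fun hn => ?_) fun hn G hG => ?_
  · exact le_min (Nat.ceil_pos.2 (by linarith)) (by omega)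
  obtain ⟨β', hβ', hle, hD⟩ := hT hn G hG
  have hD1 := one_le_degBound (n := n) (by omega) (one_le_arboricity G) hβ'
  refine ⟨β', hβ', ?_, ?_, by linarith⟩
  · rcases le_total ⌈β * α⌉₊ n with h | h
    · left
      rw [min_eq_left h]
      exact hle.trans (Nat.le_ceil _)
    · right
      rw [min_eq_right h]
  -- Rounding up costs a factor `2` since `β * α > 1`. Another factor `2` absorbs the `+ 1` next to
  -- the degree bound, whence `120012 = 4 * 30003`.
  · have hγ : ((min ⌈β * α⌉₊ n : ℕ) : ℝ) ≤ 2 * (α * β) := by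
      have h1 : ((min ⌈β * α⌉₊ n : ℕ) : ℝ) ≤ (⌈β * α⌉₊ : ℝ) := by exact_mod_cast min_le_left _ _
      have h2 := Nat.ceil_lt_add_one (show 0 ≤ β * α by linarith)
      linarith
    have h3 : ((min ⌈β * α⌉₊ n : ℕ) : ℝ) * (degBound n (arboricity G) β' + 1) ≤
        2 * (α * β) * (2 * T G) :=
      mul_le_mul hγ (by linarith) (by linarith) (by nlinarith)
    linarith

theorem algorithm_maintains_two {n α w : ℕ} (hα : 1 ≤ α) (hw : (n + 2) ^ 12 ≤ 2 ^ w) :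
    algorithm.MaintainsMaximalMatching w n (min (2 * α) n) α
      (fun _ => 30003 * (2 * α) * ((2 * α + 2) / Real.log 2) * Real.log n)
      (fun _ => 30003 * (2 * α) * ((2 * α + 2) / Real.log 2) * Real.log n) := by
  have hα' : (1 : ℝ) ≤ α := by exact_mod_cast hα
  have hlog2 : 0 < Real.log 2 := Real.log_pos (by norm_num)
  refine algorithm_maintains hw hα (fun hn => by omega) fun hn G hG => ⟨2, by norm_num, ?_, ?_⟩
  · rcases le_total (2 * α) n with h | h
    · left
      rw [min_eq_left h]
      exact_mod_cast Nat.mul_le_mul_left 2 hG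
    · right
      rw [min_eq_right h]
  have hG' : (arboricity G : ℝ) ≤ α := by exact_mod_cast hG
  have hlog : Real.log 2 ≤ Real.log n := Real.log_le_log (by norm_num) (by exact_mod_cast hn)
  -- Updates need two vertices, so the binary logarithm is at least `1` and absorbs the additive
  -- terms depending on `α`.
  have hq : 1 ≤ Real.log n / Real.log 2 := by rwa [le_div_iff₀ hlog2, one_mul]
  have hD : degBound n (arboricity G) 2 + 1 ≤ (2 * α + 2) / Real.log 2 * Real.log n := by
    rw [div_mul_eq_mul_div, mul_div_assoc]
    unfold degBound Real.logb
    nlinarith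
  have hD1 := one_le_degBound (n := n) (by omega) (one_le_arboricity G) (β := 2) (by norm_num)
  have hγ : ((min (2 * α) n : ℕ) : ℝ) ≤ 2 * α := by exact_mod_cast min_le_left _ _
  have h1 : ((min (2 * α) n : ℕ) : ℝ) * (degBound n (arboricity G) 2 + 1) ≤
      2 * α * ((2 * α + 2) / Real.log 2 * Real.log n) :=
    mul_le_mul hγ hD (by linarith) (by linarith)
  refine ⟨by linarith, ?_⟩
  nlinarith

end RamLang

theorem mainTheorem4 :
    ∃ (A : DynAlg) (k : ℕ) (C : ℝ), 1 ≤ k ∧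
      -- every choice of the parameter `β > 1`
      (∀ (n α w : ℕ) (β : ℝ), 1 ≤ α → 1 < β → (n + 2) ^ k ≤ 2 ^ w →
        A.MaintainsMaximalMatching w n (min ⌈β * α⌉₊ n) α
          (fun G => C * (α * β * degBound n (arboricity G) β))
          (fun G => C * degBound n (arboricity G) β)) ∧
      -- the optimal choice of `β`, for which the bound becomes the infimum
      (∀ n α : ℕ, 2 ≤ n → 1 ≤ α → ∃ β : ℝ, 1 < β ∧ degBound n α β = optDegBound n α ∧
        ∀ w : ℕ, (n + 2) ^ k ≤ 2 ^ w →
          A.MaintainsMaximalMatching w n (min ⌈β * α⌉₊ n) α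
            (fun G => C * (α * β * optDegBound n (arboricity G)))
            (fun G => C * optDegBound n (arboricity G))) ∧
      -- graphs of constant arboricity, with `β = 2`
      (∀ α : ℕ, 1 ≤ α → ∃ C' : ℝ, ∀ n w : ℕ, (n + 2) ^ k ≤ 2 ^ w →
        A.MaintainsMaximalMatching w n (min (2 * α) n) α
          (fun _ => C' * Real.log n) (fun _ => C' * Real.log n)) := by
  refine ⟨RamLang.algorithm, 12, 120012, by norm_num, ?_, ?_, ?_⟩
  · intro n α w β hα hβ hw
    refine RamLang.algorithm_maintains_min hα hβ hw fun _ G hG => ⟨β, hβ, ?_, le_rfl⟩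
    have : (arboricity G : ℝ) ≤ α := by exact_mod_cast hG
    gcongr
  · intro n α hn hα
    obtain ⟨β, hβ, h⟩ := RamLang.exists_isLeast_degBound hn hα
    exact ⟨β, hβ, RamLang.optDegBound_eq hβ h, fun w hw => RamLang.algorithm_maintains_min hα hβ hw
      fun _ G hG => RamLang.exists_degBound_le_optDegBound hn (RamLang.one_le_arboricity G) hG hβ h⟩
  · intro α hα
    exact ⟨_, fun n w hw => RamLang.algorithm_maintains_two hα hw⟩
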